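/- Let $\Bbbk$ be a commutative ring and let $(H,\mathcal{R})$ be a triangular Hopf algebra over $\Bbbk$: $\mathcal{R}\in H\otimes H$ is invertible with $\mathcal{R}^{-1}=\mathcal{R}_{21}$, $\Delta_{21}(\xi)=\mathcal{R}\Delta(\xi)\mathcal{R}^{-1}$ for $\xi\in H$, $(\Delta\otimes\mathrm{id})(\mathcal{R})=\mathcal{R}_{13}\mathcal{R}_{23}$ and $(\mathrm{id}\otimes\Delta)(\mathcal{R})=\mathcal{R}_{13}\mathcal{R}_{12}$. Write $\mathcal{R}^{-1}=\mathcal{R}_1^{-1}\otimes\mathcal{R}_2^{-1}$ and $\Delta(\xi)=\xi_{(1)}\otimes\xi_{(2)}$ (finite sums understood). Let $\mathcal{A}$ be an associative unital left $H$-module algebra that is braided commutative: $ba=(\mathcal{R}_1^{-1}\rhd a)(\mathcal{R}_2^{-1}\rhd b)$. $H$ acts on $\mathrm{End}_\Bbbk(\mathcal{A})$ by $(\xi\rhd X)(a)=\xi_{(1)}\rhd X(S(\xi_{(2)})\rhd a)$. Let $\mathrm{Der}_\mathcal{R}(\mathcal{A})$ be the $\Bbbk$-module of braided derivations, i.e.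 of the $X\in\mathrm{End}_\Bbbk(\mathcal{A})$ with $X(ab)=X(a)b+(\mathcal{R}_1^{-1}\rhd a)(\mathcal{R}_2^{-1}\rhd X)(b)$. It has the $H$-action above, the $\mathcal{A}$-actions $(a\cdot X)(b)=aX(b)$ and $X\cdot a=(\mathcal{R}_1^{-1}\rhd a)\cdot(\mathcal{R}_2^{-1}\rhd X)$, and the braided commutator $[X,Y]_\mathcal{R}=XY-(\mathcal{R}_1^{-1}\rhd Y)(\mathcal{R}_2^{-1}\rhd X)$. Let $\mathrm{T}^\bullet=\mathcal{A}\oplus\mathrm{Der}_\mathcal{R}(\mathcal{A})\oplus(\mathrm{Der}_\mathcal{R}(\mathcal{A})\otimes_\mathcal{A}\mathrm{Der}_\mathcal{R}(\mathcal{A}))\oplus\cdots$ be the tensor algebra of this $\mathcal{A}$-bimodule, with the diagonal $H$-action. For $1\le i<j\le n$ let $\sigma_{ij}\colon\mathrm{T}^n\to\mathrm{T}^n$ be the braided exchange of the $i$-th and $j$-th factors, $$X_1\otimes_{\mathcal A}\cdots\otimes_{\mathcal A} X_n\mapsto X_1\otimes_{\mathcal A}\cdots\otimes_{\mathcal A}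 X_{i-1}\otimes_{\mathcal A}\Big(\mathcal{R}_1'^{-1}\rhd\big((\mathcal{R}_1^{-1}\rhd X_j)\otimes_{\mathcal A}(\mathcal{R}_2^{-1}\rhd(X_{i+1}\otimes_{\mathcal A}\cdots\otimes_{\mathcal A} X_{j-1}))\big)\Big)\otimes_{\mathcal A}(\mathcal{R}_2'^{-1}\rhd X_i)\otimes_{\mathcal A} X_{j+1}\otimes_{\mathcal A}\cdots\otimes_{\mathcal A} X_n,$$ where $\mathcal{R}'^{-1}$ is a second copy of $\mathcal{R}^{-1}$. The braided multivector fields $(\mathfrak{X}^\bullet_\mathcal{R}(\mathcal{A}),\wedge_\mathcal{R})$ are the quotient of $\mathrm{T}^\bullet$ by the two-sided ideal generated by all $T\in\mathrm{T}^n$ (finite sums of factorizing tensors) with $\sigma_{ij}(T)=T$ for some $n$ and some $i<j$; $\mathcal{A}$ acts on the left and right by multiplication, and $\mathfrak{X}^n_\mathcal{R}(\mathcal{A})$ is the image of $\mathrm{T}^n$. **Proposition.** (1) The $H$-actions on $\mathcal{A}$ and on tensors of braided derivations induce a unique $H$-module structure on $\mathfrak{X}^\bullet_\mathcal{R}(\mathcal{A})$.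 With it $\mathfrak{X}^\bullet_\mathcal{R}(\mathcal{A})$ is an associative unital graded algebra with $\mathfrak{X}^0_\mathcal{R}(\mathcal{A})\cong\mathcal{A}$ and $\mathfrak{X}^1_\mathcal{R}(\mathcal{A})\cong\mathrm{Der}_\mathcal{R}(\mathcal{A})$ via the canonical maps, the $H$-action preserves degrees, the product is $H$-equivariant, and $\mathfrak{X}^\bullet_\mathcal{R}(\mathcal{A})$ is an $H$-equivariant braided symmetric $\mathcal{A}$-bimodule: $x\cdot a=(\mathcal{R}_1^{-1}\rhd a)\cdot(\mathcal{R}_2^{-1}\rhd x)$. (2) There is a unique $\Bbbk$-bilinear map $\llbracket\cdot,\cdot\rrbracket_\mathcal{R}$ on $\mathfrak{X}^\bullet_\mathcal{R}(\mathcal{A})$, the braided Schouten–Nijenhuis bracket, such that for all $a,b\in\mathcal{A}$, $k,\ell>0$ and $X_1,\dots,X_k,Y_1,\dots,Y_\ell\in\mathrm{Der}_\mathcal{R}(\mathcal{A})$, with $\wedge=\wedge_\mathcal{R}$: $\llbracket a,b\rrbracket_\mathcal{R}=0$, $$\llbracket X_1\wedge\cdots\wedge X_k,a\rrbracket_\mathcal{R}=\sum_{i=1}^k(-1)^{k-i}X_1\wedge\cdots\wedge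 X_{i-1}\wedge X_i(\mathcal{R}_1^{-1}\rhd a)\wedge\big(\mathcal{R}_2^{-1}\rhd(X_{i+1}\wedge\cdots\wedge X_k)\big),$$ $$\llbracket a,X_1\wedge\cdots\wedge X_k\rrbracket_\mathcal{R}=\sum_{i=1}^k(-1)^{i}\big(\mathcal{R}_{1(1)}^{-1}\rhd(X_1\wedge\cdots\wedge X_{i-1})\big)\wedge(\mathcal{R}_{1(2)}^{-1}\rhd X_i)(\mathcal{R}_2^{-1}\rhd a)\wedge X_{i+1}\wedge\cdots\wedge X_k,$$ $$\begin{aligned}\llbracket X_1\wedge\cdots\wedge X_k,Y_1\wedge\cdots\wedge Y_\ell\rrbracket_\mathcal{R}=\sum_{i=1}^k\sum_{j=1}^\ell&(-1)^{i+j}[\mathcal{R}_1^{-1}\rhd X_i,\mathcal{R}_1'^{-1}\rhd Y_j]_\mathcal{R}\wedge\Big(\mathcal{R}_2'^{-1}\rhd\big((\mathcal{R}_2^{-1}\rhd(X_1\wedge\cdots\wedge X_{i-1}))\\&\wedge X_{i+1}\wedge\cdots\wedge X_k\wedge Y_1\wedge\cdots\wedge Y_{j-1}\big)\Big)\wedge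 Y_{j+1}\wedge\cdots\wedge Y_\ell.\end{aligned}$$ (3) This bracket maps $\mathfrak{X}^k_\mathcal{R}(\mathcal{A})\times\mathfrak{X}^\ell_\mathcal{R}(\mathcal{A})$ to $\mathfrak{X}^{k+\ell-1}_\mathcal{R}(\mathcal{A})$ (to $0$ if $k=\ell=0$), it is $H$-equivariant, $\xi\rhd\llbracket X,Y\rrbracket_\mathcal{R}=\llbracket\xi_{(1)}\rhd X,\xi_{(2)}\rhd Y\rrbracket_\mathcal{R}$, and for all $k,\ell\ge0$, $X\in\mathfrak{X}^k_\mathcal{R}(\mathcal{A})$, $Y\in\mathfrak{X}^\ell_\mathcal{R}(\mathcal{A})$, $Z\in\mathfrak{X}^\bullet_\mathcal{R}(\mathcal{A})$ it satisfies $$\llbracket Y,X\rrbracket_\mathcal{R}=-(-1)^{(k-1)(\ell-1)}\llbracket\mathcal{R}_1^{-1}\rhd X,\mathcal{R}_2^{-1}\rhd Y\rrbracket_\mathcal{R},$$ $$\llbracket X,\llbracket Y,Z\rrbracket_\mathcal{R}\rrbracket_\mathcal{R}=\llbracket\llbracket X,Y\rrbracket_\mathcal{R},Z\rrbracket_\mathcal{R}+(-1)^{(k-1)(\ell-1)}\llbracket\mathcal{R}_1^{-1}\rhd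 Y,\llbracket\mathcal{R}_2^{-1}\rhd X,Z\rrbracket_\mathcal{R}\rrbracket_\mathcal{R},$$ $$\llbracket X,Y\wedge Z\rrbracket_\mathcal{R}=\llbracket X,Y\rrbracket_\mathcal{R}\wedge Z+(-1)^{(k-1)\ell}(\mathcal{R}_1^{-1}\rhd Y)\wedge\llbracket\mathcal{R}_2^{-1}\rhd X,Z\rrbracket_\mathcal{R}.$$ -/

import Mathlib

open scoped TensorProduct
open Coalgebra HopfAlgebra

namespace BraidedMV

section Legs
variable {k H : Type*} [CommRing k] [Ring H] [Algebra k H]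

/-- A finite family of pairs `(x, y)` with `t = ∑ x ⊗ y` (leg notation `t = t₁ ⊗ t₂`). -/
noncomputable def legs (t : H ⊗[k] H) : Finset (H × H) :=
  (TensorProduct.exists_finset t).choose

theorem sum_legs (t : H ⊗[k] H) : ∑ p ∈ legs t, p.1 ⊗ₜ[k] p.2 = t :=
  (TensorProduct.exists_finset t).choose_spec.symm

theorem map_sum_legs {P : Type*} [AddCommGroup P] [Module k P] (f : H ⊗[k] H →ₗ[k] P)
    (t : H ⊗[k] H) : ∑ p ∈ legs t, f (p.1 ⊗ₜ[k] p.2) = f t := by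
  rw [← map_sum, sum_legs]

end Legs

/-- A triangular structure on a Hopf algebra. -/
class Triangular (k H : Type*) [CommRing k] [Ring H] [HopfAlgebra k H] where
  R : H ⊗[k] H
  R_mul_flip : R * TensorProduct.comm k H H R = 1
  flip_mul_R : TensorProduct.comm k H H R * R = 1
  comul_flip_mul : ∀ ξ : H, TensorProduct.comm k H H (comul (R := k) ξ) * R = R * comul (R := k) ξ
  /-- `(Δ ⊗ id)(R) = R₁₃ R₂₃` in `(H ⊗ H) ⊗ H`. -/
  hexagon_left :
    Algebra.TensorProduct.map (Bialgebra.comulAlgHom k H) (AlgHom.id k H) R =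
      Algebra.TensorProduct.map
        (Algebra.TensorProduct.includeLeft : H →ₐ[k] H ⊗[k] H) (AlgHom.id k H) R *
      Algebra.TensorProduct.map
        (Algebra.TensorProduct.includeRight : H →ₐ[k] H ⊗[k] H) (AlgHom.id k H) R
  /-- `(id ⊗ Δ)(R) = R₁₃ R₁₂` in `H ⊗ (H ⊗ H)`. -/
  hexagon_right :
    Algebra.TensorProduct.map (AlgHom.id k H) (Bialgebra.comulAlgHom k H) R =
      Algebra.TensorProduct.map (AlgHom.id k H)
        (Algebra.TensorProduct.includeRight : H →ₐ[k] H ⊗[k] H) R *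
      Algebra.TensorProduct.map (AlgHom.id k H)
        (Algebra.TensorProduct.includeLeft : H →ₐ[k] H ⊗[k] H) R

/-- The inverse `R⁻¹ = R₂₁`. -/
noncomputable def Rinv (k H : Type*) [CommRing k] [Ring H] [HopfAlgebra k H] [Triangular k H] :
    H ⊗[k] H := TensorProduct.comm k H H (Triangular.R (k := k) (H := H))

section RinvLemmas
variable (k H : Type*) [CommRing k] [Ring H] [HopfAlgebra k H] [Triangular k H]

theorem hexagon_left_inv :
    Algebra.TensorProduct.map (Bialgebra.comulAlgHom k H) (AlgHom.id k H) (Rinv k H) =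
      Algebra.TensorProduct.map
        (Algebra.TensorProduct.includeRight : H →ₐ[k] H ⊗[k] H) (AlgHom.id k H) (Rinv k H) *
      Algebra.TensorProduct.map
        (Algebra.TensorProduct.includeLeft : H →ₐ[k] H ⊗[k] H) (AlgHom.id k H) (Rinv k H) := by
  have key : ∀ f : H →ₐ[k] H ⊗[k] H,
      Algebra.TensorProduct.map f (AlgHom.id k H) (Triangular.R (k := k) (H := H)) *
        Algebra.TensorProduct.map f (AlgHom.id k H) (Rinv k H) = 1 := fun f => by
    rw [← map_mul, Rinv, Triangular.R_mul_flip, map_one]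
  have key' : ∀ f : H →ₐ[k] H ⊗[k] H,
      Algebra.TensorProduct.map f (AlgHom.id k H) (Rinv k H) *
        Algebra.TensorProduct.map f (AlgHom.id k H) (Triangular.R (k := k) (H := H)) = 1 :=
      fun f => by
    rw [← map_mul, Rinv, Triangular.flip_mul_R, map_one]
  refine left_inv_eq_right_inv (key' _) ?_
  rw [Triangular.hexagon_left, mul_assoc, ← mul_assoc _ _ (Algebra.TensorProduct.map _ _ (Rinv k H)),
    key, one_mul, key]

theorem hexagon_right_inv :
    Algebra.TensorProduct.map (AlgHom.id k H) (Bialgebra.comulAlgHom k H) (Rinv k H) =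
      Algebra.TensorProduct.map (AlgHom.id k H)
        (Algebra.TensorProduct.includeLeft : H →ₐ[k] H ⊗[k] H) (Rinv k H) *
      Algebra.TensorProduct.map (AlgHom.id k H)
        (Algebra.TensorProduct.includeRight : H →ₐ[k] H ⊗[k] H) (Rinv k H) := by
  have key : ∀ f : H →ₐ[k] H ⊗[k] H,
      Algebra.TensorProduct.map (AlgHom.id k H) f (Triangular.R (k := k) (H := H)) *
        Algebra.TensorProduct.map (AlgHom.id k H) f (Rinv k H) = 1 := fun f => by
    rw [← map_mul, Rinv, Triangular.R_mul_flip, map_one]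
  have key' : ∀ f : H →ₐ[k] H ⊗[k] H,
      Algebra.TensorProduct.map (AlgHom.id k H) f (Rinv k H) *
        Algebra.TensorProduct.map (AlgHom.id k H) f (Triangular.R (k := k) (H := H)) = 1 :=
      fun f => by
    rw [← map_mul, Rinv, Triangular.flip_mul_R, map_one]
  refine left_inv_eq_right_inv (key' _) ?_
  rw [Triangular.hexagon_right, mul_assoc, ← mul_assoc _ _ (Algebra.TensorProduct.map _ _ (Rinv k H)),
    key, one_mul, key]

theorem Rinv_mul_comul_flip (ξ : H) :
    Rinv k H * TensorProduct.comm k H H (comul (R := k) ξ) = comul (R := k) ξ * Rinv k H := by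
  have h := Triangular.comul_flip_mul (k := k) ξ
  calc _ = Rinv k H * (TensorProduct.comm k H H (comul (R := k) ξ) *
        Triangular.R (k := k) (H := H)) * Rinv k H := by
          rw [mul_assoc, mul_assoc, Rinv, Triangular.R_mul_flip, mul_one]
    _ = _ := by rw [h, ← mul_assoc, Rinv, Triangular.flip_mul_R, one_mul]

end RinvLemmas

/-- Left `H`-module algebras. -/
class ModuleAlgebra (k H A : Type*) [CommRing k] [Ring H] [HopfAlgebra k H] [Ring A] [Algebra k A]
    [Module H A] [IsScalarTower k H A] : Prop where
  smul_mul : ∀ (ξ : H) (a b : A),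
    ξ • (a * b) = ∑ p ∈ legs (comul (R := k) ξ), (p.1 • a) * (p.2 • b)
  smul_one : ∀ ξ : H, ξ • (1 : A) = counit (R := k) ξ • (1 : A)

/-- Braided commutativity: `b a = (R₁⁻¹ ▷ a) (R₂⁻¹ ▷ b)`. -/
class BraidedCommutative (k H A : Type*) [CommRing k] [Ring H] [HopfAlgebra k H] [Triangular k H]
    [Ring A] [Algebra k A] [Module H A] [IsScalarTower k H A] : Prop where
  mul_comm : ∀ a b : A, b * a = ∑ r ∈ legs (Rinv k H), (r.1 • a) * (r.2 • b)

/-! ### Braided commutators in an algebra with an action of a triangular Hopf algebra -/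

section Commutator
variable {k H E : Type*} [CommRing k] [Ring H] [HopfAlgebra k H] [Ring E] [Algebra k E]

/-- `ξ ▷ (X Y) = (ξ₁ ▷ X) (ξ₂ ▷ Y)`. -/
def IsMulAction (ρ : H →ₐ[k] Module.End k E) : Prop :=
  ∀ (ξ : H) (X Y : E), ρ ξ (X * Y) = ∑ p ∈ legs (comul (R := k) ξ), ρ p.1 X * ρ p.2 Y

/-- auxiliary: `x ⊗ y ↦ (x ▷ X) (y ▷ Y)` -/
noncomputable def mulLegs (ρ : H →ₐ[k] Module.End k E) (X Y : E) : H ⊗[k] H →ₗ[k] E :=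
  LinearMap.mul' k E ∘ₗ TensorProduct.map (ρ.toLinearMap.flip X) (ρ.toLinearMap.flip Y)

@[simp] theorem mulLegs_tmul (ρ : H →ₐ[k] Module.End k E) (X Y : E) (x y : H) :
    mulLegs ρ X Y (x ⊗ₜ y) = ρ x X * ρ y Y := by simp [mulLegs]

theorem mulLegs_mul (ρ : H →ₐ[k] Module.End k E) (X Y : E) (s t : H ⊗[k] H) :
    mulLegs ρ X Y (s * t) = ∑ q ∈ legs t, mulLegs ρ (ρ q.1 X) (ρ q.2 Y) s := by
  conv_lhs => rw [← sum_legs s, ← sum_legs t]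
  simp only [Finset.mul_sum, Finset.sum_mul, map_sum, Algebra.TensorProduct.tmul_mul_tmul,
    mulLegs_tmul, map_mul, Module.End.mul_apply]
  refine Finset.sum_congr rfl fun q _ => ?_
  conv_rhs => rw [← map_sum_legs (mulLegs ρ (ρ q.1 X) (ρ q.2 Y)) s]
  simp

variable [Triangular k H]

/-- The braided commutator `X Y - (R₁⁻¹ ▷ Y) (R₂⁻¹ ▷ X)` for an action `ρ` of `H` on `E`. -/
noncomputable def commutator (ρ : H →ₐ[k] Module.End k E) (X Y : E) : E :=
  X * Y - ∑ r ∈ legs (Rinv k H), ρ r.1 Y * ρ r.2 X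

theorem commutator_eq (ρ : H →ₐ[k] Module.End k E) (X Y : E) :
    commutator ρ X Y = X * Y - mulLegs ρ Y X (Rinv k H) := by
  rw [commutator, ← map_sum_legs (mulLegs ρ Y X)]; simp

/-- `ξ ▷ [X, Y] = [ξ₁ ▷ X, ξ₂ ▷ Y]` -/
theorem act_commutator {ρ : H →ₐ[k] Module.End k E} (hρ : IsMulAction ρ) (ξ : H) (X Y : E) :
    ρ ξ (commutator ρ X Y) =
      ∑ p ∈ legs (comul (R := k) ξ), commutator ρ (ρ p.1 X) (ρ p.2 Y) := by
  have hm : ∀ (ξ : H) (X Y : E), ρ ξ (X * Y) = mulLegs ρ X Y (comul (R := k) ξ) := fun ξ X Y => by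
    rw [hρ, ← map_sum_legs (mulLegs ρ X Y)]; simp
  have h1 : ρ ξ (mulLegs ρ Y X (Rinv k H)) = mulLegs ρ Y X (comul (R := k) ξ * Rinv k H) := by
    rw [mulLegs_mul, ← map_sum_legs (mulLegs ρ Y X), map_sum]
    simp [hm]
  have h2 : ∑ p ∈ legs (comul (R := k) ξ), mulLegs ρ (ρ p.2 Y) (ρ p.1 X) (Rinv k H) =
      mulLegs ρ Y X (Rinv k H * TensorProduct.comm k H H (comul (R := k) ξ)) := by
    conv_rhs => rw [← sum_legs (comul (R := k) ξ), ← sum_legs (Rinv k H)]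
    simp only [map_sum, Finset.mul_sum, Finset.sum_mul, TensorProduct.comm_tmul,
      Algebra.TensorProduct.tmul_mul_tmul, mulLegs_tmul, map_mul, Module.End.mul_apply]
    refine Finset.sum_congr rfl fun p _ => ?_
    rw [← map_sum_legs (mulLegs ρ _ _)]; simp
  simp only [commutator_eq, map_sub, Finset.sum_sub_distrib, h2, h1, Rinv_mul_comul_flip]
  rw [hρ]

/-- `[Z X, Y] = Z [X, Y] + [Z, R₁⁻¹ ▷ Y] (R₂⁻¹ ▷ X)` -/
theorem commutator_mul_left {ρ : H →ₐ[k] Module.End k E} (hρ : IsMulAction ρ) (Z X Y : E) :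
    commutator ρ (Z * X) Y = Z * commutator ρ X Y +
      ∑ r ∈ legs (Rinv k H), commutator ρ Z (ρ r.1 Y) * ρ r.2 X := by
  have key : ∑ r ∈ legs (Rinv k H), ρ r.1 Y * ρ r.2 (Z * X) =
      ∑ r ∈ legs (Rinv k H), ∑ s ∈ legs (Rinv k H), ρ s.1 (ρ r.1 Y) * ρ s.2 Z * ρ r.2 X := by
    let F : H ⊗[k] (H ⊗[k] H) →ₗ[k] E :=
      LinearMap.mul' k E ∘ₗ TensorProduct.map (ρ.toLinearMap.flip Y) (mulLegs ρ Z X)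
    have h := congrArg F (hexagon_right_inv k H)
    rw [← sum_legs (Rinv k H)] at h
    simp only [map_sum, Finset.mul_sum, Finset.sum_mul, Algebra.TensorProduct.map_tmul,
      Algebra.TensorProduct.tmul_mul_tmul, Algebra.TensorProduct.includeLeft_apply,
      Algebra.TensorProduct.includeRight_apply, AlgHom.id_apply, Bialgebra.comulAlgHom_apply,
      F, LinearMap.comp_apply, TensorProduct.map_tmul, LinearMap.flip_apply,
      AlgHom.toLinearMap_apply, LinearMap.mul'_apply, mulLegs_tmul, one_mul, mul_one, map_mul,
      Module.End.mul_apply] at h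
    refine Eq.trans (Finset.sum_congr rfl fun r _ => ?_) (h.trans
      (Finset.sum_congr rfl fun r _ => Finset.sum_congr rfl fun s _ => ?_))
    · rw [hρ, ← map_sum_legs (mulLegs ρ Z X)]; simp
    · rw [mul_assoc]
  simp only [commutator, key, mul_sub, sub_mul, Finset.sum_sub_distrib, Finset.mul_sum,
    Finset.sum_mul, mul_assoc]
  abel

theorem commutator_sub_left (ρ : H →ₐ[k] Module.End k E) (X X' Y : E) :
    commutator ρ (X - X') Y = commutator ρ X Y - commutator ρ X' Y := by
  simp only [commutator, sub_mul, map_sub, mul_sub, Finset.sum_sub_distrib]; abel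

theorem commutator_sum_left (ρ : H →ₐ[k] Module.End k E) {ι : Type*} (s : Finset ι) (X : ι → E)
    (Y : E) : commutator ρ (∑ i ∈ s, X i) Y = ∑ i ∈ s, commutator ρ (X i) Y := by
  simp only [commutator, Finset.sum_mul, map_sum, Finset.mul_sum, Finset.sum_sub_distrib]
  rw [Finset.sum_comm]

/-- The braided commutator as a bilinear map. -/
noncomputable def commutatorL (ρ : H →ₐ[k] Module.End k E) : E →ₗ[k] E →ₗ[k] E :=
  LinearMap.mk₂ k (commutator ρ)
    (fun X X' Y => by
      simp only [commutator, add_mul, map_add, mul_add, Finset.sum_add_distrib]; abel)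
    (fun c X Y => by
      simp only [commutator, map_smul, smul_mul_assoc, mul_smul_comm, smul_sub, Finset.smul_sum])
    (fun X Y Y' => by
      simp only [commutator, add_mul, map_add, mul_add, Finset.sum_add_distrib]; abel)
    (fun c X Y => by
      simp only [commutator, map_smul, smul_mul_assoc, mul_smul_comm, smul_sub, Finset.smul_sum])

@[simp] theorem commutatorL_apply (ρ : H →ₐ[k] Module.End k E) (X Y : E) :
    commutatorL ρ X Y = commutator ρ X Y := rfl

theorem act_commutator_mul {ρ : H →ₐ[k] Module.End k E} (hρ : IsMulAction ρ) (X Y Z : E) :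
    ∑ r ∈ legs (Rinv k H), ρ r.1 (commutator ρ Y Z) * ρ r.2 X =
      ∑ r ∈ legs (Rinv k H), ∑ s ∈ legs (Rinv k H),
        commutator ρ (ρ r.1 Y) (ρ s.1 Z) * ρ s.2 (ρ r.2 X) := by
  let G : H ⊗[k] H →ₗ[k] E := TensorProduct.lift
    ((commutatorL ρ).compl₁₂ (ρ.toLinearMap.flip Y) (ρ.toLinearMap.flip Z))
  have hG : ∀ x y, G (x ⊗ₜ y) = commutator ρ (ρ x Y) (ρ y Z) := fun x y => by simp [G]
  let F : (H ⊗[k] H) ⊗[k] H →ₗ[k] E :=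
    LinearMap.mul' k E ∘ₗ TensorProduct.map G (ρ.toLinearMap.flip X)
  have h := congrArg F (hexagon_left_inv k H)
  rw [← sum_legs (Rinv k H)] at h
  simp only [map_sum, Finset.mul_sum, Finset.sum_mul, Algebra.TensorProduct.map_tmul,
    Algebra.TensorProduct.tmul_mul_tmul, Algebra.TensorProduct.includeLeft_apply,
    Algebra.TensorProduct.includeRight_apply, AlgHom.id_apply, Bialgebra.comulAlgHom_apply,
    F, LinearMap.comp_apply, TensorProduct.map_tmul, LinearMap.flip_apply,
    AlgHom.toLinearMap_apply, LinearMap.mul'_apply, hG, one_mul, mul_one, map_mul,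
    Module.End.mul_apply] at h
  refine Eq.trans (Finset.sum_congr rfl fun r _ => ?_) h
  rw [act_commutator hρ, ← map_sum_legs G]; simp [hG]

/-- The braided Jacobi identity. -/
theorem commutator_jacobi {ρ : H →ₐ[k] Module.End k E} (hρ : IsMulAction ρ) (X Y Z : E) :
    commutator ρ X (commutator ρ Y Z) = commutator ρ (commutator ρ X Y) Z +
      ∑ r ∈ legs (Rinv k H), commutator ρ (ρ r.1 Y) (commutator ρ (ρ r.2 X) Z) := by
  have K2 : ∑ r ∈ legs (Rinv k H), ∑ s ∈ legs (Rinv k H),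
      ρ s.1 (commutator ρ (ρ r.2 X) Z) * ρ s.2 (ρ r.1 Y) =
      ∑ t ∈ legs (Rinv k H), commutator ρ X (ρ t.1 Z) * ρ t.2 Y := by
    let F : H ⊗[k] H →ₗ[k] E := ∑ t ∈ legs (Rinv k H),
      LinearMap.mul' k E ∘ₗ TensorProduct.map
        ((commutatorL ρ).flip (ρ t.1 Z) ∘ₗ ρ.toLinearMap.flip X)
        (ρ t.2 ∘ₗ ρ.toLinearMap.flip Y)
    have hF : ∀ x y, F (x ⊗ₜ y) =
        ∑ t ∈ legs (Rinv k H), commutator ρ (ρ x X) (ρ t.1 Z) * ρ t.2 (ρ y Y) := fun x y => by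
      simp [F]
    have h1 : Rinv k H * TensorProduct.comm k H H (Rinv k H) = 1 := by
      have : TensorProduct.comm k H H (Rinv k H) = Triangular.R (k := k) (H := H) := by
        simp [Rinv]
      rw [this, Rinv, Triangular.flip_mul_R]
    have h := congrArg F h1
    rw [Algebra.TensorProduct.one_def, hF, ← sum_legs (Rinv k H)] at h
    simp only [map_sum, Finset.mul_sum, Finset.sum_mul, Algebra.TensorProduct.tmul_mul_tmul, hF,
      TensorProduct.comm_tmul, map_one, Module.End.one_apply, map_mul, Module.End.mul_apply] at h
    rw [sum_legs] at h
    rw [← h]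
    refine Finset.sum_congr rfl fun r _ => ?_
    rw [act_commutator_mul hρ]
  have e1 : commutator ρ X (commutator ρ Y Z) = X * commutator ρ Y Z -
      ∑ r ∈ legs (Rinv k H), ∑ s ∈ legs (Rinv k H),
        commutator ρ (ρ r.1 Y) (ρ s.1 Z) * ρ s.2 (ρ r.2 X) := by
    rw [← act_commutator_mul hρ]; rfl
  have e2 : commutator ρ (commutator ρ X Y) Z = X * commutator ρ Y Z +
      ∑ t ∈ legs (Rinv k H), commutator ρ X (ρ t.1 Z) * ρ t.2 Y -
      ∑ r ∈ legs (Rinv k H), (ρ r.1 Y * commutator ρ (ρ r.2 X) Z +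
        ∑ s ∈ legs (Rinv k H), commutator ρ (ρ r.1 Y) (ρ s.1 Z) * ρ s.2 (ρ r.2 X)) := by
    conv_lhs => rw [commutator.eq_def ρ X Y, commutator_sub_left, commutator_sum_left]
    simp only [commutator_mul_left hρ]
  have e3 : ∑ r ∈ legs (Rinv k H), commutator ρ (ρ r.1 Y) (commutator ρ (ρ r.2 X) Z) =
      ∑ r ∈ legs (Rinv k H), ρ r.1 Y * commutator ρ (ρ r.2 X) Z -
      ∑ t ∈ legs (Rinv k H), commutator ρ X (ρ t.1 Z) * ρ t.2 Y := by
    rw [← K2, ← Finset.sum_sub_distrib]; rfl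
  rw [e1, e2, e3, Finset.sum_add_distrib]
  abel

end Commutator

/-! ### The adjoint action on endomorphisms -/

section Adjoint

open WithConv

variable (k H A : Type*) [CommRing k] [Ring H] [HopfAlgebra k H] [Ring A] [Algebra k A]
  [Module H A] [IsScalarTower k H A]

/-- `x ↦ (a ↦ x ▷ a)`. -/
noncomputable abbrev opr : H →ₐ[k] Module.End k A := Algebra.lsmul k k A

/-- `x ⊗ y ↦ (X ↦ (a ↦ x ▷ X (S(y) ▷ a)))`. -/
noncomputable def sandwich : H ⊗[k] H →ₐ[k] Module.End k (Module.End k A) :=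
  Algebra.TensorProduct.algHomOfLinearMapTensorProduct
    (TensorProduct.lift ((LinearMap.mul k (Module.End k (Module.End k A))).compl₁₂
      ((LinearMap.mul k (Module.End k A)) ∘ₗ (opr k H A).toLinearMap)
      ((LinearMap.mul k (Module.End k A)).flip ∘ₗ (opr k H A).toLinearMap ∘ₗ antipode k)))
    (fun x x' y y' => by
      ext X a
      simp [antipode_mul_antidistrib])
    (by ext X a; simp)

/-- The adjoint action `(ξ ▷ X)(a) = ξ₁ ▷ X (S(ξ₂) ▷ a)`. -/
noncomputable def adj : H →ₐ[k] Module.End k (Module.End k A) :=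
  (sandwich k H A).comp (Bialgebra.comulAlgHom k H)

variable {k H A}

@[simp] theorem sandwich_tmul (x y : H) (X : Module.End k A) (a : A) :
    sandwich k H A (x ⊗ₜ y) X a = x • X (antipode k y • a) := by
  simp [sandwich]

theorem adj_apply (ξ : H) (X : Module.End k A) (a : A) :
    adj k H A ξ X a = ∑ p ∈ legs (comul (R := k) ξ), p.1 • X (antipode k p.2 • a) := by
  have := map_sum_legs ((LinearMap.applyₗ a) ∘ₗ (LinearMap.applyₗ X) ∘ₗ
    (sandwich k H A).toLinearMap) (comul (R := k) ξ)
  simp at this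
  rw [this]; rfl

theorem conv_const_left {P : Type*} [Ring P] [Algebra k P] (X : P) (f : WithConv (H →ₗ[k] P))
    (ξ : H) :
    (toConv ((counit (R := k) (A := H)).smulRight X) * f) ξ = X * f ξ := by
  rw [(Coalgebra.Repr.arbitrary k ξ).convMul_apply]
  conv_rhs => rw [← Coalgebra.sum_counit_smul (Coalgebra.Repr.arbitrary k ξ)]
  simp [Finset.mul_sum, map_sum]

theorem conv_const_right {P : Type*} [Ring P] [Algebra k P] (X : P) (f : WithConv (H →ₗ[k] P))
    (ξ : H) :
    (f * toConv ((counit (R := k) (A := H)).smulRight X)) ξ = f ξ * X := by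
  rw [(Coalgebra.Repr.arbitrary k ξ).convMul_apply]
  have h := congrArg (TensorProduct.rid k H)
    (Coalgebra.sum_tmul_counit_eq (R := k) (Coalgebra.Repr.arbitrary k ξ))
  simp only [map_sum, TensorProduct.rid_tmul, one_smul] at h
  conv_rhs => rw [← h]
  simp [Finset.sum_mul, map_sum]

theorem conv_apply_legs {P : Type*} [Ring P] [Algebra k P] (f g : WithConv (H →ₗ[k] P)) (ξ : H) :
    (f * g) ξ = ∑ p ∈ legs (comul (R := k) ξ), f p.1 * g p.2 := by
  rw [LinearMap.convMul_apply, ← LinearMap.comp_apply, ← map_sum_legs]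
  simp

theorem adj_eq_conv (ξ : H) (X : Module.End k A) :
    adj k H A ξ X = (toConv (opr k H A).toLinearMap *
      (toConv ((counit (R := k) (A := H)).smulRight X) *
        toConv ((opr k H A).toLinearMap ∘ₗ antipode k))) ξ := by
  rw [conv_apply_legs]
  simp only [conv_const_left]
  ext a
  rw [adj_apply]
  simp [LinearMap.sum_apply]

theorem antipode_conv_opr : toConv ((opr k H A).toLinearMap ∘ₗ antipode k) *
    toConv (opr k H A).toLinearMap = 1 := by
  ext ξ a
  rw [(Coalgebra.Repr.arbitrary k ξ).convMul_apply]
  have h := congrArg (fun x : H => x • a)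
    (HopfAlgebra.sum_antipode_mul_eq_smul (R := k) (Coalgebra.Repr.arbitrary k ξ))
  simpa [Finset.sum_smul, mul_smul, Algebra.algebraMap_eq_smul_one] using h

theorem opr_conv_antipode : toConv (opr k H A).toLinearMap *
    toConv ((opr k H A).toLinearMap ∘ₗ antipode k) = 1 := by
  ext ξ a
  rw [(Coalgebra.Repr.arbitrary k ξ).convMul_apply]
  have h := congrArg (fun x : H => x • a)
    (HopfAlgebra.sum_mul_antipode_eq_smul (R := k) (Coalgebra.Repr.arbitrary k ξ))
  simpa [Finset.sum_smul, mul_smul, Algebra.algebraMap_eq_smul_one] using h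

theorem isMulAction_adj : IsMulAction (adj k H A) := by
  intro ξ X Y
  let l := toConv (opr k H A).toLinearMap
  let s := toConv ((opr k H A).toLinearMap ∘ₗ antipode k)
  let c : Module.End k A → WithConv (H →ₗ[k] Module.End k A) :=
    fun X => toConv ((counit (R := k) (A := H)).smulRight X)
  have hc : c (X * Y) = c X * c Y := by
    ext ξ a
    simp only [c]
    rw [conv_const_left]
    simp
  have ha : ∀ X ξ, adj k H A ξ X = (l * (c X * s)) ξ := fun X ξ => adj_eq_conv ξ X
  have h : l * (c (X * Y) * s) = (l * (c X * s)) * (l * (c Y * s)) := by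
    have : s * l = 1 := antipode_conv_opr
    calc _ = l * (c X * (1 * (c Y * s))) := by rw [hc, one_mul, mul_assoc (c X)]
      _ = _ := by rw [← this]; simp only [mul_assoc]
  rw [ha, h, conv_apply_legs]
  simp only [← ha]

/-- `ξ ▷ (X(a)) = (ξ₁ ▷ X)(ξ₂ ▷ a)` -/
theorem smul_apply_eq (ξ : H) (X : Module.End k A) (a : A) :
    ξ • X a = ∑ p ∈ legs (comul (R := k) ξ), adj k H A p.1 X (p.2 • a) := by
  let l := toConv (opr k H A).toLinearMap
  let s := toConv ((opr k H A).toLinearMap ∘ₗ antipode k)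
  let c : Module.End k A → WithConv (H →ₗ[k] Module.End k A) :=
    fun X => toConv ((counit (R := k) (A := H)).smulRight X)
  have ha : ∀ ξ, adj k H A ξ X = (l * (c X * s)) ξ := fun ξ => adj_eq_conv ξ X
  have h : (l * (c X * s)) * l = l * c X := by
    have : s * l = 1 := antipode_conv_opr
    rw [mul_assoc, mul_assoc, this, mul_one]
  have e : ((l * (c X * s)) * l) ξ = (l * c X) ξ := by rw [h]
  rw [conv_apply_legs, show (l * c X) ξ = l ξ * X from conv_const_right X l ξ] at e
  simp only [← ha] at e
  have e2 := congrArg (fun f : Module.End k A => f a) e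
  simpa [LinearMap.sum_apply, l] using e2.symm

/-- The adjoint action on left multiplications. -/
theorem adj_mulLeft [ModuleAlgebra k H A] (ξ : H) (a : A) :
    adj k H A ξ (LinearMap.mulLeft k a) = LinearMap.mulLeft k (ξ • a) := by
  let l := toConv (opr k H A).toLinearMap
  let s := toConv ((opr k H A).toLinearMap ∘ₗ antipode k)
  let m : WithConv (H →ₗ[k] Module.End k A) :=
    toConv ((LinearMap.mul k A) ∘ₗ (opr k H A).toLinearMap.flip a)
  let c : Module.End k A → WithConv (H →ₗ[k] Module.End k A) :=
    fun X => toConv ((counit (R := k) (A := H)).smulRight X)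
  have h : l * c (LinearMap.mulLeft k a) = m * l := by
    ext ξ b
    simp only [c]
    rw [conv_const_right, conv_apply_legs]
    simp [l, m, LinearMap.sum_apply, ModuleAlgebra.smul_mul (k := k)]
  have hl : l * s = 1 := opr_conv_antipode
  have h2 : l * (c (LinearMap.mulLeft k a) * s) = m := by
    rw [← mul_assoc, h, mul_assoc, hl, mul_one]
  rw [adj_eq_conv]
  exact congrArg (fun f => f ξ) h2

end Adjoint

/-! ### Braided derivations -/

section Der
variable (k H A : Type*) [CommRing k] [Ring H] [HopfAlgebra k H] [Triangular k H] [Ring A]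
  [Algebra k A] [Module H A] [IsScalarTower k H A]

/-- The braided derivations: `X (a b) = X(a) b + (R₁⁻¹ ▷ a) (R₂⁻¹ ▷ X)(b)`. -/
noncomputable def Der : Submodule k (Module.End k A) where
  carrier := {X | ∀ a b : A, X (a * b) =
    X a * b + ∑ r ∈ legs (Rinv k H), (r.1 • a) * adj k H A r.2 X b}
  zero_mem' := by intro a b; simp
  add_mem' := by
    intro X Y hX hY a b
    simp only [LinearMap.add_apply, map_add, hX a b, hY a b, add_mul, mul_add,
      Finset.sum_add_distrib]
    abel
  smul_mem' := by
    intro c X hX a b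
    simp only [LinearMap.smul_apply, map_smul, hX a b, smul_add, Finset.smul_sum, smul_mul_assoc,
      mul_smul_comm]

variable {k H A}

theorem mem_Der {X : Module.End k A} : X ∈ Der k H A ↔ ∀ a b : A, X (a * b) =
    X a * b + ∑ r ∈ legs (Rinv k H), (r.1 • a) * adj k H A r.2 X b := Iff.rfl

variable [ModuleAlgebra k H A]

theorem mem_Der_iff {X : Module.End k A} : X ∈ Der k H A ↔ ∀ a : A,
    commutator (adj k H A) X (LinearMap.mulLeft k a) = LinearMap.mulLeft k (X a) := by
  refine forall_congr' fun a => ?_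
  rw [LinearMap.ext_iff]
  refine forall_congr' fun b => ?_
  simp [commutator, adj_mulLeft, LinearMap.sum_apply, sub_eq_iff_eq_add]

open WithConv in
theorem adj_mem {X : Module.End k A} (hX : X ∈ Der k H A) (ξ : H) : adj k H A ξ X ∈ Der k H A := by
  rw [mem_Der_iff] at hX ⊢
  intro a
  ext b
  let l := toConv (opr k H A).toLinearMap
  let s := toConv ((opr k H A).toLinearMap ∘ₗ antipode k)
  let U : WithConv (H →ₗ[k] Module.End k A) := toConv <| LinearMap.mk₂ k
    (fun ξ a => commutatorL (adj k H A) (adj k H A ξ X) (LinearMap.mul k A a) b -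
      adj k H A ξ X a * b)
    (fun x y a => by simp only [map_add, LinearMap.add_apply, add_mul]; abel)
    (fun c x a => by simp only [map_smul, LinearMap.smul_apply, smul_mul_assoc, smul_sub])
    (fun x a a' => by simp only [map_add, LinearMap.add_apply, add_mul]; abel)
    (fun c x a => by simp only [map_smul, LinearMap.smul_apply, smul_mul_assoc, smul_sub])
  have hU : ∀ ξ a, U ξ a = commutator (adj k H A) (adj k H A ξ X) (LinearMap.mulLeft k a) b -
      adj k H A ξ X a * b := fun ξ a => rfl
  have h0 : U * l = 0 := by
    ext ξ a
    rw [conv_apply_legs]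
    have h1 := congrArg (fun f : Module.End k A => f b) (act_commutator
      (isMulAction_adj (k := k) (H := H) (A := A)) ξ X (LinearMap.mulLeft k a))
    rw [hX] at h1
    simp only [adj_mulLeft, LinearMap.sum_apply, LinearMap.mulLeft_apply] at h1
    rw [smul_apply_eq, Finset.sum_mul] at h1
    simp only [LinearMap.sum_apply, Module.End.mul_apply, hU]
    rw [Finset.sum_sub_distrib]
    exact sub_eq_zero.2 h1.symm
  have h2 : U = 0 := by
    have hl : l * s = 1 := opr_conv_antipode
    rw [← mul_one U, ← hl, ← mul_assoc, h0, zero_mul]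
  have h3 := congrArg (fun f => f ξ a) h2
  exact sub_eq_zero.1 ((hU ξ a).symm.trans h3)

theorem comp_sub_mem {X Y : Module.End k A} (hX : X ∈ Der k H A) (hY : Y ∈ Der k H A) :
    commutator (adj k H A) X Y ∈ Der k H A := by
  have hX' := mem_Der_iff.1 hX
  have hY' := mem_Der_iff.1 hY
  rw [mem_Der_iff]
  intro a
  have h := commutator_jacobi (isMulAction_adj (k := k) (H := H) (A := A)) X Y (LinearMap.mulLeft k a)
  rw [hY', hX'] at h
  rw [← sub_eq_iff_eq_add] at h
  rw [← h]
  have h2 : ∀ r : H × H, commutator (adj k H A) (adj k H A r.1 Y)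
      (commutator (adj k H A) (adj k H A r.2 X) (LinearMap.mulLeft k a)) =
      LinearMap.mulLeft k (adj k H A r.1 Y (adj k H A r.2 X a)) := fun r => by
    rw [mem_Der_iff.1 (adj_mem hX _), mem_Der_iff.1 (adj_mem hY _)]
  simp only [h2]
  ext b
  simp [commutator, sub_mul, LinearMap.sum_apply, Finset.sum_mul]

theorem mulLeft_mul_mem [BraidedCommutative k H A] (b : A) {X : Module.End k A}
    (hX : X ∈ Der k H A) : LinearMap.mulLeft k b * X ∈ Der k H A := by
  have hX' := mem_Der_iff.1 hX
  rw [mem_Der_iff]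
  intro a
  have h0 : ∀ a : A, commutator (adj k H A) (LinearMap.mulLeft k b) (LinearMap.mulLeft k a) = 0 := by
    intro a
    ext c
    simp [commutator, adj_mulLeft, LinearMap.sum_apply, ← mul_assoc, ← Finset.sum_mul,
      ← BraidedCommutative.mul_comm (k := k) (H := H) a b]
  rw [commutator_mul_left isMulAction_adj, hX']
  simp only [adj_mulLeft, h0]
  ext c
  simp

end Der

section DerOperations
variable {k H A : Type*} [CommRing k] [Ring H] [HopfAlgebra k H] [Triangular k H] [Ring A]
  [Algebra k A] [Module H A] [IsScalarTower k H A] [ModuleAlgebra k H A]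

/-- The adjoint action of `H` on braided derivations. -/
noncomputable def Der.act : H →ₗ[k] Der k H A →ₗ[k] Der k H A :=
  LinearMap.mk₂ k (fun ξ X => ⟨adj k H A ξ X.1, adj_mem X.2 ξ⟩)
    (fun x y X => Subtype.ext (by simp))
    (fun c x X => Subtype.ext (by simp))
    (fun x X Y => Subtype.ext (by simp))
    (fun c x X => Subtype.ext (by simp))

/-- The braided commutator `[X, Y] = X Y - (R₁⁻¹ ▷ Y) (R₂⁻¹ ▷ X)` of braided derivations. -/
noncomputable def Der.bracket (X Y : Der k H A) : Der k H A :=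
  ⟨commutator (adj k H A) X.1 Y.1, comp_sub_mem X.2 Y.2⟩

theorem Der.act_apply (ξ : H) (X : Der k H A) (a : A) : (Der.act ξ X).1 a =
    ∑ p ∈ legs (comul (R := k) ξ), p.1 • X.1 (antipode k p.2 • a) := adj_apply ξ X.1 a

theorem Der.bracket_apply (X Y : Der k H A) (a : A) : (Der.bracket X Y).1 a = X.1 (Y.1 a) -
    ∑ r ∈ legs (Rinv k H), (Der.act r.1 Y).1 ((Der.act r.2 X).1 a) := by
  simp [Der.bracket, commutator, LinearMap.sum_apply, Der.act]

variable [BraidedCommutative k H A]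

/-- The left `A`-action `(a · X)(b) = a X(b)`. -/
noncomputable def Der.lact (a : A) (X : Der k H A) : Der k H A :=
  ⟨LinearMap.mulLeft k a * X.1, mulLeft_mul_mem a X.2⟩

/-- The right `A`-action `X · a = (R₁⁻¹ ▷ a) · (R₂⁻¹ ▷ X)`. -/
noncomputable def Der.ract (X : Der k H A) (a : A) : Der k H A :=
  ∑ r ∈ legs (Rinv k H), Der.lact (r.1 • a) (Der.act r.2 X)

theorem Der.lact_apply (a : A) (X : Der k H A) (b : A) : (Der.lact a X).1 b = a * X.1 b := rfl

end DerOperations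

/-! ### Tensors over `k` of braided derivations -/

section KTensor
variable {k H A : Type*} [CommRing k] [Ring H] [HopfAlgebra k H] [Triangular k H] [Ring A]
  [Algebra k A] [Module H A] [IsScalarTower k H A]

/-- `X₁ ⊗ ⋯ ⊗ Xₙ` over `k`. -/
noncomputable def tensor (l : List (Der k H A)) : TensorAlgebra k (Der k H A) :=
  (l.map (TensorAlgebra.ι k)).prod

variable [ModuleAlgebra k H A]

/-- The map `t ↦ (ξ ↦ ξ ▷ t)` of the diagonal action: the homomorphism from the tensor algebra over
`k` to the convolution algebra of `k`-linear maps on `H` that sends `X` to `ξ ↦ ξ ▷ X`. -/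
noncomputable def diagonalHom : TensorAlgebra k (Der k H A) →ₐ[k]
    WithConv (H →ₗ[k] TensorAlgebra k (Der k H A)) :=
  TensorAlgebra.lift k
    ((WithConv.linearEquiv k (H →ₗ[k] TensorAlgebra k (Der k H A))).symm.toLinearMap ∘ₗ
      LinearMap.llcomp k H (Der k H A) (TensorAlgebra k (Der k H A)) (TensorAlgebra.ι k) ∘ₗ
      (Der.act (k := k) (H := H) (A := A)).flip)

/-- The diagonal `H`-action on the tensor algebra over `k`:
`ξ ▷ (X₁ ⊗ ⋯ ⊗ Xₙ) = (ξ₁ ▷ X₁) ⊗ ⋯ ⊗ (ξₙ ▷ Xₙ)` and `ξ ▷ 1 = ε(ξ) 1`. -/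
noncomputable def diagonal (ξ : H) (t : TensorAlgebra k (Der k H A)) :
    TensorAlgebra k (Der k H A) :=
  diagonalHom t ξ

theorem diagonal_nil (ξ : H) :
    diagonal ξ (tensor (k := k) (A := A) []) = algebraMap k _ (counit (R := k) ξ) := by
  simp [diagonal, diagonalHom, tensor]

theorem diagonal_cons (ξ : H) (X : Der k H A) (l : List (Der k H A)) :
    diagonal ξ (tensor (X :: l)) = ∑ p ∈ legs (comul (R := k) ξ),
      TensorAlgebra.ι k (Der.act p.1 X) * diagonal p.2 (tensor l) := by
  simp only [tensor, List.map_cons, List.prod_cons, diagonal, map_mul]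
  rw [conv_apply_legs]
  simp [diagonalHom]

/-- The braided exchange of the `i`-th and `j`-th factor (`i < j`) of `X₁ ⊗ ⋯ ⊗ Xₙ`: it equals
`X₁ ⊗ ⋯ ⊗ Xᵢ₋₁ ⊗ (R'₁⁻¹ ▷ ((R₁⁻¹ ▷ Xⱼ) ⊗ (R₂⁻¹ ▷ (Xᵢ₊₁ ⊗ ⋯ ⊗ Xⱼ₋₁)))) ⊗ (R'₂⁻¹ ▷ Xᵢ) ⊗ Xⱼ₊₁ ⊗ ⋯ ⊗ Xₙ`. -/
noncomputable def exchange {n : ℕ} (X : Fin n → Der k H A) (i j : Fin n) :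
    TensorAlgebra k (Der k H A) :=
  tensor ((List.ofFn X).take i) *
    (∑ r' ∈ legs (Rinv k H),
      diagonal r'.1 (∑ r ∈ legs (Rinv k H),
        TensorAlgebra.ι k (Der.act r.1 (X j)) *
          diagonal r.2 (tensor (((List.ofFn X).take j).drop (i + 1)))) *
      TensorAlgebra.ι k (Der.act r'.2 (X i))) *
    tensor ((List.ofFn X).drop (j + 1))

end KTensor

/-! ### Braided multivector fields -/

section Multivector
variable (k H A : Type*) [CommRing k] [Ring H] [HopfAlgebra k H] [Triangular k H] [Ring A]
  [Algebra k A] [Module H A] [IsScalarTower k H A] [ModuleAlgebra k H A]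
  [BraidedCommutative k H A]

/-- The relations presenting the tensor algebra over `A` of the `A`-bimodule of braided derivations
as a quotient of the tensor algebra over `k` of `A × Der`. -/
inductive TensorRel : TensorAlgebra k (A × Der k H A) → TensorAlgebra k (A × Der k H A) → Prop
  | one : TensorRel (TensorAlgebra.ι k (1, 0)) 1
  | mul (a b : A) : TensorRel
      (TensorAlgebra.ι k (a, 0) * TensorAlgebra.ι k (b, 0)) (TensorAlgebra.ι k (a * b, 0))
  | left (a : A) (X : Der k H A) : TensorRel
      (TensorAlgebra.ι k (a, 0) * TensorAlgebra.ι k (0, X)) (TensorAlgebra.ι k (0, Der.lact a X))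
  | right (X : Der k H A) (a : A) : TensorRel
      (TensorAlgebra.ι k (0, X) * TensorAlgebra.ι k (a, 0)) (TensorAlgebra.ι k (0, Der.ract X a))

/-- The tensor algebra `A ⊕ Der ⊕ (Der ⊗_A Der) ⊕ ⋯` over `A` of the bimodule of braided
derivations. -/
abbrev TensorAlg := RingQuot (TensorRel k H A)

/-- The canonical map from the tensor algebra over `k` to the tensor algebra over `A`; it sends
`X₁ ⊗ ⋯ ⊗ Xₙ` to `X₁ ⊗_A ⋯ ⊗_A Xₙ`. -/
noncomputable def toTensorAlg : TensorAlgebra k (Der k H A) →ₐ[k] TensorAlg k H A :=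
  (RingQuot.mkAlgHom k (TensorRel k H A)).comp
    (TensorAlgebra.lift k (TensorAlgebra.ι k ∘ₗ LinearMap.inr k A (Der k H A)))

/-- The generators of the ideal defining the exterior algebra: an element
`T = ∑ₛ X₁ˢ ⊗_A ⋯ ⊗_A Xₙˢ` is set to zero if it is invariant under the braided exchange of the
`i`-th and `j`-th factor for some `i < j`. -/
inductive WedgeRel : TensorAlg k H A → TensorAlg k H A → Prop
  | mk {n m : ℕ} (i j : Fin n) (hij : i < j) (X : Fin m → Fin n → Der k H A)
      (h : toTensorAlg k H A (∑ s, tensor (List.ofFn (X s))) =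
        toTensorAlg k H A (∑ s, exchange (X s) i j)) :
      WedgeRel (toTensorAlg k H A (∑ s, tensor (List.ofFn (X s)))) 0

/-- The algebra of braided multivector fields; its product is the braided wedge product. -/
abbrev MV := RingQuot (WedgeRel k H A)

variable {k H A}

theorem mkAlgHom_ι_one : RingQuot.mkAlgHom k (TensorRel k H A) (TensorAlgebra.ι k (1, 0)) = 1 := by
  rw [RingQuot.mkAlgHom_rel k TensorRel.one, map_one]

variable (k H)

/-- The map `A → 𝔛⁰`. -/
noncomputable def ofAlg : A →ₐ[k] MV k H A :=
  (RingQuot.mkAlgHom k (WedgeRel k H A)).comp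
    (AlgHom.ofLinearMap ((RingQuot.mkAlgHom k (TensorRel k H A)).toLinearMap ∘ₗ
      TensorAlgebra.ι k ∘ₗ LinearMap.inl k A (Der k H A))
      (by simpa using mkAlgHom_ι_one)
      (fun a b => by
        simpa using (RingQuot.mkAlgHom_rel k (TensorRel.mul (k := k) (H := H) a b)).symm))

variable {k H}

/-- The map `X₁ ⊗ ⋯ ⊗ Xₙ ↦ X₁ ∧ ⋯ ∧ Xₙ`. -/
noncomputable def toMV : TensorAlgebra k (Der k H A) →ₐ[k] MV k H A :=
  (RingQuot.mkAlgHom k (WedgeRel k H A)).comp (toTensorAlg k H A)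

/-- The map `Der → 𝔛¹`. -/
noncomputable def ofDer : Der k H A →ₗ[k] MV k H A := toMV.toLinearMap ∘ₗ TensorAlgebra.ι k

/-- `X₁ ∧ ⋯ ∧ Xₙ`. -/
noncomputable def wedge (l : List (Der k H A)) : MV k H A := (l.map ofDer).prod

/-- `X₁ ∧ ⋯ ∧ Xᵢ₋₁`. -/
noncomputable def before {n : ℕ} (X : Fin n → Der k H A) (i : Fin n) : MV k H A :=
  wedge ((List.ofFn X).take i)

/-- `Xᵢ₊₁ ∧ ⋯ ∧ Xₙ`. -/
noncomputable def after {n : ℕ} (X : Fin n → Der k H A) (i : Fin n) : MV k H A :=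
  wedge ((List.ofFn X).drop (i + 1))

variable (k H A) in
/-- The multivector fields of degree `n`, spanned by the `a · (X₁ ∧ ⋯ ∧ Xₙ)`. -/
noncomputable def degree (n : ℕ) : Submodule k (MV k H A) :=
  Submodule.span k {x | ∃ (a : A) (X : Fin n → Der k H A), x = ofAlg k H a * wedge (List.ofFn X)}

/-- The `H`-action on multivector fields induced by the given action on `A` and by the diagonal
action on tensors. -/
structure IsInducedAction (act : H →ₐ[k] Module.End k (MV k H A)) : Prop where
  act_alg : ∀ (ξ : H) (a : A), act ξ (ofAlg k H a) = ofAlg k H (ξ • a)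
  act_wedge : ∀ (ξ : H) (l : List (Der k H A)), act ξ (wedge l) = toMV (diagonal ξ (tensor l))

/-- The defining formulas of the braided Schouten-Nijenhuis bracket. Indices are counted from `0`,
so that the signs are shifted accordingly. -/
structure IsSchoutenNijenhuis (act : H →ₐ[k] Module.End k (MV k H A))
    (B : MV k H A →ₗ[k] MV k H A →ₗ[k] MV k H A) : Prop where
  alg_alg : ∀ a b : A, B (ofAlg k H a) (ofAlg k H b) = 0
  mv_alg : ∀ (n : ℕ) (_ : 0 < n) (X : Fin n → Der k H A) (a : A),
    B (wedge (List.ofFn X)) (ofAlg k H a) =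
      ∑ i : Fin n, (-1 : ℤ) ^ (n - (i + 1 : ℕ)) • ∑ r ∈ legs (Rinv k H),
        before X i * ofAlg k H ((X i).1 (r.1 • a)) * act r.2 (after X i)
  alg_mv : ∀ (n : ℕ) (_ : 0 < n) (X : Fin n → Der k H A) (a : A),
    B (ofAlg k H a) (wedge (List.ofFn X)) =
      ∑ i : Fin n, (-1 : ℤ) ^ (i + 1 : ℕ) • ∑ r ∈ legs (Rinv k H),
        ∑ p ∈ legs (comul (R := k) r.1),
          act p.1 (before X i) * ofAlg k H ((Der.act p.2 (X i)).1 (r.2 • a)) * after X i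
  mv_mv : ∀ (n m : ℕ) (_ : 0 < n) (_ : 0 < m) (X : Fin n → Der k H A) (Y : Fin m → Der k H A),
    B (wedge (List.ofFn X)) (wedge (List.ofFn Y)) =
      ∑ i : Fin n, ∑ j : Fin m, (-1 : ℤ) ^ ((i + 1) + (j + 1) : ℕ) •
        ∑ r ∈ legs (Rinv k H), ∑ r' ∈ legs (Rinv k H),
          ofDer (Der.bracket (Der.act r.1 (X i)) (Der.act r'.1 (Y j))) *
            act r'.2 (act r.2 (before X i) * after X i * before Y j) * after Y j

/-- The multivector fields are a graded algebra and an `H`-equivariant braided symmetric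
`A`-bimodule, with `A`-actions `a · x = a ∧ x` and `x · a = x ∧ a`. -/
structure IsEquivariantGradedAlgebra (act : H →ₐ[k] Module.End k (MV k H A)) : Prop where
  gradedMonoid : SetLike.GradedMonoid (degree k H A)
  isInternal : DirectSum.IsInternal (degree k H A)
  /-- `A` is identified with the degree zero part. -/
  ofAlg_injective : Function.Injective (ofAlg k H : A →ₐ[k] MV k H A)
  range_ofAlg : (ofAlg k H : A →ₐ[k] MV k H A).toLinearMap.range = degree k H A 0
  /-- The braided derivations are identified with the degree one part. -/
  ofDer_injective : Function.Injective (ofDer : Der k H A →ₗ[k] MV k H A)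
  range_ofDer : (ofDer : Der k H A →ₗ[k] MV k H A).range = degree k H A 1
  act_degree : ∀ (ξ : H) (n : ℕ), ∀ x ∈ degree k H A n, act ξ x ∈ degree k H A n
  act_one : ∀ ξ : H, act ξ 1 = counit (R := k) ξ • (1 : MV k H A)
  act_mul : ∀ (ξ : H) (x y : MV k H A),
    act ξ (x * y) = ∑ p ∈ legs (comul (R := k) ξ), act p.1 x * act p.2 y
  act_left : ∀ (ξ : H) (a : A) (x : MV k H A),
    act ξ (ofAlg k H a * x) = ∑ p ∈ legs (comul (R := k) ξ), ofAlg k H (p.1 • a) * act p.2 x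
  act_right : ∀ (ξ : H) (a : A) (x : MV k H A),
    act ξ (x * ofAlg k H a) = ∑ p ∈ legs (comul (R := k) ξ), act p.1 x * ofAlg k H (p.2 • a)
  braided_symmetric : ∀ (a : A) (x : MV k H A),
    x * ofAlg k H a = ∑ r ∈ legs (Rinv k H), ofAlg k H (r.1 • a) * act r.2 x

/-- An `H`-equivariant graded (with degree shifted by `-1`) braided Lie bracket that satisfies the
graded braided Leibniz rule. -/
structure IsBraidedGerstenhaberBracket (act : H →ₐ[k] Module.End k (MV k H A))
    (B : MV k H A →ₗ[k] MV k H A →ₗ[k] MV k H A) : Prop where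
  /-- The bracket maps degrees `p, q` to degree `p + q - 1` (to zero if `p = q = 0`). -/
  degree_zero : ∀ x ∈ degree k H A 0, ∀ y ∈ degree k H A 0, B x y = 0
  degree_add : ∀ p q n : ℕ, p + q = n + 1 → ∀ x ∈ degree k H A p, ∀ y ∈ degree k H A q,
    B x y ∈ degree k H A n
  equivariant : ∀ (ξ : H) (x y : MV k H A),
    act ξ (B x y) = ∑ p ∈ legs (comul (R := k) ξ), B (act p.1 x) (act p.2 y)
  skew : ∀ p q : ℕ, ∀ x ∈ degree k H A p, ∀ y ∈ degree k H A q,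
    B y x = -(Int.negOnePow (((p : ℤ) - 1) * ((q : ℤ) - 1)) •
      ∑ r ∈ legs (Rinv k H), B (act r.1 x) (act r.2 y))
  jacobi : ∀ p q : ℕ, ∀ x ∈ degree k H A p, ∀ y ∈ degree k H A q, ∀ z : MV k H A,
    B x (B y z) = B (B x y) z + Int.negOnePow (((p : ℤ) - 1) * ((q : ℤ) - 1)) •
      ∑ r ∈ legs (Rinv k H), B (act r.1 y) (B (act r.2 x) z)
  leibniz : ∀ p q : ℕ, ∀ x ∈ degree k H A p, ∀ y ∈ degree k H A q, ∀ z : MV k H A,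
    B x (y * z) = B x y * z + Int.negOnePow (((p : ℤ) - 1) * (q : ℤ)) •
      ∑ r ∈ legs (Rinv k H), act r.1 y * B (act r.2 x) z

end Multivector

end BraidedMV

open scoped TensorProduct
open Coalgebra HopfAlgebra

set_option linter.unusedSectionVars false

/-! All Koszul signs are absorbed into the Hopf algebra. `Super H` consists of the `H`-valued
functions on `ℤ/2`; its modules are the `ℤ/2`-graded `H`-modules, and its R-matrix is that of `H`
with Koszul signs. Let `A` be even and the braided derivations odd. The tensor algebra `T` of the
bimodule of braided derivations is then a `Super H`-module algebra. In the multivector fields `M`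
the derivations anticommute in the braided sense, so `M` is braided commutative over `Super H`. The
theory of braided derivations therefore applies to `(Super H, M)` in place of `(H, A)`: they are
closed under braided commutators, left multiplications and right multiplications, and they are
determined by their values on the generators `A ⊕ Der`.

The brackets of generators are `⟦a, b⟧ = 0`, `⟦X, a⟧ = X(a)`, `⟦a, Y⟧ = -(R₁⁻¹ ▷ Y)(R₂⁻¹ ▷ a)` and
`[X, Y]`. The bracket is odd, so generators in the second argument carry shifted parity. As a
function of the first argument the bracket extends to a derivation `tBr` of `T` with values in the
bimodule of linear maps `A ⊕ Der → T`.

The main point is that `tBr` descends to `M` (`nullBr_of_tM`). Since 2 need not be invertible, an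
invariant tensor `x` cannot be rewritten as `S + σ(S)`. Instead, `σᵢⱼ` is conjugate to an exchange
of adjacent factors. Modulo tensors that are zero in `M` together with all their brackets, adjacent
exchanges act as `-1`, so the two adjacent factors may be moved to the front (`NullBr.of_exch`).
There, brackets with derivations commute with the exchange (`swapZero_tBr_der`). A bracket with `b ∈
A` is the bracket on the remaining factors plus a difference of two contractions that are
interchanged by the exchange (`tBr_alg`); on invariant tensors this difference vanishes.

For each `x` in `M` there is then exactly one braided derivation `⟦x, ·⟧` of `M` with the prescribed
values on generators (`IsModel.exists_der`, `IsModel.der_ext`). The Leibniz rule in the second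
argument holds by construction. For the Leibniz rule in the first argument and for skew symmetry,
two braided derivations are compared on generators; equivariance is propagated from generators along
products. The defect of the Jacobi identity is a braided derivation in its last argument, and skew
symmetry permutes the arguments, so it too is only needed on generators, where it is the braided
Jacobi identity in `Der`.

The explicit formulas follow by induction on the number of factors, and they determine the bracket
because `M` is spanned by `A` and wedge products. `A` and `Der` embed in `M` because `T` acts on `A
⊕ Der` with all tensors of length at least two acting as zero (`genRep`). The grading comes from the
homomorphism `T → M[X]` that sends a tensor `x` of degree `n` to its class times `Xⁿ` (`gradHom`).
-/

namespace BraidedMV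

/-! ### The axioms of a triangular Hopf algebra as identities between sums over legs. -/

section Bilinear
variable {k H V W P : Type*} [CommRing k] [Ring H] [Algebra k H]
  [AddCommGroup V] [Module k V] [AddCommGroup W] [Module k W] [AddCommGroup P] [Module k P]

/-- `h₁ ⊗ h₂ ↦ f (h₁ ▷ v) (h₂ ▷ w)`. -/
noncomputable def ev2 (ρ₁ : H →ₐ[k] Module.End k V) (ρ₂ : H →ₐ[k] Module.End k W)
    (f : V →ₗ[k] W →ₗ[k] P) (v : V) (w : W) : H ⊗[k] H →ₗ[k] P :=
  TensorProduct.lift f ∘ₗ TensorProduct.map (ρ₁.toLinearMap.flip v) (ρ₂.toLinearMap.flip w)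

@[simp] theorem ev2_tmul (ρ₁ : H →ₐ[k] Module.End k V) (ρ₂ : H →ₐ[k] Module.End k W)
    (f : V →ₗ[k] W →ₗ[k] P) (v : V) (w : W) (x y : H) :
    ev2 ρ₁ ρ₂ f v w (x ⊗ₜ y) = f (ρ₁ x v) (ρ₂ y w) := by simp [ev2]

theorem sum_legs_ev2 (ρ₁ : H →ₐ[k] Module.End k V) (ρ₂ : H →ₐ[k] Module.End k W)
    (f : V →ₗ[k] W →ₗ[k] P) (v : V) (w : W) (t : H ⊗[k] H) :
    ∑ r ∈ legs t, f (ρ₁ r.1 v) (ρ₂ r.2 w) = ev2 ρ₁ ρ₂ f v w t := by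
  rw [← map_sum_legs (ev2 ρ₁ ρ₂ f v w)]; simp

theorem ev2_mul (ρ₁ : H →ₐ[k] Module.End k V) (ρ₂ : H →ₐ[k] Module.End k W)
    (f : V →ₗ[k] W →ₗ[k] P) (v : V) (w : W) (s t : H ⊗[k] H) :
    ev2 ρ₁ ρ₂ f v w (s * t) =
      ∑ r ∈ legs t, ∑ p ∈ legs s, f (ρ₁ p.1 (ρ₁ r.1 v)) (ρ₂ p.2 (ρ₂ r.2 w)) := by
  conv_lhs => rw [← sum_legs s, ← sum_legs t]
  simp [Finset.mul_sum, Finset.sum_mul]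

end Bilinear

section Mk
variable {k V W U P : Type*} [CommRing k]
  [AddCommGroup V] [Module k V] [AddCommGroup W] [Module k W] [AddCommGroup U] [Module k U]
  [AddCommGroup P] [Module k P]

/-- A function of two variables is bilinear. -/
structure Bilin (k : Type*) {V W P : Type*} [CommRing k]
    [AddCommGroup V] [Module k V] [AddCommGroup W] [Module k W] [AddCommGroup P] [Module k P]
    (f : V → W → P) : Prop where
  add_left : ∀ v v' w, f (v + v') w = f v w + f v' w
  smul_left : ∀ (c : k) v w, f (c • v) w = c • f v w
  add_right : ∀ v w w', f v (w + w') = f v w + f v w'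
  smul_right : ∀ (c : k) v w, f v (c • w) = c • f v w

/-- A function of three variables is trilinear. -/
structure Trilin (k : Type*) {V W U P : Type*} [CommRing k]
    [AddCommGroup V] [Module k V] [AddCommGroup W] [Module k W] [AddCommGroup U] [Module k U]
    [AddCommGroup P] [Module k P] (f : V → W → U → P) : Prop where
  add₁ : ∀ v v' w u, f (v + v') w u = f v w u + f v' w u
  smul₁ : ∀ (c : k) v w u, f (c • v) w u = c • f v w u
  add₂ : ∀ v w w' u, f v (w + w') u = f v w u + f v w' u
  smul₂ : ∀ (c : k) v w u, f v (c • w) u = c • f v w u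
  add₃ : ∀ v w u u', f v w (u + u') = f v w u + f v w u'
  smul₃ : ∀ (c : k) v w u, f v w (c • u) = c • f v w u

/-- The bundled bilinear map. -/
noncomputable def Bilin.toLin {f : V → W → P} (hf : Bilin k f) : V →ₗ[k] W →ₗ[k] P :=
  LinearMap.mk₂ k f hf.add_left hf.smul_left hf.add_right hf.smul_right

@[simp] theorem Bilin.toLin_apply {f : V → W → P} (hf : Bilin k f) (v : V) (w : W) :
    hf.toLin v w = f v w := rfl

/-- The bundled trilinear map. -/
noncomputable def Trilin.toLin {f : V → W → U → P} (hf : Trilin k f) :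
    V →ₗ[k] W →ₗ[k] U →ₗ[k] P :=
  LinearMap.mk₂ k (fun v w => ⟨⟨f v w, hf.add₃ v w⟩, fun c u => hf.smul₃ c v w u⟩)
    (fun v v' w => LinearMap.ext fun u => hf.add₁ v v' w u)
    (fun c v w => LinearMap.ext fun u => hf.smul₁ c v w u)
    (fun v w w' => LinearMap.ext fun u => hf.add₂ v w w' u)
    (fun c v w => LinearMap.ext fun u => hf.smul₂ c v w u)

@[simp] theorem Trilin.toLin_apply {f : V → W → U → P} (hf : Trilin k f) (v : V) (w : W) (u : U) :
    hf.toLin v w u = f v w u := rfl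

end Mk

section Legs
variable {k H V W U P : Type*} [CommRing k] [Ring H] [HopfAlgebra k H]
  [AddCommGroup V] [Module k V] [AddCommGroup W] [Module k W] [AddCommGroup U] [Module k U]
  [AddCommGroup P] [Module k P]
  (ρ₁ : H →ₐ[k] Module.End k V) (ρ₂ : H →ₐ[k] Module.End k W) (ρ₃ : H →ₐ[k] Module.End k U)

/-- `h₁ ⊗ (h₂ ⊗ h₃) ↦ f (h₁ ▷ v) (h₂ ▷ w) (h₃ ▷ u)`. -/
noncomputable def ev3 (f : V →ₗ[k] W →ₗ[k] U →ₗ[k] P) (v : V) (w : W) (u : U) :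
    H ⊗[k] (H ⊗[k] H) →ₗ[k] P :=
  TensorProduct.lift ((TensorProduct.lift.equiv (.id k) W U P).toLinearMap ∘ₗ f) ∘ₗ
    TensorProduct.map (ρ₁.toLinearMap.flip v)
      (TensorProduct.map (ρ₂.toLinearMap.flip w) (ρ₃.toLinearMap.flip u))

@[simp] theorem ev3_tmul (f : V →ₗ[k] W →ₗ[k] U →ₗ[k] P) (v : V) (w : W) (u : U) (x y z : H) :
    ev3 ρ₁ ρ₂ ρ₃ f v w u (x ⊗ₜ (y ⊗ₜ z)) = f (ρ₁ x v) (ρ₂ y w) (ρ₃ z u) := by simp [ev3]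

/-- Coassociativity. -/
theorem legs_coassoc (f : V → W → U → P) (ξ : H) (v : V) (w : W) (u : U)
    (hf : Trilin k f := by
      constructor <;> intros <;> simp [add_mul, mul_add, Finset.sum_add_distrib, Finset.smul_sum]) :
    ∑ p ∈ legs (comul (R := k) ξ), ∑ q ∈ legs (comul (R := k) p.1),
      f (ρ₁ q.1 v) (ρ₂ q.2 w) (ρ₃ p.2 u) =
    ∑ p ∈ legs (comul (R := k) ξ), ∑ q ∈ legs (comul (R := k) p.2),
      f (ρ₁ p.1 v) (ρ₂ q.1 w) (ρ₃ q.2 u) := by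
  have h := congrArg (ev3 ρ₁ ρ₂ ρ₃ hf.toLin v w u) (Coalgebra.coassoc_apply (R := k) ξ)
  rw [← sum_legs (comul (R := k) ξ)] at h
  simp only [map_sum, LinearMap.rTensor_tmul, LinearMap.lTensor_tmul] at h
  refine Eq.trans ?_ (h.trans ?_)
  · refine Finset.sum_congr rfl fun p _ => ?_
    conv_rhs => rw [← sum_legs (comul (R := k) p.1)]
    simp [TensorProduct.sum_tmul]
  · refine Finset.sum_congr rfl fun p _ => ?_
    conv_lhs => rw [← sum_legs (comul (R := k) p.2)]
    simp [TensorProduct.tmul_sum]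

variable [Triangular k H]

/-- `(id ⊗ Δ)(R⁻¹) = R⁻¹₁₂ R⁻¹₁₃`. -/
theorem legs_hexR (f : V → W → U → P) (v : V) (w : W) (u : U)
    (hf : Trilin k f := by
      constructor <;> intros <;> simp [add_mul, mul_add, Finset.sum_add_distrib, Finset.smul_sum]) :
    ∑ q ∈ legs (Rinv k H), ∑ p ∈ legs (comul (R := k) q.2),
      f (ρ₁ q.1 v) (ρ₂ p.1 w) (ρ₃ p.2 u) =
    ∑ r ∈ legs (Rinv k H), ∑ s ∈ legs (Rinv k H),
      f (ρ₁ r.1 (ρ₁ s.1 v)) (ρ₂ r.2 w) (ρ₃ s.2 u) := by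
  have h := congrArg (ev3 ρ₁ ρ₂ ρ₃ hf.toLin v w u) (hexagon_right_inv k H)
  rw [← sum_legs (Rinv k H)] at h
  simp only [map_sum, Finset.mul_sum, Finset.sum_mul, Algebra.TensorProduct.map_tmul,
      Algebra.TensorProduct.tmul_mul_tmul, Algebra.TensorProduct.includeLeft_apply,
      Algebra.TensorProduct.includeRight_apply, AlgHom.id_apply, Bialgebra.comulAlgHom_apply,
      ev3_tmul, one_mul, mul_one, map_mul, Module.End.mul_apply, Trilin.toLin_apply] at h
  rw [Finset.sum_comm] at h
  refine Eq.trans (Finset.sum_congr rfl fun q _ => ?_) h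
  conv_rhs => rw [← sum_legs (comul (R := k) q.2)]
  simp [TensorProduct.tmul_sum]

/-- `(Δ ⊗ id)(R⁻¹) = R⁻¹₂₃ R⁻¹₁₃`. -/
theorem legs_hexL (f : V → W → U → P) (v : V) (w : W) (u : U)
    (hf : Trilin k f := by
      constructor <;> intros <;> simp [add_mul, mul_add, Finset.sum_add_distrib, Finset.smul_sum]) :
    ∑ q ∈ legs (Rinv k H), ∑ p ∈ legs (comul (R := k) q.1),
      f (ρ₁ p.1 v) (ρ₂ p.2 w) (ρ₃ q.2 u) =
    ∑ r ∈ legs (Rinv k H), ∑ s ∈ legs (Rinv k H),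
      f (ρ₁ s.1 v) (ρ₂ r.1 w) (ρ₃ r.2 (ρ₃ s.2 u)) := by
  have h := congrArg (ev3 ρ₁ ρ₂ ρ₃ hf.toLin v w u ∘ₗ (TensorProduct.assoc k H H H).toLinearMap)
    (hexagon_left_inv k H)
  rw [← sum_legs (Rinv k H)] at h
  simp only [map_sum, Finset.mul_sum, Finset.sum_mul, Algebra.TensorProduct.map_tmul,
      Algebra.TensorProduct.tmul_mul_tmul, Algebra.TensorProduct.includeLeft_apply,
      Algebra.TensorProduct.includeRight_apply, AlgHom.id_apply, Bialgebra.comulAlgHom_apply,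
      LinearMap.comp_apply, LinearEquiv.coe_coe, TensorProduct.assoc_tmul,
      ev3_tmul, one_mul, mul_one, map_mul, Module.End.mul_apply, Trilin.toLin_apply] at h
  rw [Finset.sum_comm] at h
  refine Eq.trans (Finset.sum_congr rfl fun q _ => ?_) h
  conv_rhs => rw [← sum_legs (comul (R := k) q.1)]
  simp [TensorProduct.sum_tmul]

/-- `Δ(ξ) R⁻¹ = R⁻¹ Δ₂₁(ξ)`. -/
theorem legs_comul_Rinv (f : V → W → P) (ξ : H) (v : V) (w : W)
    (hf : Bilin k f := by
      constructor <;> intros <;> simp [add_mul, mul_add, Finset.sum_add_distrib, Finset.smul_sum]) :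
    ∑ r ∈ legs (Rinv k H), ∑ p ∈ legs (comul (R := k) ξ),
      f (ρ₁ p.1 (ρ₁ r.1 v)) (ρ₂ p.2 (ρ₂ r.2 w)) =
    ∑ p ∈ legs (comul (R := k) ξ), ∑ r ∈ legs (Rinv k H),
      f (ρ₁ r.1 (ρ₁ p.2 v)) (ρ₂ r.2 (ρ₂ p.1 w)) := by
  have h := congrArg (ev2 ρ₁ ρ₂ hf.toLin v w) (Rinv_mul_comul_flip k H ξ)
  have h2 := ev2_mul ρ₁ ρ₂ hf.toLin v w (comul (R := k) ξ) (Rinv k H)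
  simp only [Bilin.toLin_apply] at h2
  rw [← h2, ← h]
  conv_lhs => rw [← sum_legs (Rinv k H), ← sum_legs (comul (R := k) ξ)]
  simp [Finset.mul_sum, Finset.sum_mul]

/-- `R⁻¹ R⁻¹₂₁ = 1`. -/
theorem legs_Rinv_flip (f : V → W → P) (v : V) (w : W)
    (hf : Bilin k f := by
      constructor <;> intros <;> simp [add_mul, mul_add, Finset.sum_add_distrib, Finset.smul_sum]) :
    ∑ r ∈ legs (Rinv k H), ∑ s ∈ legs (Rinv k H),
      f (ρ₁ s.1 (ρ₁ r.2 v)) (ρ₂ s.2 (ρ₂ r.1 w)) = f v w := by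
  have h1 : Rinv k H * TensorProduct.comm k H H (Rinv k H) = 1 := by
    have : TensorProduct.comm k H H (Rinv k H) = Triangular.R (k := k) (H := H) := by
      simp [Rinv]
    rw [this, Rinv, Triangular.flip_mul_R]
  have h := congrArg (ev2 ρ₁ ρ₂ hf.toLin v w) h1
  rw [← sum_legs (Rinv k H)] at h
  simpa [Finset.mul_sum, Finset.sum_mul, Algebra.TensorProduct.one_def] using h

variable (k H) in
-- Applying `ε` to the first leg of `(Δ ⊗ id)(R⁻¹) = R⁻¹₂₃ R⁻¹₁₃` gives `R⁻¹ = R⁻¹ (1 ⊗ (ε ⊗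
-- id)(R⁻¹))`, and the invertible factor `R⁻¹` cancels.
theorem sum_counit_smul_Rinv : ∑ r ∈ legs (Rinv k H), counit (R := k) r.1 • r.2 = 1 := by
  let E : H ⊗[k] H →ₐ[k] H := (Algebra.TensorProduct.lid k H).toAlgHom.comp
    (Algebra.TensorProduct.map (Bialgebra.counitAlgHom k H) (AlgHom.id k H))
  have hE : ∀ x y, E (x ⊗ₜ y) = counit (R := k) x • y := fun x y => by simp [E]
  have h1 : E.comp (Bialgebra.comulAlgHom k H) = AlgHom.id k H := by
    ext ξ
    have := congrArg (TensorProduct.lid k H) (Coalgebra.rTensor_counit_comul (R := k) ξ)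
    rw [← sum_legs (comul (R := k) ξ)] at this
    simp only [AlgHom.comp_apply, Bialgebra.comulAlgHom_apply]
    rw [← sum_legs (comul (R := k) ξ)]
    simpa [hE] using this
  have h2 : E.comp (Algebra.TensorProduct.includeRight : H →ₐ[k] H ⊗[k] H) = AlgHom.id k H := by
    ext; simp [hE]
  have h := congrArg (Algebra.TensorProduct.map E (AlgHom.id k H)) (hexagon_left_inv k H)
  rw [map_mul] at h
  simp only [← AlgHom.comp_apply, ← Algebra.TensorProduct.map_comp, h1, h2,
    AlgHom.comp_id] at h
  rw [Algebra.TensorProduct.map_id, AlgHom.id_apply] at h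
  have h3 := congrArg (fun x => E (Triangular.R (k := k) (H := H) * x)) h
  simp only [← mul_assoc] at h3
  rw [Rinv, Triangular.R_mul_flip, one_mul, map_one] at h3
  rw [h3, ← sum_legs (TensorProduct.comm k H H (Triangular.R (k := k) (H := H)))]
  simp [hE, Rinv]

variable (k H) in
-- Since `ε ⊗ id` is multiplicative and takes `R⁻¹` to `1`, it also takes `R` to `1`; and `R` is the
-- flip of `R⁻¹`.
theorem sum_counit_smul_Rinv' : ∑ r ∈ legs (Rinv k H), counit (R := k) r.2 • r.1 = 1 := by
  let E : H ⊗[k] H →ₐ[k] H := (Algebra.TensorProduct.lid k H).toAlgHom.comp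
    (Algebra.TensorProduct.map (Bialgebra.counitAlgHom k H) (AlgHom.id k H))
  have hE : ∀ x y, E (x ⊗ₜ y) = counit (R := k) x • y := fun x y => by simp [E]
  have h := congrArg E (Triangular.R_mul_flip (k := k) (H := H))
  have h1 : E (TensorProduct.comm k H H (Triangular.R (k := k) (H := H))) = 1 := by
    rw [← sum_counit_smul_Rinv k H, ← Rinv]
    conv_lhs => rw [← sum_legs (Rinv k H)]
    simp [hE]
  rw [map_mul, h1, mul_one, map_one] at h
  rw [← h, show Triangular.R (k := k) (H := H) = TensorProduct.comm k H H (Rinv k H) by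
    simp [Rinv]]
  conv_rhs => rw [← sum_legs (Rinv k H)]
  simp [hE]

theorem legs_Rinv_counit_left (f : W → P) (w : W)
    (hf : IsLinearMap k f := by
      constructor <;> intros <;> simp [add_mul, mul_add, Finset.sum_add_distrib, Finset.smul_sum]) :
    ∑ r ∈ legs (Rinv k H), counit (R := k) r.1 • f (ρ₂ r.2 w) = f w := by
  have h := congrArg (hf.mk' f ∘ₗ ρ₂.toLinearMap.flip w) (sum_counit_smul_Rinv k H)
  simpa using h

theorem legs_Rinv_counit_right (f : W → P) (w : W)
    (hf : IsLinearMap k f := by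
      constructor <;> intros <;> simp [add_mul, mul_add, Finset.sum_add_distrib, Finset.smul_sum]) :
    ∑ r ∈ legs (Rinv k H), counit (R := k) r.2 • f (ρ₂ r.1 w) = f w := by
  have h := congrArg (hf.mk' f ∘ₗ ρ₂.toLinearMap.flip w) (sum_counit_smul_Rinv' k H)
  simpa using h

end Legs

/-! ### The triangular Hopf algebra `Super H` that encodes parities and Koszul signs. -/

/-- Functions on `ℤ/2` with values in `H`: the tensor product of `H` with the functions on `ℤ/2`.
Its modules are the `ℤ/2`-graded `H`-modules. -/
def Super (H : Type*) : Type _ := ZMod 2 → H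

/-- The Koszul sign of two parities. -/
def ksign (p q : ZMod 2) : ℤ := if p = 1 ∧ q = 1 then -1 else 1

theorem ksign_add_left : ∀ p q r : ZMod 2, ksign (p + q) r = ksign p r * ksign q r := by decide
theorem ksign_add_right : ∀ p q r : ZMod 2, ksign r (p + q) = ksign r p * ksign r q := by decide
theorem ksign_comm : ∀ p q : ZMod 2, ksign p q = ksign q p := by decide
theorem ksign_mul_self : ∀ p q : ZMod 2, ksign p q * ksign p q = 1 := by decide
@[simp] theorem ksign_zero_left : ∀ q : ZMod 2, ksign 0 q = 1 := by decide
@[simp] theorem ksign_zero_right : ∀ q : ZMod 2, ksign q 0 = 1 := by decide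

namespace Super

section Ring
variable (k : Type*) {H : Type*} [CommRing k] [Ring H] [Algebra k H]

instance : Ring (Super H) := inferInstanceAs (Ring (ZMod 2 → H))
instance : Algebra k (Super H) := inferInstanceAs (Algebra k (ZMod 2 → H))

/-- Evaluation at a parity. -/
def ev (p : ZMod 2) : Super H →ₐ[k] H := Pi.evalAlgHom k (fun _ : ZMod 2 => H) p

/-- Extension by zero. -/
def single (p : ZMod 2) : H →ₗ[k] Super H := LinearMap.single k (fun _ : ZMod 2 => H) p

theorem ev_single (p q : ZMod 2) (x : H) : ev k p (single k q x) = if p = q then x else 0 := by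
  change (Pi.single q x : ZMod 2 → H) p = _
  rw [Pi.single_apply]

theorem sum_single_ev (x : Super H) : ∑ p, single k p (ev k p x) = x :=
  Finset.univ_sum_single (M := fun _ : ZMod 2 => H) x

variable {k} in
theorem ext_ev {x y : Super H} (h : ∀ p, ev k p x = ev k p y) : x = y := funext h

/-- Evaluation on a tensor product. -/
noncomputable def ev2 (p q : ZMod 2) : Super H ⊗[k] Super H →ₐ[k] H ⊗[k] H :=
  Algebra.TensorProduct.map (ev k p) (ev k q)

theorem sum_single_ev2 (x : Super H ⊗[k] Super H) :
    ∑ p, ∑ q, TensorProduct.map (single k p) (single k q) (ev2 k p q x) = x := by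
  induction x using TensorProduct.induction_on with
  | zero => simp
  | add x y hx hy => 
    conv_rhs => rw [← hx, ← hy]
    simp only [map_add, Finset.sum_add_distrib]
  | tmul x y =>
    conv_rhs => rw [← sum_single_ev k x, ← sum_single_ev k y, TensorProduct.sum_tmul]
    simp [ev2, TensorProduct.tmul_sum]

variable {k} in
-- With this lemma and its threefold versions every axiom of `Super H` is checked parity by parity,
-- where it becomes the axiom of `H` up to a sign.
theorem ext2 {x y : Super H ⊗[k] Super H} (h : ∀ p q, ev2 k p q x = ev2 k p q y) : x = y := by
  rw [← sum_single_ev2 k x, ← sum_single_ev2 k y]; simp only [h]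

theorem ev2_map_single (p q p' q' : ZMod 2) (t : H ⊗[k] H) :
    ev2 k p q (TensorProduct.map (single k p') (single k q') t) =
      if p = p' ∧ q = q' then t else 0 := by
  induction t using TensorProduct.induction_on with
  | zero => simp
  | add x y hx hy => simp only [map_add, hx, hy]; split_ifs <;> simp
  | tmul x y =>
    simp only [TensorProduct.map_tmul, ev2, Algebra.TensorProduct.map_tmul, ev_single]
    by_cases h1 : p = p' <;> by_cases h2 : q = q' <;> simp [h1, h2]

/-- Evaluation on a triple tensor product. -/
noncomputable def ev3 (p q r : ZMod 2) :
    Super H ⊗[k] (Super H ⊗[k] Super H) →ₐ[k] H ⊗[k] (H ⊗[k] H) :=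
  Algebra.TensorProduct.map (ev k p) (ev2 k q r)

variable {k} in
theorem ext3 {x y : Super H ⊗[k] (Super H ⊗[k] Super H)}
    (h : ∀ p q r, ev3 k p q r x = ev3 k p q r y) : x = y := by
  have key : ∀ x : Super H ⊗[k] (Super H ⊗[k] Super H), ∑ p, ∑ q, ∑ r,
      TensorProduct.map (single k p) (TensorProduct.map (single k q) (single k r))
        (ev3 k p q r x) = x := fun x => by
    induction x using TensorProduct.induction_on with
    | zero => simp
    | add x y hx hy =>
      conv_rhs => rw [← hx, ← hy]
      simp only [map_add, Finset.sum_add_distrib]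
    | tmul x y =>
      conv_rhs => rw [← sum_single_ev k x, ← sum_single_ev2 k y, TensorProduct.sum_tmul]
      simp [ev3, TensorProduct.tmul_sum]
  rw [← key x, ← key y]; simp only [h]

/-- Evaluation on a triple tensor product, bracketed to the left. -/
noncomputable def ev3' (p q r : ZMod 2) :
    (Super H ⊗[k] Super H) ⊗[k] Super H →ₐ[k] (H ⊗[k] H) ⊗[k] H :=
  Algebra.TensorProduct.map (ev2 k p q) (ev k r)

theorem assoc_ev3' (p q r : ZMod 2) (x : (Super H ⊗[k] Super H) ⊗[k] Super H) :
    ev3 k p q r (TensorProduct.assoc k _ _ _ x) = TensorProduct.assoc k _ _ _ (ev3' k p q r x) := by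
  induction x using TensorProduct.induction_on with
  | zero => simp
  | add x y hx hy => simp only [map_add, hx, hy]
  | tmul x y =>
    induction x using TensorProduct.induction_on with
    | zero => simp
    | add x y hx hy => simp only [TensorProduct.add_tmul, map_add, hx, hy]
    | tmul x z => simp [ev3, ev3', ev2]

variable {k} in
theorem ext3' {x y : (Super H ⊗[k] Super H) ⊗[k] Super H}
    (h : ∀ p q r, ev3' k p q r x = ev3' k p q r y) : x = y := by
  apply (TensorProduct.assoc k _ _ _).injective
  refine ext3 fun p q r => ?_
  rw [assoc_ev3', assoc_ev3', h]

theorem ev2_comm (p q : ZMod 2) (x : Super H ⊗[k] Super H) :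
    ev2 k p q (TensorProduct.comm k _ _ x) = TensorProduct.comm k _ _ (ev2 k q p x) := by
  induction x using TensorProduct.induction_on with
  | zero => simp
  | add x y hx hy => simp only [map_add, hx, hy]
  | tmul x y => simp [ev2]

/-- The parity shift. -/
def shift : Super H →ₐ[k] Super H :=
  AlgHom.pi (fun p => ev k (p + 1) : (p : ZMod 2) → Super H →ₐ[k] (fun _ => H) p)

theorem ev_shift (p : ZMod 2) (x : Super H) : ev k p (shift k x) = ev k (p + 1) x := rfl

/-- The parity operator. -/
def par : Super H := fun p => ksign p 1 • (1 : H)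

theorem ev_par (p : ZMod 2) : ev k p (par : Super H) = ksign p 1 • (1 : H) := rfl

/-- The elements of parity independent value. -/
def const : H →ₐ[k] Super H := 
  AlgHom.pi (fun _ => AlgHom.id k H : (p : ZMod 2) → H →ₐ[k] (fun _ => H) p)

@[simp] theorem ev_const (p : ZMod 2) (x : H) : ev k p (const k x) = x := rfl

theorem par_mul (x : Super H) : par * x = x * par := funext fun p => by
  change (ksign p 1 • (1 : H)) * x p = x p * (ksign p 1 • (1 : H))
  rw [smul_mul_assoc, mul_smul_comm, one_mul, mul_one]

theorem shift_shift (x : Super H) : shift k (shift k x) = x := by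
  refine ext_ev (k := k) fun p => ?_
  rw [ev_shift, ev_shift, show p + 1 + 1 = p by revert p; decide]

end Ring

section Hopf
variable {k H : Type*} [CommRing k] [Ring H] [HopfAlgebra k H]

/-- The component of `Δ(x)` at `(p, q)` is `Δ` of the component of `x` at `p + q`, so that parities
add up in tensor products of modules. The counit evaluates at `0`, so that the unit is even. -/
noncomputable instance : CoalgebraStruct k (Super H) where
  comul := ∑ p, ∑ q, TensorProduct.map (single k p) (single k q) ∘ₗ comul ∘ₗ (ev k (p + q)).toLinearMap
  counit := counit ∘ₗ (ev k 0).toLinearMap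

theorem ev2_comul (p q : ZMod 2) (x : Super H) :
    ev2 k p q (comul x) = comul (ev k (p + q) x) := by
  change ev2 k p q ((∑ p, ∑ q, TensorProduct.map (single k p) (single k q) ∘ₗ comul ∘ₗ
    (ev k (p + q)).toLinearMap : Super H →ₗ[k] Super H ⊗[k] Super H) x) = _
  simp only [LinearMap.sum_apply, LinearMap.comp_apply, map_sum, ev2_map_single, ite_and]
  simp

theorem counit_eq (x : Super H) : counit (R := k) x = counit (R := k) (ev k 0 x) := rfl

noncomputable instance : Coalgebra k (Super H) where
  coassoc := by
    refine LinearMap.ext fun x => ext3 fun p q r => ?_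
    have h1 : ∀ t : Super H ⊗[k] Super H, ev3' k p q r (comul.rTensor _ t) =
        comul.rTensor _ (ev2 k (p + q) r t) := fun t => by
      induction t using TensorProduct.induction_on with
      | zero => simp
      | add x y hx hy => simp only [map_add, hx, hy]
      | tmul x y => simp [ev3', ev2_comul]; simp [ev2]
    have h2 : ∀ t : Super H ⊗[k] Super H, ev3 k p q r (comul.lTensor _ t) =
        comul.lTensor _ (ev2 k p (q + r) t) := fun t => by
      induction t using TensorProduct.induction_on with
      | zero => simp
      | add x y hx hy => simp only [map_add, hx, hy]
      | tmul x y => simp [ev3, ev2_comul]; simp [ev2]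
    simp only [LinearMap.comp_apply, LinearEquiv.coe_coe, assoc_ev3', h1, h2, ev2_comul, add_assoc]
    exact Coalgebra.coassoc_apply _
  rTensor_counit_comp_comul := by
    refine LinearMap.ext fun x => (TensorProduct.lid k _).injective (ext_ev (k := k) fun q => ?_)
    have h1 : ∀ t : Super H ⊗[k] Super H, ev k q (TensorProduct.lid k _ (counit.rTensor _ t)) =
        TensorProduct.lid k _ (counit.rTensor _ (ev2 k 0 q t)) := fun t => by
      induction t using TensorProduct.induction_on with
      | zero => simp
      | add x y hx hy => simp only [map_add, hx, hy]
      | tmul x y => simp [counit_eq, ev2]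
    rw [LinearMap.comp_apply, h1, ev2_comul, Coalgebra.rTensor_counit_comul]
    simp
  lTensor_counit_comp_comul := by
    refine LinearMap.ext fun x => (TensorProduct.rid k _).injective (ext_ev (k := k) fun q => ?_)
    have h1 : ∀ t : Super H ⊗[k] Super H, ev k q (TensorProduct.rid k _ (counit.lTensor _ t)) =
        TensorProduct.rid k _ (counit.lTensor _ (ev2 k q 0 t)) := fun t => by
      induction t using TensorProduct.induction_on with
      | zero => simp
      | add x y hx hy => simp only [map_add, hx, hy]
      | tmul x y => simp [counit_eq, ev2]
    rw [LinearMap.comp_apply, h1, ev2_comul, Coalgebra.lTensor_counit_comul]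
    simp

noncomputable instance : Bialgebra k (Super H) :=
  Bialgebra.mk' k (Super H) (by simp [counit_eq]) (by simp [counit_eq])
    (ext2 fun p q => by simp [ev2_comul]) (ext2 fun p q => by simp [ev2_comul])

/-- The antipode. -/
noncomputable def superAntipode : Super H →ₗ[k] Super H where
  toFun x := fun p => antipode k (ev k p x)
  map_add' x y := funext fun p => by
    change antipode k (ev k p (x + y)) = antipode k (ev k p x) + antipode k (ev k p y)
    simp
  map_smul' c x := funext fun p => by
    change antipode k (ev k p (c • x)) = c • antipode k (ev k p x)
    simp

theorem ev_superAntipode (p : ZMod 2) (x : Super H) :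
    ev k p (superAntipode (k := k) x) = antipode k (ev k p x) := rfl

/-- The antipode can be taken pointwise because `-p = p` in `ℤ/2`: the antipode axiom at `p`
involves only the component of `Δ(x)` at `(p, p)`, which is `Δ` of the value of `x` at `p + p = 0`.
-/
noncomputable instance : HopfAlgebra k (Super H) where
  antipode := superAntipode
  mul_antipode_rTensor_comul := by
    refine LinearMap.ext fun x => ext_ev (k := k) fun p => ?_
    have h1 : ∀ t : Super H ⊗[k] Super H,
        ev k p (LinearMap.mul' k _ (LinearMap.rTensor _ superAntipode t)) =
        LinearMap.mul' k _ ((antipode k).rTensor _ (ev2 k p p t)) := fun t => by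
      induction t using TensorProduct.induction_on with
      | zero => simp
      | add x y hx hy => simp only [map_add, hx, hy]
      | tmul x y => simp [ev2, ev_superAntipode]
    rw [LinearMap.comp_apply, LinearMap.comp_apply, h1, ev2_comul,
      CharTwo.add_self_eq_zero p]
    simp [counit_eq]
  mul_antipode_lTensor_comul := by
    refine LinearMap.ext fun x => ext_ev (k := k) fun p => ?_
    have h1 : ∀ t : Super H ⊗[k] Super H,
        ev k p (LinearMap.mul' k _ (LinearMap.lTensor _ superAntipode t)) =
        LinearMap.mul' k _ ((antipode k).lTensor _ (ev2 k p p t)) := fun t => by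
      induction t using TensorProduct.induction_on with
      | zero => simp
      | add x y hx hy => simp only [map_add, hx, hy]
      | tmul x y => simp [ev2, ev_superAntipode]
    rw [LinearMap.comp_apply, LinearMap.comp_apply, h1, ev2_comul,
      CharTwo.add_self_eq_zero p]
    simp [counit_eq]

theorem ev3_map_comul (p q r : ZMod 2) (t : Super H ⊗[k] Super H) :
    ev3 k p q r (Algebra.TensorProduct.map (AlgHom.id k _) (Bialgebra.comulAlgHom k _) t) =
      Algebra.TensorProduct.map (AlgHom.id k _) (Bialgebra.comulAlgHom k _)
        (ev2 k p (q + r) t) := by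
  induction t using TensorProduct.induction_on with
  | zero => simp
  | add x y hx hy => simp only [map_add, hx, hy]
  | tmul x y => simp [ev3, ev2_comul]; simp [ev2]

theorem ev3'_map_comul (p q r : ZMod 2) (t : Super H ⊗[k] Super H) :
    ev3' k p q r (Algebra.TensorProduct.map (Bialgebra.comulAlgHom k _) (AlgHom.id k _) t) =
      Algebra.TensorProduct.map (Bialgebra.comulAlgHom k _) (AlgHom.id k _)
        (ev2 k (p + q) r t) := by
  induction t using TensorProduct.induction_on with
  | zero => simp
  | add x y hx hy => simp only [map_add, hx, hy]
  | tmul x y => simp [ev3', ev2_comul]; simp [ev2]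

/-- The coproduct depends only on the sum of the two parities, so a shift may be put on either leg.
This is what lets an odd bracket be treated as an even map with one argument shifted. -/
theorem comul_shift (x : Super H) : comul (R := k) (shift k x) =
    TensorProduct.map (shift k).toLinearMap LinearMap.id (comul (R := k) x) := by
  have h : ∀ p q, ∀ t : Super H ⊗[k] Super H, ev2 k p q (TensorProduct.map
      (shift k).toLinearMap LinearMap.id t) = ev2 k (p + 1) q t := fun p q t => by
    induction t using TensorProduct.induction_on with
    | zero => simp
    | add x y hx hy => simp only [map_add, hx, hy]
    | tmul x y => simp [ev2, ev_shift]
  refine ext2 fun p q => ?_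
  rw [h, ev2_comul, ev2_comul, ev_shift, add_right_comm]

theorem comul_shift' (x : Super H) : comul (R := k) (shift k x) =
    TensorProduct.map LinearMap.id (shift k).toLinearMap (comul (R := k) x) := by
  have h : ∀ p q, ∀ t : Super H ⊗[k] Super H, ev2 k p q (TensorProduct.map
      LinearMap.id (shift k).toLinearMap t) = ev2 k p (q + 1) t := fun p q t => by
    induction t using TensorProduct.induction_on with
    | zero => simp
    | add x y hx hy => simp only [map_add, hx, hy]
    | tmul x y => simp [ev2, ev_shift]
  refine ext2 fun p q => ?_
  rw [h, ev2_comul, ev2_comul, ev_shift, add_assoc]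

theorem comul_const (x : H) : comul (R := k) (const k x) =
    TensorProduct.map (const k).toLinearMap (const k).toLinearMap (comul (R := k) x) := by
  have h : ∀ p q, ∀ t : H ⊗[k] H, ev2 k p q (TensorProduct.map
      (const k).toLinearMap (const k).toLinearMap t) = t := fun p q t => by
    induction t using TensorProduct.induction_on with
    | zero => simp
    | add x y hx hy => simp only [map_add, hx, hy]
    | tmul x y => simp [ev2]
  refine ext2 fun p q => ?_
  rw [h, ev2_comul, ev_const]

variable [Triangular k H]

/-- The `R`-matrix of `H` with Koszul signs. -/
noncomputable def superR (k H : Type*) [CommRing k] [Ring H] [HopfAlgebra k H] [Triangular k H] :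
    Super H ⊗[k] Super H := ∑ p, ∑ q, ksign p q •
  TensorProduct.map (single k p) (single k q) (Triangular.R (k := k) (H := H))

theorem ev2_superR (p q : ZMod 2) :
    ev2 k p q (superR k H) = ksign p q • Triangular.R (k := k) (H := H) := by
  simp only [superR, map_sum, map_zsmul, ev2_map_single, ite_and]
  simp

/-- The sign is a symmetric bicharacter with square one. Bimultiplicativity gives the two hexagons,
and symmetry together with the square gives `R R₂₁ = 1`. -/
noncomputable instance : Triangular k (Super H) where
  R := superR k H
  R_mul_flip := ext2 fun p q => by
    simp only [map_mul, ev2_comm, ev2_superR, map_zsmul, map_one, smul_mul_smul_comm,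
      Triangular.R_mul_flip, ksign_comm q p, ksign_mul_self, one_smul]
  flip_mul_R := ext2 fun p q => by
    simp only [map_mul, ev2_comm, ev2_superR, map_zsmul, map_one, smul_mul_smul_comm,
      Triangular.flip_mul_R, ksign_comm q p, ksign_mul_self, one_smul]
  comul_flip_mul ξ := ext2 fun p q => by
    simp only [map_mul, ev2_comm, ev2_superR, ev2_comul, mul_smul_comm, smul_mul_assoc,
      add_comm q p, Triangular.comul_flip_mul]
  hexagon_left := ext3' fun p q r => by
    have hl : ∀ t : Super H ⊗[k] Super H, ev3' k p q r (Algebra.TensorProduct.map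
        (Algebra.TensorProduct.includeLeft : Super H →ₐ[k] Super H ⊗[k] Super H)
        (AlgHom.id k _) t) = Algebra.TensorProduct.map
        (Algebra.TensorProduct.includeLeft : H →ₐ[k] H ⊗[k] H) (AlgHom.id k _) (ev2 k p r t) :=
      fun t => by
      induction t using TensorProduct.induction_on with
      | zero => simp
      | add x y hx hy => simp only [map_add, hx, hy]
      | tmul x y => simp [ev3', ev2]
    have hr : ∀ t : Super H ⊗[k] Super H, ev3' k p q r (Algebra.TensorProduct.map
        (Algebra.TensorProduct.includeRight : Super H →ₐ[k] Super H ⊗[k] Super H)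
        (AlgHom.id k _) t) = Algebra.TensorProduct.map
        (Algebra.TensorProduct.includeRight : H →ₐ[k] H ⊗[k] H) (AlgHom.id k _) (ev2 k q r t) :=
      fun t => by
      induction t using TensorProduct.induction_on with
      | zero => simp
      | add x y hx hy => simp only [map_add, hx, hy]
      | tmul x y => simp [ev3', ev2]
    rw [map_mul, ev3'_map_comul, hl, hr, ev2_superR, ev2_superR, ev2_superR, map_zsmul, map_zsmul,
      map_zsmul, Triangular.hexagon_left, smul_mul_smul_comm, ksign_add_left]
  hexagon_right := ext3 fun p q r => by
    have hl : ∀ t : Super H ⊗[k] Super H, ev3 k p q r (Algebra.TensorProduct.map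
        (AlgHom.id k _) (Algebra.TensorProduct.includeLeft :
          Super H →ₐ[k] Super H ⊗[k] Super H) t) = Algebra.TensorProduct.map
        (AlgHom.id k _) (Algebra.TensorProduct.includeLeft : H →ₐ[k] H ⊗[k] H) (ev2 k p q t) :=
      fun t => by
      induction t using TensorProduct.induction_on with
      | zero => simp
      | add x y hx hy => simp only [map_add, hx, hy]
      | tmul x y => simp [ev3, ev2]
    have hr : ∀ t : Super H ⊗[k] Super H, ev3 k p q r (Algebra.TensorProduct.map
        (AlgHom.id k _) (Algebra.TensorProduct.includeRight :
          Super H →ₐ[k] Super H ⊗[k] Super H) t) = Algebra.TensorProduct.map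
        (AlgHom.id k _) (Algebra.TensorProduct.includeRight : H →ₐ[k] H ⊗[k] H) (ev2 k p r t) :=
      fun t => by
      induction t using TensorProduct.induction_on with
      | zero => simp
      | add x y hx hy => simp only [map_add, hx, hy]
      | tmul x y => simp [ev3, ev2]
    rw [map_mul, ev3_map_comul, hl, hr, ev2_superR, ev2_superR, ev2_superR, map_zsmul, map_zsmul,
      map_zsmul, Triangular.hexagon_right, smul_mul_smul_comm, ksign_add_right, mul_comm]

theorem ev2_Rinv (p q : ZMod 2) : ev2 k p q (Rinv k (Super H)) = ksign p q • Rinv k H := by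
  rw [Rinv, ev2_comm, show Triangular.R (k := k) (H := Super H) = superR k H from rfl,
    ev2_superR, map_zsmul, ksign_comm, Rinv]

/-- By bimultiplicativity the sign of `(p + 1, q)` is the sign of `(p, q)` times the sign of `(1,
q)`, and the latter is the parity operator on the second leg. -/
theorem map_shift_left_Rinv : TensorProduct.map (shift k).toLinearMap LinearMap.id
    (Rinv k (Super H)) = (1 ⊗ₜ par) * Rinv k (Super H) := by
  have h : ∀ p q, ∀ t : Super H ⊗[k] Super H, ev2 k p q (TensorProduct.map
      (shift k).toLinearMap LinearMap.id t) = ev2 k (p + 1) q t := fun p q t => by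
    induction t using TensorProduct.induction_on with
    | zero => simp
    | add x y hx hy => simp only [map_add, hx, hy]
    | tmul x y => simp [ev2, ev_shift]
  refine ext2 fun p q => ?_
  rw [h, map_mul, ev2_Rinv, ev2_Rinv, ksign_add_left, ksign_comm 1 q, mul_comm, mul_smul,
    mul_smul_comm]
  simp only [ev2, ev_par, Algebra.TensorProduct.map_tmul, map_one, TensorProduct.tmul_smul,
    ← Algebra.TensorProduct.one_def, smul_mul_assoc, one_mul]
  rw [smul_comm]

end Hopf
end Super

/-! ### Evaluation of sums over legs of `Super H` on homogeneous arguments. -/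

section SuperLegs
variable {k H V W P : Type*} [CommRing k] [Ring H] [HopfAlgebra k H]
  [AddCommGroup V] [Module k V] [AddCommGroup W] [Module k W] [AddCommGroup P] [Module k P]
  (ρ₁ : H →ₐ[k] Module.End k V) (ρ₂ : H →ₐ[k] Module.End k W)

theorem sum_legs_eq (f : V → W → P) (v : V) (w : W) (t : H ⊗[k] H)
    (hf : Bilin k f := by
      constructor <;> intros <;> simp [add_mul, mul_add, Finset.sum_add_distrib, Finset.smul_sum]) :
    ∑ r ∈ legs t, f (ρ₁ r.1 v) (ρ₂ r.2 w) = ev2 ρ₁ ρ₂ hf.toLin v w t :=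
  sum_legs_ev2 ρ₁ ρ₂ hf.toLin v w t

theorem legs_ev (f : V → W → P) (p q : ZMod 2) (t : Super H ⊗[k] Super H)
    (v : V) (w : W)
    (hf : Bilin k f := by
      constructor <;> intros <;> simp [add_mul, mul_add, Finset.sum_add_distrib, Finset.smul_sum]) :
    ∑ r ∈ legs t, f (ρ₁ (Super.ev k p r.1) v) (ρ₂ (Super.ev k q r.2) w) =
      ∑ r ∈ legs (Super.ev2 k p q t), f (ρ₁ r.1 v) (ρ₂ r.2 w) := by
  rw [sum_legs_eq ρ₁ ρ₂ f (hf := hf)]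
  conv_rhs => rw [← sum_legs t]
  simp [Super.ev2]

theorem legs_ev_comul (f : V → W → P) (p q : ZMod 2) (ξ : Super H)
    (v : V) (w : W)
    (hf : Bilin k f := by
      constructor <;> intros <;> simp [add_mul, mul_add, Finset.sum_add_distrib, Finset.smul_sum]) :
    ∑ r ∈ legs (comul (R := k) ξ), f (ρ₁ (Super.ev k p r.1) v) (ρ₂ (Super.ev k q r.2) w) =
      ∑ r ∈ legs (comul (R := k) (Super.ev k (p + q) ξ)), f (ρ₁ r.1 v) (ρ₂ r.2 w) := by
  rw [legs_ev ρ₁ ρ₂ f (hf := hf), Super.ev2_comul]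

theorem legs_comul_const {ρ₁ : Super H →ₐ[k] Module.End k V} {ρ₂ : Super H →ₐ[k] Module.End k W}
    (f : V → W → P) (ξ : H) (v : V) (w : W)
    (hf : Bilin k f := by
      constructor <;> intros <;> simp [add_mul, mul_add, Finset.sum_add_distrib, Finset.smul_sum]) :
    ∑ r ∈ legs (comul (R := k) (Super.const k ξ)), f (ρ₁ r.1 v) (ρ₂ r.2 w) =
      ∑ r ∈ legs (comul (R := k) ξ), f (ρ₁ (Super.const k r.1) v) (ρ₂ (Super.const k r.2) w) := by
  rw [sum_legs_eq ρ₁ ρ₂ f (hf := hf), Super.comul_const]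
  conv_lhs => rw [← sum_legs (comul (R := k) ξ)]
  simp

variable [Triangular k H]

/-- The passage from `Super H` back to `H`: on arguments of parities `p` and `q` only one component
of `R⁻¹` acts. All signs of the final formulas arise here. -/
theorem legs_ev_Rinv (f : V → W → P) (p q : ZMod 2) (v : V) (w : W)
    (hf : Bilin k f := by
      constructor <;> intros <;> simp [add_mul, mul_add, Finset.sum_add_distrib, Finset.smul_sum]) :
    ∑ r ∈ legs (Rinv k (Super H)), f (ρ₁ (Super.ev k p r.1) v) (ρ₂ (Super.ev k q r.2) w) =
      ksign p q • ∑ r ∈ legs (Rinv k H), f (ρ₁ r.1 v) (ρ₂ r.2 w) := by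
  rw [legs_ev ρ₁ ρ₂ f (hf := hf), Super.ev2_Rinv, sum_legs_eq ρ₁ ρ₂ f (hf := hf), sum_legs_eq ρ₁ ρ₂ f (hf := hf), map_zsmul]

end SuperLegs

/-! ### The tensor algebra of the bimodule of braided derivations: universal property, words,
induction. -/

section Tensor
variable {k H A : Type*} [CommRing k] [Ring H] [HopfAlgebra k H] [Triangular k H] [Ring A]
  [Algebra k A] [Module H A] [IsScalarTower k H A] [ModuleAlgebra k H A]

section
variable (k H A)
/-- The adjoint action on braided derivations as a homomorphism. -/
noncomputable def derAct : H →ₐ[k] Module.End k (Der k H A) :=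
  AlgHom.ofLinearMap (Der.act (k := k) (H := H) (A := A))
    (LinearMap.ext fun X => Subtype.ext (by simp [Der.act]))
    (fun x y => LinearMap.ext fun X => Subtype.ext (by simp [Der.act]))
end

theorem derAct_apply (ξ : H) (X : Der k H A) : derAct k H A ξ X = Der.act ξ X := rfl

theorem coe_derAct (ξ : H) (X : Der k H A) : (derAct k H A ξ X).1 = adj k H A ξ X.1 := rfl

variable [BraidedCommutative k H A]

section
variable (k H A)

/-- The left action as a bilinear map. -/
noncomputable def lactL : A →ₗ[k] Der k H A →ₗ[k] Der k H A :=
  LinearMap.mk₂ k Der.lact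
    (fun a b X => Subtype.ext (by ext; simp [Der.lact, add_mul]))
    (fun c a X => Subtype.ext (by ext; simp [Der.lact]))
    (fun a X Y => Subtype.ext (by ext; simp [Der.lact, mul_add]))
    (fun c a X => Subtype.ext (by ext; simp [Der.lact]))

/-- By definition `X · a` is the subtracted term of the commutator of `X` with left multiplication
by `a`, and for a braided derivation this commutator is left multiplication by `X(a)`. The formula
is free of `R`, which makes the bimodule axioms immediate. -/
theorem coe_ract (X : Der k H A) (a : A) : (Der.ract X a).1 =
    X.1 * LinearMap.mulLeft k a - LinearMap.mulLeft k (X.1 a) := by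
  rw [← mem_Der_iff.1 X.2 a, commutator, sub_sub_cancel]
  simp [Der.ract, Der.lact, adj_mulLeft, Der.act]

/-- The right action as a bilinear map. -/
noncomputable def ractL : Der k H A →ₗ[k] A →ₗ[k] Der k H A :=
  LinearMap.mk₂ k Der.ract
    (fun X Y a => Subtype.ext (by ext; simp [coe_ract, add_mul]; abel))
    (fun c X a => Subtype.ext (by ext; simp [coe_ract, smul_sub]))
    (fun X a b => Subtype.ext (by ext; simp [coe_ract, add_mul]; abel))
    (fun c X a => Subtype.ext (by ext; simp [coe_ract, smul_sub]))

/-- The map `A → T⁰`. -/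
noncomputable def tA : A →ₐ[k] TensorAlg k H A :=
  AlgHom.ofLinearMap ((RingQuot.mkAlgHom k (TensorRel k H A)).toLinearMap ∘ₗ
      TensorAlgebra.ι k ∘ₗ LinearMap.inl k A (Der k H A))
      (by simpa using mkAlgHom_ι_one)
      (fun a b => by
        simpa using (RingQuot.mkAlgHom_rel k (TensorRel.mul (k := k) (H := H) a b)).symm)

/-- The map `Der → T¹`. -/
noncomputable def tD : Der k H A →ₗ[k] TensorAlg k H A :=
  (RingQuot.mkAlgHom k (TensorRel k H A)).toLinearMap ∘ₗ
      TensorAlgebra.ι k ∘ₗ LinearMap.inr k A (Der k H A)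

theorem toTensorAlg_ι (X : Der k H A) :
    toTensorAlg k H A (TensorAlgebra.ι k X) = tD k H A X := by
  simp [toTensorAlg, tD]

theorem ofDer_eq (X : Der k H A) :
    ofDer X = RingQuot.mkAlgHom k (WedgeRel k H A) (tD k H A X) := by
  simp [ofDer, toMV, toTensorAlg_ι]

end

variable {E : Type*} [Semiring E] [Algebra k E]

theorem tA_mul_tD (a : A) (X : Der k H A) :
    tA k H A a * tD k H A X = tD k H A (Der.lact a X) := by
  simpa [tA, tD] using RingQuot.mkAlgHom_rel k (TensorRel.left (k := k) (H := H) a X)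

theorem tD_mul_tA (X : Der k H A) (a : A) :
    tD k H A X * tA k H A a = tD k H A (Der.ract X a) := by
  simpa [tA, tD] using RingQuot.mkAlgHom_rel k (TensorRel.right (k := k) (H := H) X a)

/-- The universal property of the tensor algebra of the bimodule of braided derivations. -/
noncomputable def tLift (α : A →ₐ[k] E) (β : Der k H A →ₗ[k] E)
    (hl : ∀ a X, α a * β X = β (Der.lact a X)) (hr : ∀ X a, β X * α a = β (Der.ract X a)) :
    TensorAlg k H A →ₐ[k] E :=
  RingQuot.liftAlgHom k ⟨TensorAlgebra.lift k (α.toLinearMap.coprod β), by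
    intro x y h
    cases h with
    | one => simp
    | mul a b => simp
    | left a X => simp [hl]
    | right X a => simp [hr]⟩

@[simp] theorem tLift_tA (α : A →ₐ[k] E) (β : Der k H A →ₗ[k] E) (hl hr) (a : A) :
    tLift α β hl hr (tA k H A a) = α a := by
  simp only [tLift, tA, AlgHom.ofLinearMap_apply, LinearMap.comp_apply, AlgHom.toLinearMap_apply]
  rw [RingQuot.liftAlgHom_mkAlgHom_apply]
  simp

@[simp] theorem tLift_tD (α : A →ₐ[k] E) (β : Der k H A →ₗ[k] E) (hl hr) (X : Der k H A) :
    tLift α β hl hr (tD k H A X) = β X := by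
  simp only [tLift, tD, LinearMap.comp_apply, AlgHom.toLinearMap_apply]
  rw [RingQuot.liftAlgHom_mkAlgHom_apply]
  simp

/-- For a general element `y` of the free algebra on `A × Der`, one shows that multiplication by the
class of `y` preserves the property; scalars are covered by the case of `A`. -/
theorem tInduction {p : TensorAlg k H A → Prop} (hadd : ∀ x y, p x → p y → p (x + y))
    (hA : ∀ a, p (tA k H A a)) (hmulA : ∀ a x, p x → p (tA k H A a * x))
    (hmulD : ∀ X x, p x → p (tD k H A X * x)) (x : TensorAlg k H A) : p x := by
  have key : ∀ y : TensorAlgebra k (A × Der k H A), ∀ x, p x →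
      p (RingQuot.mkAlgHom k (TensorRel k H A) y * x) := by
    intro y
    induction y using TensorAlgebra.induction with
    | algebraMap c =>
      intro x hx
      have := hmulA (algebraMap k A c) x hx
      rwa [AlgHom.commutes] at this ⊢
    | ι aX =>
      intro x hx
      have h : TensorAlgebra.ι k aX = TensorAlgebra.ι k (aX.1, (0 : Der k H A)) +
        TensorAlgebra.ι k (0, aX.2) := by rw [← map_add]; simp
      rw [h, map_add, add_mul]
      exact hadd _ _ (hmulA aX.1 x hx) (hmulD aX.2 x hx)
    | mul y z hy hz =>
      intro x hx
      rw [map_mul, mul_assoc]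
      exact hy _ (hz _ hx)
    | add y z hy hz =>
      intro x hx
      rw [map_add, add_mul]
      exact hadd _ _ (hy _ hx) (hz _ hx)
  obtain ⟨y, rfl⟩ := RingQuot.mkAlgHom_surjective k (TensorRel k H A) x
  have := key y _ (hA 1)
  rwa [map_one, mul_one] at this

/-- The word `X₁ ⊗_A ⋯ ⊗_A Xₙ`. -/
noncomputable def word (l : List (Der k H A)) : TensorAlg k H A := (l.map (tD k H A)).prod

@[simp] theorem word_nil : word ([] : List (Der k H A)) = 1 := rfl
@[simp] theorem word_cons (X : Der k H A) (l : List (Der k H A)) :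
    word (X :: l) = tD k H A X * word l := by simp [word]
theorem word_append (l m : List (Der k H A)) : word (l ++ m) = word l * word m := by simp [word]

theorem toTensorAlg_tensor (l : List (Der k H A)) : toTensorAlg k H A (tensor l) = word l := by
  simp [tensor, word, map_list_prod, Function.comp_def, toTensorAlg_ι]

section
variable (k H A)
/-- The span of the words of length `n`. -/
noncomputable def words (n : ℕ) : Submodule k (TensorAlg k H A) :=
  Submodule.span k {x | ∃ l : List (Der k H A), l.length = n ∧ x = word l}
end

theorem word_mem (l : List (Der k H A)) : word l ∈ words k H A l.length :=
  Submodule.subset_span ⟨l, rfl, rfl⟩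

theorem words_induction {n : ℕ} {p : TensorAlg k H A → Prop} (h0 : p 0)
    (hadd : ∀ x y, p x → p y → p (x + y)) (hsmul : ∀ (c : k) x, p x → p (c • x))
    (hw : ∀ l : List (Der k H A), l.length = n → p (word l)) (x : TensorAlg k H A)
    (hx : x ∈ words k H A n) : p x := by
  induction hx using Submodule.span_induction with
  | mem x h => obtain ⟨l, h, rfl⟩ := h; exact hw l h
  | zero => exact h0
  | add x y _ _ hx hy => exact hadd x y hx hy
  | smul c x _ hx => exact hsmul c x hx

theorem words_mul {n m : ℕ} {x y : TensorAlg k H A} (hx : x ∈ words k H A n)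
    (hy : y ∈ words k H A m) : x * y ∈ words k H A (n + m) := by
  have : words k H A n * words k H A m ≤ words k H A (n + m) := by
    rw [words, words, Submodule.span_mul_span, Submodule.span_le]
    rintro _ ⟨_, ⟨l, rfl, rfl⟩, _, ⟨m, rfl, rfl⟩, rfl⟩
    exact Submodule.subset_span ⟨l ++ m, by simp, (word_append l m).symm⟩
  exact this (Submodule.mul_mem_mul hx hy)

theorem tD_mem (X : Der k H A) : tD k H A X ∈ words k H A 1 := by
  simpa using word_mem [X]

/-- The coefficient is absorbed into the first factor. Positive length matters: the span of the
empty word is `k · 1` and not `A`. -/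
theorem tA_mul_mem {n : ℕ} (a : A) {x : TensorAlg k H A} (hx : x ∈ words k H A (n + 1)) :
    tA k H A a * x ∈ words k H A (n + 1) := by
  refine words_induction (n := n + 1) (p := fun x => tA k H A a * x ∈ words k H A (n + 1))
    (by simp) (fun x y hx hy => by rw [mul_add]; exact add_mem hx hy)
    (fun c x hx => by rw [mul_smul_comm]; exact Submodule.smul_mem _ c hx) (fun l hl => ?_) x hx
  obtain _ | ⟨X, l⟩ := l
  · simp at hl
  · rw [word_cons, ← mul_assoc, tA_mul_tD, ← word_cons]
    exact Submodule.subset_span ⟨_, by simpa using hl, rfl⟩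

theorem words_mul_tA {n : ℕ} (a : A) {x : TensorAlg k H A} (hx : x ∈ words k H A (n + 1)) :
    x * tA k H A a ∈ words k H A (n + 1) := by
  refine words_induction (n := n + 1) (p := fun x => x * tA k H A a ∈ words k H A (n + 1))
    (by simp) (fun x y hx hy => by rw [add_mul]; exact add_mem hx hy)
    (fun c x hx => by rw [smul_mul_assoc]; exact Submodule.smul_mem _ c hx) (fun l hl => ?_) x hx
  obtain rfl | ⟨l, X, rfl⟩ := l.eq_nil_or_concat'
  · simp at hl
  · have : word (l ++ [X]) * tA k H A a = word (l ++ [Der.ract X a]) := by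
      simp [word_append, mul_assoc, tD_mul_tA]
    rw [this]
    exact Submodule.subset_span ⟨_, by simpa using hl, rfl⟩

/-- The sums of elements of `A` and of combinations of words of positive length are stable under
left multiplication by generators, hence exhaust the tensor algebra. -/
theorem tInduction_word {p : TensorAlg k H A → Prop} (hadd : ∀ x y, p x → p y → p (x + y))
    (hA : ∀ a, p (tA k H A a)) (hw : ∀ n, ∀ x ∈ words k H A (n + 1), p x)
    (x : TensorAlg k H A) : p x := by
  let S : AddSubmonoid (TensorAlg k H A) := AddSubmonoid.closure
    (Set.range (tA k H A) ∪ ⋃ n, (words k H A (n + 1) : Set (TensorAlg k H A)))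
  have hS : ∀ x, x ∈ S := by
    refine tInduction (fun x y => add_mem) (fun a => AddSubmonoid.subset_closure (.inl ⟨a, rfl⟩))
      (fun a x hx => ?_) (fun X x hx => ?_)
    · induction hx using AddSubmonoid.closure_induction with
      | zero => rw [mul_zero]; exact zero_mem _
      | add x y _ _ hx hy => rw [mul_add]; exact add_mem hx hy
      | mem x hx =>
        refine AddSubmonoid.subset_closure ?_
        rcases hx with ⟨b, rfl⟩ | hx
        · exact .inl ⟨a * b, map_mul _ _ _⟩
        · obtain ⟨n, hn⟩ := Set.mem_iUnion.1 hx
          exact .inr (Set.mem_iUnion.2 ⟨n, tA_mul_mem a hn⟩)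
    · induction hx using AddSubmonoid.closure_induction with
      | zero => rw [mul_zero]; exact zero_mem _
      | add x y _ _ hx hy => rw [mul_add]; exact add_mem hx hy
      | mem x hx =>
        refine AddSubmonoid.subset_closure (.inr (Set.mem_iUnion.2 ?_))
        rcases hx with ⟨b, rfl⟩ | hx
        · exact ⟨0, by rw [tD_mul_tA]; exact tD_mem _⟩
        · obtain ⟨n, hn⟩ := Set.mem_iUnion.1 hx
          exact ⟨n + 1, by simpa [add_comm 1] using words_mul (tD_mem X) hn⟩
  have h0 : p 0 := by simpa using hA 0
  induction hS x using AddSubmonoid.closure_induction with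
  | zero => exact h0
  | add x y _ _ hx hy => exact hadd x y hx hy
  | mem x hx =>
    rcases hx with ⟨b, rfl⟩ | hx
    · exact hA b
    · obtain ⟨n, hn⟩ := Set.mem_iUnion.1 hx
      exact hw n x hn

end Tensor

/-! ### Calculus of braided derivations: skew symmetry, brackets with functions, compatibility with
the bimodule structure. -/

section CommutatorSkew
variable {k H E : Type*} [CommRing k] [Ring H] [HopfAlgebra k H] [Ring E] [Algebra k E]
  [Triangular k H]

theorem commutator_skew (ρ : H →ₐ[k] Module.End k E) (X Y : E) :
    commutator ρ X Y = -∑ r ∈ legs (Rinv k H), commutator ρ (ρ r.1 Y) (ρ r.2 X) := by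
  have h := legs_Rinv_flip ρ ρ (fun x y : E => x * y) X Y
  simp only [commutator, Finset.sum_sub_distrib, h]
  abel

end CommutatorSkew

section DerLemmas
variable {k H A : Type*} [CommRing k] [Ring H] [HopfAlgebra k H] [Triangular k H] [Ring A]
  [Algebra k A] [Module H A] [IsScalarTower k H A] [ModuleAlgebra k H A]

section
variable (k H A)

/-- The bracket of braided derivations as a bilinear map. -/
noncomputable def bracketL : Der k H A →ₗ[k] Der k H A →ₗ[k] Der k H A :=
  LinearMap.mk₂ k Der.bracket
    (fun X Y Z => Subtype.ext (by simp [Der.bracket, ← commutatorL_apply]))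
    (fun c a X => Subtype.ext (by simp [Der.bracket, ← commutatorL_apply]))
    (fun a X Y => Subtype.ext (by simp [Der.bracket, ← commutatorL_apply]))
    (fun c a X => Subtype.ext (by simp [Der.bracket, ← commutatorL_apply]))

/-- Evaluation of braided derivations as a bilinear map. -/
noncomputable def evalL : Der k H A →ₗ[k] A →ₗ[k] A := (Der k H A).subtype

/-- The bracket `⟦a, Y⟧ = -(R₁⁻¹ ▷ Y)(R₂⁻¹ ▷ a)` of an algebra element and a derivation. -/
noncomputable def algDer : A →ₗ[k] Der k H A →ₗ[k] A :=
  -∑ r ∈ legs (Rinv k H), ((evalL k H A).compl₁₂ (derAct k H A r.1) (opr k H A r.2)).flip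

end

theorem bracketL_apply (X Y : Der k H A) : bracketL k H A X Y = Der.bracket X Y := rfl
@[simp] theorem evalL_apply (X : Der k H A) (a : A) : evalL k H A X a = X.1 a := rfl

theorem algDer_apply (a : A) (Y : Der k H A) :
    algDer k H A a Y = -∑ r ∈ legs (Rinv k H), (derAct k H A r.1 Y).1 (r.2 • a) := by
  simp [algDer, LinearMap.sum_apply]

theorem smul_eval (ξ : H) (X : Der k H A) (a : A) :
    ξ • X.1 a = ∑ p ∈ legs (comul (R := k) ξ), (derAct k H A p.1 X).1 (p.2 • a) :=
  smul_apply_eq ξ X.1 a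

theorem derAct_bracket (ξ : H) (X Y : Der k H A) : derAct k H A ξ (Der.bracket X Y) =
    ∑ p ∈ legs (comul (R := k) ξ), Der.bracket (derAct k H A p.1 X) (derAct k H A p.2 Y) :=
  Subtype.ext (by
    rw [coe_derAct, Der.bracket, act_commutator isMulAction_adj]
    simp [Der.bracket, coe_derAct])

/-- Evaluation is equivariant but the order of `a` and `Y` is reversed; `Δ(ξ) R⁻¹ = R⁻¹ Δ₂₁(ξ)`
restores it. -/
theorem smul_algDer (ξ : H) (a : A) (Y : Der k H A) : ξ • algDer k H A a Y =
    ∑ p ∈ legs (comul (R := k) ξ), algDer k H A (p.1 • a) (derAct k H A p.2 Y) := by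
  have h := legs_comul_Rinv (derAct k H A) (opr k H A) (fun Y a => evalL k H A Y a) ξ Y a
  simp only [algDer_apply, smul_neg, Finset.smul_sum, Finset.sum_neg_distrib, smul_eval]
  exact congrArg _ h

theorem der_mul (X : Der k H A) (a b : A) :
    X.1 (a * b) = X.1 a * b + ∑ r ∈ legs (Rinv k H), (r.1 • a) * (derAct k H A r.2 X).1 b :=
  X.2 a b

theorem bracket_skew (X Y : Der k H A) : Der.bracket X Y =
    -∑ r ∈ legs (Rinv k H), Der.bracket (derAct k H A r.1 Y) (derAct k H A r.2 X) :=
  Subtype.ext ((commutator_skew (adj k H A) X.1 Y.1).trans (by simp [Der.bracket, coe_derAct]))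

theorem eval_eq_algDer (X : Der k H A) (a : A) : X.1 a =
    -∑ r ∈ legs (Rinv k H), algDer k H A (r.1 • a) (derAct k H A r.2 X) := by
  have h := legs_Rinv_flip (derAct k H A) (opr k H A) (fun Y a => evalL k H A Y a) X a
  simp only [algDer_apply, Finset.sum_neg_distrib, neg_neg]
  exact h.symm

/-- The hexagon moves `Y` to the left of `a` and of `b` separately. In the second term of the
braided Leibniz rule for `Y`, the `R⁻¹` that carries `Y` across `a` cancels the one from the hexagon
by `R⁻¹ R⁻¹₂₁ = 1`. -/
theorem algDer_mul (a b : A) (Y : Der k H A) : algDer k H A (a * b) Y =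
    a * algDer k H A b Y +
      ∑ r ∈ legs (Rinv k H), algDer k H A a (derAct k H A r.1 Y) * (r.2 • b) := by
  have h1 := legs_hexR (derAct k H A) (opr k H A) (opr k H A)
    (fun Y a b => evalL k H A Y (a * b)) Y a b
  have h2 : ∑ r ∈ legs (Rinv k H), (derAct k H A r.1 Y).1 (r.2 • (a * b)) =
      ∑ r ∈ legs (Rinv k H), ∑ s ∈ legs (Rinv k H),
        (derAct k H A r.1 (derAct k H A s.1 Y)).1 ((r.2 • a) * (s.2 • b)) := by
    simp only [Algebra.lsmul_coe, evalL_apply] at h1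
    rw [← h1]
    simp [ModuleAlgebra.smul_mul (k := k)]
  have h3 : ∑ s ∈ legs (Rinv k H), ∑ r ∈ legs (Rinv k H), ∑ t ∈ legs (Rinv k H),
      (t.1 • r.2 • a) * (derAct k H A t.2 (derAct k H A r.1 (derAct k H A s.1 Y))).1 (s.2 • b) =
      ∑ s ∈ legs (Rinv k H), a * (derAct k H A s.1 Y).1 (s.2 • b) :=
    Finset.sum_congr rfl fun s _ => by
      have h := legs_Rinv_flip (opr k H A) (derAct k H A)
        (fun a Y => a * evalL k H A Y (s.2 • b)) a (derAct k H A s.1 Y)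
      simpa only [Algebra.lsmul_coe, evalL_apply] using h
  simp only [algDer_apply, h2, der_mul, Finset.sum_add_distrib]
  have h4 := Finset.sum_comm.trans h3
  rw [h4, Finset.sum_comm]
  simp only [neg_mul, mul_neg, Finset.mul_sum, Finset.sum_mul, Finset.sum_neg_distrib]
  abel

variable [BraidedCommutative k H A]

@[simp] theorem lactL_apply (a : A) (X : Der k H A) : lactL k H A a X = Der.lact a X := rfl
@[simp] theorem ractL_apply (X : Der k H A) (a : A) : ractL k H A X a = Der.ract X a := rfl

theorem derAct_lact (ξ : H) (a : A) (X : Der k H A) : derAct k H A ξ (Der.lact a X) =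
    ∑ p ∈ legs (comul (R := k) ξ), Der.lact (p.1 • a) (derAct k H A p.2 X) :=
  Subtype.ext (by
    rw [coe_derAct, Der.lact, isMulAction_adj]
    simp [Der.lact, coe_derAct, adj_mulLeft])

theorem derAct_ract (ξ : H) (X : Der k H A) (a : A) : derAct k H A ξ (Der.ract X a) =
    ∑ p ∈ legs (comul (R := k) ξ), Der.ract (derAct k H A p.1 X) (p.2 • a) :=
  Subtype.ext (by
    rw [coe_derAct, coe_ract, map_sub, isMulAction_adj, adj_mulLeft, smul_apply_eq]
    simp only [adj_mulLeft, AddSubmonoidClass.coe_finsetSum, coe_ract, Finset.sum_sub_distrib,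
      coe_derAct]
    congr 1
    ext; simp [Finset.sum_mul, LinearMap.sum_apply])

theorem lact_lact (a b : A) (X : Der k H A) :
    Der.lact a (Der.lact b X) = Der.lact (a * b) X :=
  Subtype.ext (by ext; simp [Der.lact])

theorem ract_ract (X : Der k H A) (a b : A) :
    Der.ract (Der.ract X a) b = Der.ract X (a * b) :=
  Subtype.ext (by ext; simp [coe_ract, mul_assoc, sub_mul])

theorem lact_ract (a : A) (X : Der k H A) (b : A) :
    Der.lact a (Der.ract X b) = Der.ract (Der.lact a X) b :=
  Subtype.ext (by ext; simp [coe_ract, Der.lact, mul_assoc, mul_sub])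

/-- In `X(ab) - X(a) b` both products are reversed by braided commutativity. By the Leibniz rule,
`X((R₁⁻¹ ▷ b)(R₂⁻¹ ▷ a))` then splits into the claimed sum and a term that the hexagon identifies
with `X(a) b`. -/
theorem ract_apply (X : Der k H A) (a b : A) : (Der.ract X a).1 b =
    ∑ r ∈ legs (Rinv k H), X.1 (r.1 • b) * (r.2 • a) := by
  have h1 : X.1 (a * b) = ∑ r ∈ legs (Rinv k H), X.1 ((r.1 • b) * (r.2 • a)) := by
    rw [BraidedCommutative.mul_comm (k := k) (H := H) b a, map_sum]
  have h2 : X.1 a * b = ∑ r ∈ legs (Rinv k H), ∑ s ∈ legs (Rinv k H),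
      (s.1 • r.1 • b) * (derAct k H A s.2 X).1 (r.2 • a) := by
    rw [BraidedCommutative.mul_comm (k := k) (H := H) b (X.1 a), Finset.sum_comm]
    have h := legs_hexR (opr k H A) (derAct k H A) (opr k H A)
      (fun b X a => b * evalL k H A X a) b X a
    simp only [Algebra.lsmul_coe, evalL_apply] at h
    rw [← h]
    simp only [smul_eval, Finset.mul_sum]
  rw [coe_ract]
  simp only [LinearMap.sub_apply, Module.End.mul_apply, LinearMap.mulLeft_apply]
  rw [h1, h2]
  simp [der_mul, Finset.sum_add_distrib]

theorem commutator_mulLeft_der (a : A) (Y : Der k H A) :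
    commutator (adj k H A) (LinearMap.mulLeft k a) Y.1 = LinearMap.mulLeft k (algDer k H A a Y) := by
  rw [commutator_skew]
  have : ∀ r : H × H, commutator (adj k H A) (adj k H A r.1 Y.1)
      (adj k H A r.2 (LinearMap.mulLeft k a)) =
      LinearMap.mulLeft k ((derAct k H A r.1 Y).1 (r.2 • a)) := fun r => by
    rw [adj_mulLeft]
    exact mem_Der_iff.1 (derAct k H A r.1 Y).2 (r.2 • a)
  simp only [this, algDer_apply]
  ext; simp [Finset.sum_mul, LinearMap.sum_apply]

/-- The braided Leibniz rule of the commutator in its first argument, for left multiplication by `a`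
composed with `X`; the commutator of a multiplication with `Y` is again a multiplication. -/
theorem bracket_lact (a : A) (X Y : Der k H A) : Der.bracket (Der.lact a X) Y =
    Der.lact a (Der.bracket X Y) + ∑ r ∈ legs (Rinv k H),
      Der.lact (algDer k H A a (derAct k H A r.1 Y)) (derAct k H A r.2 X) :=
  Subtype.ext (by
    simp only [Der.bracket, Der.lact]
    rw [commutator_mul_left isMulAction_adj]
    simp only [← coe_derAct, commutator_mulLeft_der]
    simp)

/-- By `coe_ract` the right action is composition with a multiplication minus multiplication by
`X(a)`. The first part is handled by the Leibniz rule of the commutator, the second by `key`, the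
Jacobi identity for `X`, `a`, `Y`. -/
theorem bracket_ract (X : Der k H A) (a : A) (Y : Der k H A) : Der.bracket (Der.ract X a) Y =
    Der.ract X (algDer k H A a Y) + ∑ r ∈ legs (Rinv k H),
      Der.ract (Der.bracket X (derAct k H A r.1 Y)) (r.2 • a) := by
  have key : algDer k H A (X.1 a) Y = X.1 (algDer k H A a Y) + ∑ r ∈ legs (Rinv k H),
      (Der.bracket X (derAct k H A r.1 Y)).1 (r.2 • a) := by
    have h := legs_hexR (derAct k H A) (derAct k H A) (opr k H A)
      (fun Y X a => evalL k H A Y (evalL k H A X a)) Y X a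
    simp only [evalL_apply, Algebra.lsmul_coe] at h
    rw [Finset.sum_comm] at h
    simp only [algDer_apply, smul_eval, map_sum, map_neg, h, Der.bracket_apply,
      Finset.sum_sub_distrib, ← derAct_apply]
    abel
  refine Subtype.ext ?_
  simp only [Der.bracket]
  have h := commutator_mul_left (ρ := adj k H A) isMulAction_adj X.1 (LinearMap.mulLeft k a) Y.1
  rw [coe_ract, commutator_sub_left, h, commutator_mulLeft_der, commutator_mulLeft_der, key]
  simp only [adj_mulLeft, Submodule.coe_add, AddSubmonoidClass.coe_finsetSum, coe_ract,
    Finset.sum_sub_distrib]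
  ext b
  simp only [LinearMap.sub_apply, LinearMap.add_apply, LinearMap.sum_apply, Module.End.mul_apply,
    LinearMap.mulLeft_apply, Der.bracket, coe_derAct, add_mul, Finset.sum_mul]
  abel

end DerLemmas

/-! ### Pairs of elements that commute up to the braiding. -/

section BraidedComm
variable {k H E : Type*} [CommRing k] [Ring H] [HopfAlgebra k H] [Ring E] [Algebra k E]
  {ρ : H →ₐ[k] Module.End k E}

theorem IsMulAction.comp_const {ρ : Super H →ₐ[k] Module.End k E} (hρ : IsMulAction ρ) :
    IsMulAction (ρ.comp (Super.const k)) := fun ξ X Y => by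
  rw [AlgHom.comp_apply, hρ, legs_comul_const (fun x y : E => x * y)]
  rfl

variable [Triangular k H]

/-- `x y = (R₁⁻¹ ▷ y) (R₂⁻¹ ▷ x)`. -/
def BraidedComm (ρ : H →ₐ[k] Module.End k E) (x y : E) : Prop :=
  x * y = ∑ r ∈ legs (Rinv k H), ρ r.1 y * ρ r.2 x

/-- `y` crosses `x'` and then `x`, and the hexagon for `(id ⊗ Δ)(R⁻¹)` combines the two crossings.
In the middle `y` has been acted upon, so the hypothesis on `x` must cover all `ξ ▷ y`. -/
theorem BraidedComm.mul_left (hρ : IsMulAction ρ) {x x' y : E}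
    (h : ∀ ξ, BraidedComm ρ x (ρ ξ y)) (h' : BraidedComm ρ x' y) : BraidedComm ρ (x * x') y := by
  have hρ' : ∀ ξ X Y, ρ ξ (X * Y) = _ := hρ
  have h1 := legs_hexR ρ ρ ρ (fun y x x' => y * (x * x')) y x x'
  simp only [← Finset.mul_sum, ← hρ'] at h1
  rw [BraidedComm, h1, mul_assoc, h', Finset.mul_sum, Finset.sum_comm]
  refine Finset.sum_congr rfl fun r _ => ?_
  rw [← mul_assoc, h, Finset.sum_mul]
  simp only [mul_assoc]

theorem BraidedComm.mul_right (hρ : IsMulAction ρ) {x y y' : E}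
    (h : BraidedComm ρ x y) (h' : ∀ ξ, BraidedComm ρ (ρ ξ x) y') : BraidedComm ρ x (y * y') := by
  have hρ' : ∀ ξ X Y, ρ ξ (X * Y) = _ := hρ
  have h1 := legs_hexL ρ ρ ρ (fun y y' x => y * y' * x) y y' x
  simp only [← Finset.sum_mul, ← hρ'] at h1
  rw [BraidedComm, h1, ← mul_assoc, h, Finset.sum_mul, Finset.sum_comm]
  refine Finset.sum_congr rfl fun r _ => ?_
  rw [mul_assoc, h', Finset.mul_sum]
  simp only [mul_assoc]

theorem BraidedComm.add_left {x x' y : E} (h : BraidedComm ρ x y) (h' : BraidedComm ρ x' y) :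
    BraidedComm ρ (x + x') y := by
  simp only [BraidedComm] at h h' ⊢
  simp only [add_mul, h, h', map_add, mul_add, Finset.sum_add_distrib]

theorem BraidedComm.add_right {x y y' : E} (h : BraidedComm ρ x y) (h' : BraidedComm ρ x y') :
    BraidedComm ρ x (y + y') := by
  simp only [BraidedComm] at h h' ⊢
  simp only [mul_add, h, h', map_add, add_mul, Finset.sum_add_distrib]

/-- In a triangular, not merely quasitriangular, Hopf algebra the braiding is its own inverse. -/
theorem BraidedComm.symm {x y : E} (h : ∀ ξ η, BraidedComm ρ (ρ ξ x) (ρ η y)) :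
    BraidedComm ρ y x := by
  have h1 := legs_Rinv_flip ρ ρ (fun y x : E => y * x) y x
  simp only [BraidedComm] at h ⊢
  rw [← h1]
  exact Finset.sum_congr rfl fun r _ => (h _ _).symm

end BraidedComm

/-! ### The diagonal action on the tensor algebra, with `A` even and the derivations odd. -/

section TensorAction
variable {k H A : Type*} [CommRing k] [Ring H] [HopfAlgebra k H] [Triangular k H] [Ring A]
  [Algebra k A] [Module H A] [IsScalarTower k H A] [ModuleAlgebra k H A]

section
variable (k H A)

/-- The even action on `A`. -/
noncomputable def sA : Super H →ₐ[k] Module.End k A := (opr k H A).comp (Super.ev k 0)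

/-- The odd action on the braided derivations. -/
noncomputable def sD : Super H →ₐ[k] Module.End k (Der k H A) := (derAct k H A).comp (Super.ev k 1)

end

theorem sA_apply (ξ : Super H) (a : A) : sA k H A ξ a = Super.ev k 0 ξ • a := rfl
variable [BraidedCommutative k H A]

section
variable (k H A)

/-- The map `a ↦ (ξ ↦ ξ ▷ a)`. -/
noncomputable def convA : A →ₐ[k] WithConv (Super H →ₗ[k] TensorAlg k H A) :=
  AlgHom.ofLinearMap
    ((WithConv.linearEquiv k (Super H →ₗ[k] TensorAlg k H A)).symm.toLinearMap ∘ₗ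
      LinearMap.llcomp k (Super H) A (TensorAlg k H A) (tA k H A).toLinearMap ∘ₗ
      (sA k H A).toLinearMap.flip)
    (by
      ext ξ
      have : tA k H A (Super.ev k 0 ξ • 1) = algebraMap k _ (counit (R := k) ξ) := by
        rw [ModuleAlgebra.smul_one (k := k), map_smul, map_one, Algebra.algebraMap_eq_smul_one]
        rfl
      simpa [sA_apply] using this)
    (fun a b => by
      ext ξ
      rw [conv_apply_legs]
      have h := legs_ev_comul (opr k H A) (opr k H A) (fun a b => tA k H A a * tA k H A b) 0 0 ξ a b
      simp only [Algebra.lsmul_coe, add_zero, ← map_mul, ← map_sum,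
        ← ModuleAlgebra.smul_mul (k := k)] at h
      simpa [sA_apply] using h.symm)

/-- The map `X ↦ (ξ ↦ ξ ▷ X)`. -/
noncomputable def convD : Der k H A →ₗ[k] WithConv (Super H →ₗ[k] TensorAlg k H A) :=
  (WithConv.linearEquiv k (Super H →ₗ[k] TensorAlg k H A)).symm.toLinearMap ∘ₗ
      LinearMap.llcomp k (Super H) (Der k H A) (TensorAlg k H A) (tD k H A) ∘ₗ
      (sD k H A).toLinearMap.flip

variable {k H A} in
theorem convA_apply (a : A) (ξ : Super H) : convA k H A a ξ = tA k H A (Super.ev k 0 ξ • a) := rfl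
variable {k H A} in
theorem convD_apply (X : Der k H A) (ξ : Super H) :
    convD k H A X ξ = tD k H A (derAct k H A (Super.ev k 1 ξ) X) := rfl

/-- The map `x ↦ (ξ ↦ ξ ▷ x)`. -/
noncomputable def convT : TensorAlg k H A →ₐ[k] WithConv (Super H →ₗ[k] TensorAlg k H A) :=
  tLift (convA k H A) (convD k H A)
    (fun a X => by
      ext ξ
      have h := legs_ev_comul (opr k H A) (derAct k H A)
        (fun a X => tA k H A a * tD k H A X) 0 1 ξ a X
      simp only [Algebra.lsmul_coe, zero_add, tA_mul_tD, ← map_sum, ← derAct_lact] at h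
      rw [conv_apply_legs, convD_apply, ← h]
      simp only [convA_apply, convD_apply, tA_mul_tD, map_sum])
    (fun X a => by
      ext ξ
      have h := legs_ev_comul (derAct k H A) (opr k H A)
        (fun X a => tD k H A X * tA k H A a) 1 0 ξ X a
      simp only [Algebra.lsmul_coe, add_zero, tD_mul_tA, ← map_sum, ← derAct_ract] at h
      rw [conv_apply_legs, convD_apply, ← h]
      simp only [convA_apply, convD_apply, tD_mul_tA, map_sum])

end

theorem convT_mul (x y : TensorAlg k H A) (ξ : Super H) : convT k H A (x * y) ξ =
    ∑ p ∈ legs (comul (R := k) ξ), convT k H A x p.1 * convT k H A y p.2 := by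
  rw [map_mul, conv_apply_legs]

theorem convT_tA (a : A) (ξ : Super H) :
    convT k H A (tA k H A a) ξ = tA k H A (Super.ev k 0 ξ • a) := by
  rw [convT, tLift_tA, convA_apply]
theorem convT_tD (X : Der k H A) (ξ : Super H) :
    convT k H A (tD k H A X) ξ = tD k H A (derAct k H A (Super.ev k 1 ξ) X) := by
  rw [convT, tLift_tD, convD_apply]

/-- A composition law for an action that is multiplicative on the generators. -/
theorem convT_comp (ξ η : Super H) (x : TensorAlg k H A) :
    convT k H A x (ξ * η) = convT k H A (convT k H A x η) ξ := by
  have key : ∀ y x : TensorAlg k H A,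
      (∀ ξ η, convT k H A y (ξ * η) = convT k H A (convT k H A y η) ξ) →
      (∀ ξ η, convT k H A x (ξ * η) = convT k H A (convT k H A x η) ξ) →
      ∀ ξ η, convT k H A (y * x) (ξ * η) = convT k H A (convT k H A (y * x) η) ξ := by
    intro y x hy hx ξ η
    let F : Super H ⊗[k] Super H →ₗ[k] TensorAlg k H A := LinearMap.mul' k _ ∘ₗ
      TensorProduct.map (convT k H A y).ofConv (convT k H A x).ofConv
    have hF : ∀ a b, F (a ⊗ₜ b) = convT k H A y a * convT k H A x b := fun a b => by
      simp [F]
    have h1 : ∀ ζ, convT k H A (y * x) ζ = F (comul ζ) := fun ζ => by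
      rw [convT_mul, ← map_sum_legs F]; simp only [hF]
    let G : TensorAlg k H A →ₗ[k] TensorAlg k H A :=
      { toFun := fun z => convT k H A z ξ
        map_add' := fun a b => by rw [map_add]; rfl
        map_smul' := fun a b => by rw [map_smul]; rfl }
    have hG : ∀ z, convT k H A z ξ = G z := fun _ => rfl
    rw [h1, Bialgebra.comul_mul, convT_mul, hG, map_sum]
    simp only [← hG, convT_mul]
    conv_lhs => rw [← sum_legs (comul (R := k) ξ), ← sum_legs (comul (R := k) η)]
    simp only [Finset.mul_sum, Finset.sum_mul, Algebra.TensorProduct.tmul_mul_tmul, map_sum, hF,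
      hy, hx]
  revert ξ η
  induction x using tInduction with
  | hadd x y hx hy =>
    intro ξ η
    have : ∀ (a b : TensorAlg k H A) ζ, convT k H A (a + b) ζ =
        convT k H A a ζ + convT k H A b ζ := fun a b ζ => by rw [map_add]; rfl
    rw [this, this, this, hx, hy]
  | hA a => intro ξ η; simp only [convT_tA, map_mul, mul_smul]
  | hmulA a x hx =>
    exact key _ _ (fun ξ η => by simp only [convT_tA, map_mul, mul_smul]) hx
  | hmulD X x hx =>
    exact key _ _ (fun ξ η => by simp only [convT_tD, map_mul, Module.End.mul_apply]) hx

theorem convT_one_right (x : TensorAlg k H A) : convT k H A x 1 = x := by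
  have key : ∀ y x : TensorAlg k H A, convT k H A y 1 = y → convT k H A x 1 = x →
      convT k H A (y * x) 1 = y * x := by
    intro y x hy hx
    let F : Super H ⊗[k] Super H →ₗ[k] TensorAlg k H A := LinearMap.mul' k _ ∘ₗ
      TensorProduct.map (convT k H A y).ofConv (convT k H A x).ofConv
    have hF : ∀ a b, F (a ⊗ₜ b) = convT k H A y a * convT k H A x b := fun a b => by
      simp [F]
    rw [convT_mul]
    simp only [← hF]
    rw [map_sum_legs, Bialgebra.comul_one, Algebra.TensorProduct.one_def, hF, hy, hx]
  induction x using tInduction with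
  | hadd x y hx hy =>
    have : convT k H A (x + y) 1 = convT k H A x 1 + convT k H A y 1 := by rw [map_add]; rfl
    rw [this, hx, hy]
  | hA a => rw [convT_tA, map_one, one_smul]
  | hmulA a x hx => exact key _ _ (by rw [convT_tA, map_one, one_smul]) hx
  | hmulD X x hx => exact key _ _ (by rw [convT_tD, map_one, map_one, Module.End.one_apply]) hx

section
variable (k H A)

/-- The diagonal action on the tensor algebra; the derivations are odd. -/
noncomputable def tAct : Super H →ₐ[k] Module.End k (TensorAlg k H A) :=
  AlgHom.ofLinearMap
    (((WithConv.linearEquiv k (Super H →ₗ[k] TensorAlg k H A)).toLinearMap ∘ₗ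
      (convT k H A).toLinearMap).flip)
    (LinearMap.ext fun x => convT_one_right x)
    (fun ξ η => LinearMap.ext fun x => convT_comp ξ η x)

/-- The action of `H` on the tensor algebra. -/
noncomputable def tActH : H →ₐ[k] Module.End k (TensorAlg k H A) :=
  (tAct k H A).comp (Super.const k)

end

theorem tAct_tA (a : A) (ξ : Super H) :
    tAct k H A ξ (tA k H A a) = tA k H A (Super.ev k 0 ξ • a) := convT_tA a ξ
theorem tAct_tD (X : Der k H A) (ξ : Super H) :
    tAct k H A ξ (tD k H A X) = tD k H A (derAct k H A (Super.ev k 1 ξ) X) := convT_tD X ξ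
theorem isMulAction_tAct : IsMulAction (tAct k H A) := fun ξ x y => convT_mul x y ξ
theorem isMulAction_tActH : IsMulAction (tActH k H A) := isMulAction_tAct.comp_const
theorem tActH_tA (a : A) (ξ : H) : tActH k H A ξ (tA k H A a) = tA k H A (ξ • a) := convT_tA a _
theorem tActH_tD (X : Der k H A) (ξ : H) :
    tActH k H A ξ (tD k H A X) = tD k H A (derAct k H A ξ X) := convT_tD X _
theorem tAct_one (ξ : Super H) : tAct k H A ξ 1 = counit (R := k) ξ • (1 : TensorAlg k H A) := by
  rw [← map_one (tA k H A), tAct_tA, ModuleAlgebra.smul_one (k := k), map_smul]; rfl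
theorem tActH_one (ξ : H) : tActH k H A ξ 1 = counit (R := k) ξ • (1 : TensorAlg k H A) :=
  tAct_one (Super.const k ξ)

/-- A word of length `n` has parity `n`, so `Super H` acts on it through evaluation at `n`; this
translates between the signed and the unsigned action. -/
theorem tAct_word (l : List (Der k H A)) (ξ : Super H) :
    tAct k H A ξ (word l) = tActH k H A (Super.ev k l.length ξ) (word l) := by
  induction l generalizing ξ with
  | nil => simp only [word_nil, tAct_one, tActH_one, List.length_nil, Nat.cast_zero]; rfl
  | cons X l ih =>
    have h := legs_ev_comul (derAct k H A) (tActH k H A) (fun X x => tD k H A X * x) 1 l.length ξ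
      X (word l)
    rw [word_cons, isMulAction_tAct, isMulAction_tActH, List.length_cons, Nat.cast_succ, add_comm]
    simp only [ih, tAct_tD, tActH_tD]
    exact h

theorem tAct_words {n : ℕ} {x : TensorAlg k H A} (hx : x ∈ words k H A n) (ξ : Super H) :
    tAct k H A ξ x = tActH k H A (Super.ev k n ξ) x := by
  refine words_induction (p := fun x => tAct k H A ξ x = tActH k H A (Super.ev k n ξ) x)
    (by simp) (fun x y hx hy => by simp only [map_add, hx, hy])
    (fun c x hx => by simp only [map_smul, hx]) (fun l hl => ?_) x hx
  rw [tAct_word, hl]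

theorem tActH_word_mem (l : List (Der k H A)) (ξ : H) :
    tActH k H A ξ (word l) ∈ words k H A l.length := by
  induction l generalizing ξ with
  | nil =>
    rw [word_nil, tActH_one]
    exact Submodule.smul_mem _ _ (word_mem [])
  | cons X l ih =>
    rw [word_cons, isMulAction_tActH]
    refine Submodule.sum_mem _ fun p _ => ?_
    rw [tActH_tD, List.length_cons, add_comm]
    exact words_mul (tD_mem _) (ih _)

theorem tActH_mem {n : ℕ} {x : TensorAlg k H A} (hx : x ∈ words k H A n) (ξ : H) :
    tActH k H A ξ x ∈ words k H A n := by
  refine words_induction (p := fun x => tActH k H A ξ x ∈ words k H A n)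
    (by simp) (fun x y hx hy => by rw [map_add]; exact add_mem hx hy)
    (fun c x hx => by rw [map_smul]; exact Submodule.smul_mem _ c hx) (fun l hl => ?_) x hx
  rw [← hl]; exact tActH_word_mem l ξ

/-- Identifies the action built here on tensors over `A` with the prescribed diagonal action on
tensors over `k`. -/
theorem toTensorAlg_diagonal (ξ : H) (t : TensorAlgebra k (Der k H A)) :
    toTensorAlg k H A (diagonal ξ t) = tActH k H A ξ (toTensorAlg k H A t) := by
  have hadd : ∀ (a b : TensorAlgebra k (Der k H A)) ξ, diagonal ξ (a + b) =
      diagonal ξ a + diagonal ξ b := fun a b ξ => by rw [diagonal, map_add]; rfl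
  induction t using TensorAlgebra.induction generalizing ξ with
  | algebraMap c =>
    have : diagonal ξ (algebraMap k (TensorAlgebra k (Der k H A)) c) =
        algebraMap k _ (c * counit (R := k) ξ) := by
      rw [diagonal, AlgHom.commutes, Algebra.algebraMap_eq_smul_one, map_mul,
        ← Algebra.smul_def]; rfl
    rw [this, AlgHom.commutes, AlgHom.commutes, Algebra.algebraMap_eq_smul_one,
      Algebra.algebraMap_eq_smul_one, map_smul, tActH_one, smul_smul]
  | ι X =>
    rw [toTensorAlg_ι, tActH_tD, ← toTensorAlg_ι]
    simp [diagonal, diagonalHom, derAct_apply]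
  | mul x y hx hy =>
    rw [map_mul, isMulAction_tActH, diagonal, map_mul, conv_apply_legs, map_sum]
    refine Finset.sum_congr rfl fun p _ => ?_
    rw [map_mul, ← hx, ← hy]; rfl
  | add x y hx hy => rw [hadd, map_add, map_add, map_add, hx, hy]

/-- For a derivation this is the definition of the right action, and for an element of `A` it is
braided commutativity. Products follow from the hexagon; no sign appears since `a` is even. -/
theorem braidedComm_tA (x : TensorAlg k H A) (a : A) :
    BraidedComm (tAct k H A) x (tA k H A a) := by
  have hA : ∀ a b : A, BraidedComm (tAct k H A) (tA k H A b) (tA k H A a) := fun a b => by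
    have h := legs_ev_Rinv (opr k H A) (opr k H A) (fun a b => tA k H A a * tA k H A b) 0 0 a b
    simp only [BraidedComm, tAct_tA, ← map_mul]
    rw [BraidedCommutative.mul_comm (k := k) (H := H) a b]
    simpa using h.symm
  revert a
  induction x using tInduction with
  | hadd x y hx hy => exact fun a => (hx a).add_left (hy a)
  | hA b => exact fun a => hA a b
  | hmulA b x hx =>
    exact fun a => .mul_left isMulAction_tAct (fun ξ => by rw [tAct_tA]; exact hA _ _) (hx a)
  | hmulD X x hx =>
    refine fun a => .mul_left isMulAction_tAct (fun ξ => ?_) (hx a)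
    rw [tAct_tA]
    have h := legs_ev_Rinv (opr k H A) (derAct k H A) (fun a X => tA k H A a * tD k H A X) 0 1
      (Super.ev k 0 ξ • a) X
    simp only [Algebra.lsmul_coe, ksign_zero_left, one_smul] at h
    simp only [BraidedComm, tAct_tA, tAct_tD]
    rw [h, tD_mul_tA, Der.ract, map_sum]
    simp only [tA_mul_tD]; rfl

end TensorAction

/-! ### Derivations with values in maps -/

section Twist
variable {k H E W : Type*} [CommRing k] [Ring H] [HopfAlgebra k H] [Ring E] [Algebra k E]
  [AddCommGroup W] [Module k W]

/-- The left multiplication on maps with values in an algebra. -/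
noncomputable def postMul (k W : Type*) {E : Type*} [CommRing k] [Ring E] [Algebra k E]
    [AddCommGroup W] [Module k W] : E →ₐ[k] Module.End k (W →ₗ[k] E) :=
  AlgHom.ofLinearMap
    (LinearMap.mk₂ k (fun x f => LinearMap.mulLeft k x ∘ₗ f)
      (fun x y f => by ext; simp [add_mul]) (fun c x f => by ext; simp)
      (fun x f g => by ext; simp [mul_add]) (fun c x f => by ext; simp))
    (by ext; simp) (fun x y => by ext; simp)

@[simp] theorem postMul_apply (x : E) (f : W →ₗ[k] E) (w : W) : postMul k W x f w = x * f w := rfl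

variable [Triangular k H]

/-- The right multiplication `(f · y)(w) = f (R₁⁻¹ ▷ w) (R₂⁻¹ ▷ y)`. -/
noncomputable def twist (ρW : H →ₐ[k] Module.End k W) (ρ : H →ₐ[k] Module.End k E) :
    (W →ₗ[k] E) →ₗ[k] E →ₗ[k] (W →ₗ[k] E) :=
  LinearMap.mk₂ k
    (fun f y => ∑ r ∈ legs (Rinv k H), LinearMap.mulRight k (ρ r.2 y) ∘ₗ f ∘ₗ ρW r.1)
    (fun f g y => by ext; simp [add_mul, Finset.sum_add_distrib, LinearMap.sum_apply])
    (fun c f y => by ext; simp [Finset.smul_sum, LinearMap.sum_apply])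
    (fun f y z => by ext; simp [mul_add, Finset.sum_add_distrib, LinearMap.sum_apply])
    (fun c f y => by ext; simp [Finset.smul_sum, LinearMap.sum_apply])

variable {ρW : H →ₐ[k] Module.End k W} {ρ : H →ₐ[k] Module.End k E}

theorem twist_apply (f : W →ₗ[k] E) (y : E) (w : W) : twist ρW ρ f y w =
    ∑ r ∈ legs (Rinv k H), f (ρW r.1 w) * ρ r.2 y := by
  simp [twist, LinearMap.sum_apply]

/-- Associativity of the right multiplication is the hexagon. With `twist_postMul`, the maps `W → E`
form an `E`-bimodule in which derivations may take values. -/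
theorem twist_twist (hρ : IsMulAction ρ) (f : W →ₗ[k] E) (x y : E) :
    twist ρW ρ (twist ρW ρ f x) y = twist ρW ρ f (x * y) := by
  ext w
  have hρ' : ∀ ξ X Y, ρ ξ (X * Y) = _ := hρ
  have h := legs_hexR ρW ρ ρ (fun w x y => f w * (x * y)) w x y
  simp only [← Finset.mul_sum, ← hρ'] at h
  rw [twist_apply, twist_apply, h, Finset.sum_comm]
  simp only [twist_apply, Finset.sum_mul, mul_assoc]

theorem twist_postMul (z : E) (f : W →ₗ[k] E) (x : E) :
    twist ρW ρ (postMul k W z f) x = postMul k W z (twist ρW ρ f x) := by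
  ext w
  simp only [twist_apply, postMul_apply, Finset.mul_sum, mul_assoc]

theorem twist_one (hρ1 : ∀ ξ, ρ ξ 1 = counit (R := k) ξ • (1 : E)) (f : W →ₗ[k] E) :
    twist ρW ρ f 1 = f := by
  ext w
  rw [twist_apply, ← legs_Rinv_counit_right ρW (fun w => f w) w]
  simp [hρ1]

/-- Equivariance of a derivation passes from two factors to their product. Coassociativity
redistributes the legs in both Leibniz terms, and in the twisted one `Δ(ξ) R⁻¹ = R⁻¹ Δ₂₁(ξ)` moves
`ξ` past the braiding. -/
theorem equivariant_mul {E' : Type*} [Ring E'] [Algebra k E'] {ρ' : H →ₐ[k] Module.End k E'}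
    (hρ' : IsMulAction ρ') (hρ : IsMulAction ρ) (q : E' →ₐ[k] E)
    (hq : ∀ ξ x, q (ρ' ξ x) = ρ ξ (q x)) (d : E' →ₗ[k] W →ₗ[k] E)
    (hd : ∀ x y, d (x * y) = postMul k W (q x) (d y) + twist ρW ρ (d x) (q y)) (y x : E')
    (hy : ∀ ξ w, ρ ξ (d y w) = ∑ p ∈ legs (comul (R := k) ξ), d (ρ' p.1 y) (ρW p.2 w))
    (hx : ∀ ξ w, ρ ξ (d x w) = ∑ p ∈ legs (comul (R := k) ξ), d (ρ' p.1 x) (ρW p.2 w))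
    (ξ : H) (w : W) : ρ ξ (d (y * x) w) =
      ∑ p ∈ legs (comul (R := k) ξ), d (ρ' p.1 (y * x)) (ρW p.2 w) := by
  have hρ1 : ∀ ξ X Y, ρ ξ (X * Y) = _ := hρ
  have hρ2 : ∀ ξ X Y, ρ' ξ (X * Y) = _ := hρ'
  have h1 := legs_coassoc ρ' ρ' ρW (fun y x w => q y * d x w) ξ y x w
  have h3 := legs_coassoc ρ' ρ' ρW
    (fun y x w => ∑ r ∈ legs (Rinv k H), d y (ρW r.1 w) * ρ r.2 (q x)) ξ y x w
  have h4 : ∀ p : H × H, ∑ r ∈ legs (Rinv k H), ∑ q' ∈ legs (comul (R := k) p.2),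
      d (ρ' p.1 y) (ρW q'.1 (ρW r.1 w)) * ρ q'.2 (ρ r.2 (q x)) = _ := fun p =>
    legs_comul_Rinv ρW ρ (fun w x => d (ρ' p.1 y) w * x) p.2 w (q x)
  have h5 : ∀ p : H × H, d (ρ' p.1 (y * x)) (ρW p.2 w) =
      ∑ q' ∈ legs (comul (R := k) p.1), (q (ρ' q'.1 y) * d (ρ' q'.2 x) (ρW p.2 w) +
      ∑ r ∈ legs (Rinv k H), d (ρ' q'.1 y) (ρW r.1 (ρW p.2 w)) *
        ρ r.2 (q (ρ' q'.2 x))) := fun p => by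
    rw [hρ2, map_sum, LinearMap.sum_apply]
    refine Finset.sum_congr rfl fun q' _ => ?_
    rw [hd, LinearMap.add_apply, twist_apply, postMul_apply]
  simp only [h5, Finset.sum_add_distrib]
  rw [h1, h3, hd]
  simp only [LinearMap.add_apply, map_add, postMul_apply, hρ1, twist_apply, map_sum]
  congr 1
  · simp only [hx, Finset.mul_sum, hq]
  · simp only [hy, Finset.sum_mul]
    have h2 := fun r : H × H =>
      legs_coassoc ρ' ρW ρ (fun y w x => d y w * x) ξ y (ρW r.1 w) (ρ r.2 (q x))
    simp only [h2]
    rw [Finset.sum_comm]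
    refine Finset.sum_congr rfl fun p _ => ?_
    rw [h4]
    simp only [hq]

end Twist

/-! ### Recursively defined linear maps and derivations on the tensor algebra. -/

section Fold
variable {k H A : Type*} [CommRing k] [Ring H] [HopfAlgebra k H] [Triangular k H] [Ring A]
  [Algebra k A] [Module H A] [IsScalarTower k H A] [ModuleAlgebra k H A]
  [BraidedCommutative k H A] {N : Type*} [AddCommGroup N] [Module k N]
  (φ : TensorAlg k H A →ₐ[k] Module.End k N)
  (pA : A →ₗ[k] TensorAlg k H A →ₗ[k] N) (pD : Der k H A →ₗ[k] TensorAlg k H A →ₗ[k] N)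
  (hm : ∀ a b x, pA (a * b) x = φ (tA k H A a) (pA b x) + pA a (tA k H A b * x))
  (hl : ∀ a X x, pD (Der.lact a X) x = φ (tA k H A a) (pD X x) + pA a (tD k H A X * x))
  (hr : ∀ X a x, pD (Der.ract X a) x = φ (tD k H A X) (pA a x) + pD X (tA k H A a * x))

/-- The representation on pairs underlying `tFold`. -/
noncomputable def tFoldHom : TensorAlg k H A →ₐ[k] Module.End k (TensorAlg k H A × N) :=
  -- A generator `y` acts by the block triangular operator `(v, n) ↦ (y v, y n + p(y)(v))`. The
  -- hypotheses `hm`, `hl`, `hr` say that these operators satisfy the bimodule relations, and the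
  -- recursive map is the second component of the orbit of `(1, 0)`.
  tLift
    (AlgHom.ofLinearMap (LinearMap.mk₂ k
      (fun a v => (tA k H A a * v.1, φ (tA k H A a) v.2 + pA a v.1))
      (fun a b v => by ext <;> simp [add_mul]; abel)
      (fun c a v => by ext <;> simp)
      (fun a v w => by ext <;> simp [mul_add]; abel)
      (fun c a v => by ext <;> simp))
      (by
        have h1 : ∀ x, pA 1 x = 0 := fun x => by simpa using hm 1 1 x
        refine LinearMap.ext fun v => ?_
        ext <;> simp [h1])
      (fun a b => LinearMap.ext fun v => by ext <;> simp [hm, mul_assoc]; abel))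
    (LinearMap.mk₂ k
      (fun X v => (tD k H A X * v.1, φ (tD k H A X) v.2 + pD X v.1))
      (fun a b v => by ext <;> simp [add_mul]; abel)
      (fun c a v => by ext <;> simp)
      (fun a v w => by ext <;> simp [mul_add]; abel)
      (fun c a v => by ext <;> simp))
    (fun a X => LinearMap.ext fun v => by
      ext <;> simp [hl, ← mul_assoc, ← tA_mul_tD]; abel)
    (fun X a => LinearMap.ext fun v => by
      ext <;> simp [hr, ← mul_assoc, ← tD_mul_tA]; abel)

/-- The linear map `F` on the tensor algebra with `F (y x) = y F(x) + p(y)(x)` for generators `y`. -/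
noncomputable def tFold : TensorAlg k H A →ₗ[k] N :=
  LinearMap.snd k _ _ ∘ₗ (tFoldHom φ pA pD hm hl hr).toLinearMap.flip (1, 0)

theorem tFoldHom_fst (x : TensorAlg k H A) (v : TensorAlg k H A × N) :
    (tFoldHom φ pA pD hm hl hr x v).1 = x * v.1 := by
  induction x using tInduction generalizing v with
  | hadd x y hx hy => simp [add_mul, hx, hy]
  | hA a => simp [tFoldHom]
  | hmulA a x hx => rw [map_mul, Module.End.mul_apply, mul_assoc, ← hx]; simp [tFoldHom]
  | hmulD X x hx => rw [map_mul, Module.End.mul_apply, mul_assoc, ← hx]; simp [tFoldHom]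

theorem tFold_one : tFold φ pA pD hm hl hr 1 = 0 := by simp [tFold]

theorem tFoldHom_tA (a : A) (v : TensorAlg k H A × N) : tFoldHom φ pA pD hm hl hr (tA k H A a) v =
    (tA k H A a * v.1, φ (tA k H A a) v.2 + pA a v.1) := by
  simp [tFoldHom]

theorem tFoldHom_tD (X : Der k H A) (v : TensorAlg k H A × N) :
    tFoldHom φ pA pD hm hl hr (tD k H A X) v =
      (tD k H A X * v.1, φ (tD k H A X) v.2 + pD X v.1) := by
  simp [tFoldHom]

theorem tFold_apply (x : TensorAlg k H A) : tFold φ pA pD hm hl hr x =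
    (tFoldHom φ pA pD hm hl hr x (1, 0)).2 := rfl

theorem tFold_tA_mul (a : A) (x : TensorAlg k H A) : tFold φ pA pD hm hl hr (tA k H A a * x) =
    φ (tA k H A a) (tFold φ pA pD hm hl hr x) + pA a x := by
  rw [tFold_apply, tFold_apply, map_mul, Module.End.mul_apply, tFoldHom_tA, tFoldHom_fst, mul_one]

theorem tFold_tD_mul (X : Der k H A) (x : TensorAlg k H A) :
    tFold φ pA pD hm hl hr (tD k H A X * x) =
    φ (tD k H A X) (tFold φ pA pD hm hl hr x) + pD X x := by
  rw [tFold_apply, tFold_apply, map_mul, Module.End.mul_apply, tFoldHom_tD, tFoldHom_fst, mul_one]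

theorem tFold_tA (a : A) : tFold φ pA pD hm hl hr (tA k H A a) = pA a 1 := by
  have := tFold_tA_mul φ pA pD hm hl hr a 1
  rwa [mul_one, tFold_one, map_zero, zero_add] at this

theorem tFold_tD (X : Der k H A) : tFold φ pA pD hm hl hr (tD k H A X) = pD X 1 := by
  have := tFold_tD_mul φ pA pD hm hl hr X 1
  rwa [mul_one, tFold_one, map_zero, zero_add] at this

end Fold

section Deriv
variable {k H A : Type*} [CommRing k] [Ring H] [HopfAlgebra k H] [Triangular k H] [Ring A]
  [Algebra k A] [Module H A] [IsScalarTower k H A] [ModuleAlgebra k H A]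
  [BraidedCommutative k H A] {W M : Type*} [AddCommGroup W] [Module k W] [Ring M] [Algebra k M]
  {ρW : Super H →ₐ[k] Module.End k W} {ρ : Super H →ₐ[k] Module.End k M} (hρ : IsMulAction ρ)
  (q : TensorAlg k H A →ₐ[k] M)
  (GA : A →ₗ[k] W →ₗ[k] M) (GD : Der k H A →ₗ[k] W →ₗ[k] M)
  (hm : ∀ a b, GA (a * b) = postMul k W (q (tA k H A a)) (GA b) +
    twist ρW ρ (GA a) (q (tA k H A b)))
  (hl : ∀ a X, GD (Der.lact a X) = postMul k W (q (tA k H A a)) (GD X) +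
    twist ρW ρ (GA a) (q (tD k H A X)))
  (hr : ∀ X a, GD (Der.ract X a) = postMul k W (q (tD k H A X)) (GA a) +
    twist ρW ρ (GD X) (q (tA k H A a)))

/-- The derivation of the tensor algebra into the bimodule of maps `W → M` with given values on
the generators. -/
noncomputable def tDeriv : TensorAlg k H A →ₗ[k] W →ₗ[k] M :=
  tFold ((postMul k W).comp q)
    (((twist ρW ρ).compl₂ q.toLinearMap) ∘ₗ GA) (((twist ρW ρ).compl₂ q.toLinearMap) ∘ₗ GD)
    (fun a b x => by simp [hm, twist_twist hρ, twist_postMul])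
    (fun a X x => by simp [hl, twist_twist hρ, twist_postMul])
    (fun X a x => by simp [hr, twist_twist hρ, twist_postMul])

theorem tDeriv_tA (hρ1 : ∀ ξ, ρ ξ 1 = counit (R := k) ξ • (1 : M)) (a : A) :
    tDeriv hρ q GA GD hm hl hr (tA k H A a) = GA a := by
  rw [tDeriv, tFold_tA]
  simp [twist_one hρ1]

theorem tDeriv_tD (hρ1 : ∀ ξ, ρ ξ 1 = counit (R := k) ξ • (1 : M)) (X : Der k H A) :
    tDeriv hρ q GA GD hm hl hr (tD k H A X) = GD X := by
  rw [tDeriv, tFold_tD]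
  simp [twist_one hρ1]

/-- The recursion is the Leibniz rule for products whose left factor is a generator; associativity
of the twisted bimodule extends it to all left factors. -/
theorem tDeriv_mul (hρ1 : ∀ ξ, ρ ξ 1 = counit (R := k) ξ • (1 : M)) (x y : TensorAlg k H A) :
    tDeriv hρ q GA GD hm hl hr (x * y) =
      postMul k W (q x) (tDeriv hρ q GA GD hm hl hr y) +
        twist ρW ρ (tDeriv hρ q GA GD hm hl hr x) (q y) := by
  induction x using tInduction with
  | hadd x x' hx hx' => simp only [add_mul, map_add, hx, hx', LinearMap.add_apply]; abel
  | hA a =>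
    rw [tDeriv_tA hρ q GA GD hm hl hr hρ1]
    simp only [tDeriv, tFold_tA_mul]
    simp
  | hmulA a x hx =>
    rw [mul_assoc]
    simp only [tDeriv, tFold_tA_mul] at hx ⊢
    rw [hx]
    simp [twist_twist hρ, twist_postMul, add_assoc]
  | hmulD X x hx =>
    rw [mul_assoc]
    simp only [tDeriv, tFold_tD_mul] at hx ⊢
    rw [hx]
    simp [twist_twist hρ, twist_postMul, add_assoc]

end Deriv

/-! ### Braided exchange of adjacent factors as a well-defined map on tensors over `A`. -/

section Exchange
variable {k H A : Type*} [CommRing k] [Ring H] [HopfAlgebra k H] [Triangular k H] [Ring A]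
  [Algebra k A] [Module H A] [IsScalarTower k H A] [ModuleAlgebra k H A]
  [BraidedCommutative k H A]

/-- The same statement as for `Super H`: since `a` is even, signed and unsigned braiding agree. -/
theorem braidedComm_tActH_tA (x : TensorAlg k H A) (a : A) :
    BraidedComm (tActH k H A) x (tA k H A a) := by
  revert a
  induction x using tInduction_word with
  | hadd x y hx hy => exact fun a => (hx a).add_left (hy a)
  | hA b =>
    intro a
    simp only [BraidedComm, tActH_tA, ← map_mul]
    rw [BraidedCommutative.mul_comm (k := k) (H := H) a b, map_sum]
  | hw n x hx =>
    intro a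
    have h := braidedComm_tA x a
    have h2 := legs_ev_Rinv (opr k H A) (tActH k H A) (fun a x => tA k H A a * x) 0
      ((n + 1 : ℕ) : ZMod 2) a x
    simp only [Algebra.lsmul_coe, ksign_zero_left, one_smul] at h2
    simp only [BraidedComm, tAct_tA, tActH_tA, tAct_words hx] at h ⊢
    rw [h, h2]

theorem tA_mul_braided (x : TensorAlg k H A) (a : A) :
    BraidedComm (tActH k H A) (tA k H A a) x :=
  BraidedComm.symm fun ξ η => by rw [tActH_tA]; exact braidedComm_tActH_tA _ _

section
variable (k H A)

/-- The braided exchange `σ(X, Y) = (R₁⁻¹ ▷ Y) ⊗_A (R₂⁻¹ ▷ X)`. -/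
noncomputable def sig : Der k H A →ₗ[k] Der k H A →ₗ[k] TensorAlg k H A :=
  ∑ r ∈ legs (Rinv k H), ((LinearMap.mul k (TensorAlg k H A)).compl₁₂
    (tD k H A ∘ₗ derAct k H A r.1) (tD k H A ∘ₗ derAct k H A r.2)).flip

/-- The projection of the tensor algebra to `A`. -/
noncomputable def projA : TensorAlg k H A →ₐ[k] A :=
  tLift (AlgHom.id k A) 0 (by simp) (by simp)

end

@[simp] theorem projA_tA (a : A) : projA k H A (tA k H A a) = a := by simp [projA]
@[simp] theorem projA_tD (X : Der k H A) : projA k H A (tD k H A X) = 0 := by simp [projA]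

theorem sig_apply (X Y : Der k H A) : sig k H A X Y =
    ∑ r ∈ legs (Rinv k H), tD k H A (derAct k H A r.1 Y) * tD k H A (derAct k H A r.2 X) := by
  simp [sig, LinearMap.sum_apply]

attribute [irreducible] sig

/-- By the hexagon `Y` crosses `a` and `X` separately, and the crossing with `a` is undone by
braided commutativity with `A`. -/
theorem sig_lact (a : A) (X Y : Der k H A) :
    sig k H A (Der.lact a X) Y = tA k H A a * sig k H A X Y := by
  have h := legs_hexR (derAct k H A) (opr k H A) (derAct k H A)
    (fun Y a X => tD k H A Y * (tA k H A a * tD k H A X)) Y a X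
  simp only [Algebra.lsmul_coe, tA_mul_tD, ← Finset.mul_sum, ← map_sum, ← derAct_lact] at h
  rw [sig_apply, sig_apply, h, Finset.sum_comm, Finset.mul_sum]
  refine Finset.sum_congr rfl fun s _ => ?_
  have h2 := tA_mul_braided (tD k H A (derAct k H A s.1 Y)) a
  rw [BraidedComm] at h2
  rw [← mul_assoc, h2, Finset.sum_mul]
  simp only [tActH_tD, tActH_tA, mul_assoc, tA_mul_tD]

theorem sig_ract (X Y : Der k H A) (a : A) :
    sig k H A X (Der.ract Y a) = sig k H A X Y * tA k H A a := by
  have h := legs_hexL (derAct k H A) (opr k H A) (derAct k H A)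
    (fun Y a X => tD k H A Y * tA k H A a * tD k H A X) Y a X
  simp only [Algebra.lsmul_coe, tD_mul_tA, ← Finset.sum_mul, ← map_sum, ← derAct_ract] at h
  rw [sig_apply, sig_apply, h, Finset.sum_comm, Finset.sum_mul]
  refine Finset.sum_congr rfl fun s _ => ?_
  have h2 := braidedComm_tActH_tA (tD k H A (derAct k H A s.2 X)) a
  rw [BraidedComm] at h2
  rw [mul_assoc, h2, Finset.mul_sum]
  simp only [tActH_tD, tActH_tA, ← mul_assoc, tD_mul_tA]

/-- The exchange is balanced over `A`; with the linearity on both sides this makes it well defined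
on `Der ⊗_A Der`. -/
theorem sig_ract_left (X Y : Der k H A) (a : A) :
    sig k H A (Der.ract X a) Y = sig k H A X (Der.lact a Y) := by
  have h := legs_hexL (opr k H A) (derAct k H A) (derAct k H A)
    (fun a Y X => tA k H A a * tD k H A Y * tD k H A X) a Y X
  simp only [Algebra.lsmul_coe, tA_mul_tD, ← Finset.sum_mul, ← map_sum, ← derAct_lact] at h
  rw [sig_apply X, h, Der.ract, map_sum, LinearMap.sum_apply, Finset.sum_comm]
  refine Finset.sum_congr rfl fun s _ => ?_
  rw [sig_lact, sig_apply, Finset.mul_sum]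
  simp only [← mul_assoc, tA_mul_tD, derAct_apply]

theorem tActH_sig (ξ : H) (X Y : Der k H A) : tActH k H A ξ (sig k H A X Y) =
    ∑ p ∈ legs (comul (R := k) ξ), sig k H A (derAct k H A p.1 X) (derAct k H A p.2 Y) := by
  have h := legs_comul_Rinv (derAct k H A) (derAct k H A)
    (fun Y X => tD k H A Y * tD k H A X) ξ Y X
  have hm : ∀ ξ (X Y : TensorAlg k H A), tActH k H A ξ (X * Y) = _ := isMulAction_tActH
  simp only [sig_apply, map_sum, hm, tActH_tD]
  exact h

theorem sig_sig (X Y : Der k H A) :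
    ∑ r ∈ legs (Rinv k H), sig k H A (derAct k H A r.1 Y) (derAct k H A r.2 X) =
      tD k H A X * tD k H A Y := by
  have h := legs_Rinv_flip (derAct k H A) (derAct k H A) (fun X Y => tD k H A X * tD k H A Y) X Y
  simp only [sig_apply]
  exact h

section Shift
variable {N : Type*} [AddCommGroup N] [Module k N] (φ : TensorAlg k H A →ₐ[k] Module.End k N)
  (G : TensorAlg k H A →ₗ[k] N) (hG : ∀ a x, G (tA k H A a * x) = φ (tA k H A a) (G x))

/-- For a left `A`-linear map `G` on the tensor algebra the map with `X ⊗ z ↦ X · G(z)`. -/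
noncomputable def tShift : TensorAlg k H A →ₗ[k] N :=
  -- After projection to `A` the derivations act as zero, so the recursion is left `A`-linear and
  -- its value on `X ⊗ z` is only the prescribed one. `contract`, `swapFst` and `swapZero` use the
  -- same device.
  tFold (φ.comp ((tA k H A).comp (projA k H A))) 0
    (LinearMap.mk₂ k (fun X x => φ (tD k H A X) (G x)) (by simp) (by simp) (by simp) (by simp))
    (by simp)
    (fun a X x => by simp [← tA_mul_tD])
    (fun X a x => by simp [← tD_mul_tA, hG])

theorem tShift_tA_mul (a : A) (x : TensorAlg k H A) :
    tShift φ G hG (tA k H A a * x) = φ (tA k H A a) (tShift φ G hG x) := by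
  rw [tShift, tFold_tA_mul]; simp

theorem tShift_tD_mul (X : Der k H A) (x : TensorAlg k H A) :
    tShift φ G hG (tD k H A X * x) = φ (tD k H A X) (G x) := by
  rw [tShift, tFold_tD_mul]; simp

theorem tShift_one : tShift φ G hG 1 = 0 := by
  rw [tShift, tFold_one]

end Shift

theorem der_one (X : Der k H A) : X.1 1 = 0 := by
  have h := der_mul X 1 1
  have h2 := legs_Rinv_counit_left (derAct k H A) (fun X => evalL k H A X 1) X
  simp only [evalL_apply] at h2
  simpa [ModuleAlgebra.smul_one (k := k), h2] using h

theorem ract_one (X : Der k H A) : Der.ract X (1 : A) = X :=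
  Subtype.ext (by rw [coe_ract, der_one]; ext b; simp)

section
variable (k H A)

/-- The precomposition with the right action on braided derivations. -/
noncomputable def preRact : A →ₐ[k] Module.End k (Der k H A →ₗ[k] TensorAlg k H A) :=
  AlgHom.ofLinearMap
    (LinearMap.mk₂ k (fun a f => f ∘ₗ (ractL k H A).flip a)
      (fun a b f => by ext; simp) (fun c a f => by ext; simp)
      (fun a f g => by ext; simp) (fun c a f => by ext; simp))
    (LinearMap.ext fun f => LinearMap.ext fun X => by simp [ract_one])
    (fun a b => LinearMap.ext fun f => LinearMap.ext fun X => by simp [ract_ract])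

end

@[simp] theorem preRact_apply (a : A) (f : Der k H A →ₗ[k] TensorAlg k H A) (X : Der k H A) :
    preRact k H A a f X = f (Der.ract X a) := rfl

/-- The part of the exchange of the first two factors that depends on the factors after the first:
`Y ⊗ v ↦ (X ↦ σ(X, Y) ⊗ v)`. -/
noncomputable def swapFst : TensorAlg k H A →ₗ[k] Der k H A →ₗ[k] TensorAlg k H A :=
  tFold ((preRact k H A).comp (projA k H A)) 0
    (LinearMap.mk₂ k (fun Y v => LinearMap.mulRight k v ∘ₗ (sig k H A).flip Y)
      (fun a b v => by ext; simp [add_mul]) (fun c a v => by ext; simp)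
      (fun a v w => by ext; simp [mul_add]) (fun c a v => by ext; simp))
    (by simp)
    (fun a Y v => by ext X; simp [sig_ract_left])
    (fun Y a v => by ext X; simp [sig_ract, mul_assoc])

theorem swapFst_one : swapFst (k := k) (H := H) (A := A) 1 = 0 := by rw [swapFst, tFold_one]

theorem swapFst_tA_mul (a : A) (x : TensorAlg k H A) (X : Der k H A) :
    swapFst (tA k H A a * x) X = swapFst x (Der.ract X a) := by
  rw [swapFst, tFold_tA_mul]; simp

theorem swapFst_tD_mul (Y : Der k H A) (x : TensorAlg k H A) (X : Der k H A) :
    swapFst (tD k H A Y * x) X = sig k H A X Y * x := by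
  rw [swapFst, tFold_tD_mul]; simp

/-- Linearity in the first factor, which is what allows that factor to be attached over `A` in
`swapZero`. -/
theorem swapFst_lact (x : TensorAlg k H A) (a : A) (X : Der k H A) :
    swapFst x (Der.lact a X) = tA k H A a * swapFst x X := by
  induction x using tInduction generalizing X with
  | hadd x y hx hy => simp only [map_add, LinearMap.add_apply, hx, hy, mul_add]
  | hA b =>
    rw [← mul_one (tA k H A b), swapFst_tA_mul, swapFst_tA_mul, swapFst_one]; simp
  | hmulA b x hx => rw [swapFst_tA_mul, swapFst_tA_mul, ← lact_ract, hx]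
  | hmulD Y x hx => rw [swapFst_tD_mul, swapFst_tD_mul, sig_lact, mul_assoc]

section
variable (k H A)

/-- The left multiplication of the tensor algebra. -/
noncomputable def tMul : TensorAlg k H A →ₐ[k] Module.End k (TensorAlg k H A) :=
  Algebra.lmul k (TensorAlg k H A)

/-- The braided exchange of the first two factors. -/
noncomputable def swapZero : TensorAlg k H A →ₗ[k] TensorAlg k H A :=
  tFold ((tMul k H A).comp ((tA k H A).comp (projA k H A))) 0
    swapFst.flip
    (by simp)
    (fun a X x => by simp [tMul, swapFst_lact])
    (fun X a x => by simp [swapFst_tA_mul])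

end

theorem swapZero_tA_mul (a : A) (x : TensorAlg k H A) :
    swapZero k H A (tA k H A a * x) = tA k H A a * swapZero k H A x :=
  (tFold_tA_mul _ _ _ _ _ _ a x).trans (by simp [tMul, swapZero])

theorem swapZero_tD_mul (X : Der k H A) (x : TensorAlg k H A) :
    swapZero k H A (tD k H A X * x) = swapFst x X :=
  (tFold_tD_mul _ _ _ _ _ _ X x).trans (by simp)

theorem swapZero_tD_tD_mul (X Y : Der k H A) (x : TensorAlg k H A) :
    swapZero k H A (tD k H A X * (tD k H A Y * x)) = sig k H A X Y * x := by
  rw [swapZero_tD_mul, swapFst_tD_mul]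

theorem swapZero_one : swapZero k H A 1 = 0 := tFold_one _ _ _ _ _ _

theorem swapZero_tD (X : Der k H A) : swapZero k H A (tD k H A X) = 0 := by
  rw [← mul_one (tD k H A X), swapZero_tD_mul, swapFst_one]; rfl

section
variable (k H A)

/-- The braided exchange of the factors in the positions `p` and `p + 1` (counted from `0`). -/
noncomputable def swapAux : ℕ → {G : TensorAlg k H A →ₗ[k] TensorAlg k H A //
    ∀ a x, G (tA k H A a * x) = tMul k H A (tA k H A a) (G x)}
  | 0 => ⟨swapZero k H A, swapZero_tA_mul⟩
  -- The left `A`-linearity is carried through the recursion because shifting a map by one factor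
  -- over `A` requires it.
  | p + 1 => ⟨tShift (tMul k H A) (swapAux p).1 (swapAux p).2, tShift_tA_mul _ _ _⟩

/-- The braided exchange of the factors in the positions `p` and `p + 1` (counted from `0`). -/
noncomputable def swap (p : ℕ) : TensorAlg k H A →ₗ[k] TensorAlg k H A := (swapAux k H A p).1

end

attribute [irreducible] swapFst swapZero

theorem swap_zero : swap k H A 0 = swapZero k H A := rfl

theorem swap_succ_tD_mul (p : ℕ) (X : Der k H A) (x : TensorAlg k H A) :
    swap k H A (p + 1) (tD k H A X * x) = tD k H A X * swap k H A p x :=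
  tShift_tD_mul _ _ (swapAux k H A p).2 X x

theorem swap_zero_one (p : ℕ) : swap k H A p 1 = 0 := by
  cases p with
  | zero => exact swapZero_one
  | succ p => exact tShift_one _ _ (swapAux k H A p).2

attribute [irreducible] swap

end Exchange

/-! ### Equivariance and involutivity of exchanges, and moves of a factor across several others. -/

section Exchange
variable {k H A : Type*} [CommRing k] [Ring H] [HopfAlgebra k H] [Triangular k H] [Ring A]
  [Algebra k A] [Module H A] [IsScalarTower k H A] [ModuleAlgebra k H A]
  [BraidedCommutative k H A]

theorem words_ext {N : Type*} [AddCommGroup N] [Module k N] {n : ℕ} {F G : TensorAlg k H A →ₗ[k] N}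
    (h : ∀ l : List (Der k H A), l.length = n → F (word l) = G (word l)) {x : TensorAlg k H A}
    (hx : x ∈ words k H A n) : F x = G x :=
  words_induction (p := fun x => F x = G x) (by simp)
    (fun x y hx hy => by rw [map_add, map_add, hx, hy])
    (fun c x hx => by rw [map_smul, map_smul, hx]) h x hx

theorem sig_mem (X Y : Der k H A) : sig k H A X Y ∈ words k H A 2 := by
  rw [sig_apply]
  exact Submodule.sum_mem _ fun r _ =>
    words_mul (n := 1) (m := 1) (tD_mem (derAct k H A r.1 Y)) (tD_mem (derAct k H A r.2 X))

theorem swap_tActH (p : ℕ) {n : ℕ} {x : TensorAlg k H A} (hx : x ∈ words k H A n) (ξ : H) :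
    swap k H A p (tActH k H A ξ x) = tActH k H A ξ (swap k H A p x) := by
  have hm : ∀ ξ (X Y : TensorAlg k H A), tActH k H A ξ (X * Y) = _ := isMulAction_tActH
  refine words_ext (F := swap k H A p ∘ₗ tActH k H A ξ) (G := tActH k H A ξ ∘ₗ swap k H A p)
    (fun l hl => ?_) hx
  simp only [LinearMap.comp_apply]
  clear hx hl
  induction p generalizing l ξ with
  | zero =>
    rw [swap_zero]
    match l with
    | [] => rw [word_nil, tActH_one, map_smul, swapZero_one, map_zero, smul_zero]
    | [X] => rw [word_cons, word_nil, mul_one, tActH_tD, swapZero_tD, swapZero_tD, map_zero]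
    | X :: Y :: v =>
      have h := legs_coassoc (derAct k H A) (derAct k H A) (tActH k H A)
        (fun X Y v => sig k H A X Y * v) ξ X Y (word v)
      simp only [word_cons, swapZero_tD_tD_mul]
      rw [hm, hm]
      simp only [tActH_sig, Finset.sum_mul]
      rw [h, map_sum]
      refine Finset.sum_congr rfl fun p _ => ?_
      rw [hm, Finset.mul_sum, map_sum]
      refine Finset.sum_congr rfl fun q _ => ?_
      rw [tActH_tD, tActH_tD, swapZero_tD_tD_mul]
  | succ p ih =>
    have key : ∀ (Z : Der k H A) (x y z : TensorAlg k H A), x = tD k H A Z → swap k H A p y = z →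
        swap k H A (p + 1) (x * y) = x * z := by
      rintro Z _ y _ rfl rfl
      exact swap_succ_tD_mul p Z y
    match l with
    | [] => rw [word_nil, tActH_one, map_smul, swap_zero_one, map_zero, smul_zero]
    | X :: v =>
      rw [word_cons, swap_succ_tD_mul p X (word v)]
      refine (congrArg (swap k H A (p + 1)) (hm ξ (tD k H A X) (word v))).trans
        (Eq.trans ?_ (hm ξ (tD k H A X) (swap k H A p (word v))).symm)
      rw [map_sum]
      refine Finset.sum_congr rfl fun q _ => ?_
      exact key _ _ _ _ (tActH_tD X q.1) (ih _ v)

theorem swap_mul {p : ℕ} {u : TensorAlg k H A} (hu : u ∈ words k H A p) (x : TensorAlg k H A) :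
    swap k H A p (u * x) = u * swapZero k H A x := by
  refine words_ext (F := swap k H A p ∘ₗ LinearMap.mulRight k x)
    (G := LinearMap.mulRight k (swapZero k H A x)) (fun l hl => ?_) hu
  simp only [LinearMap.comp_apply, LinearMap.mulRight_apply]
  clear hu
  induction l generalizing p with
  | nil => subst hl; rw [word_nil, one_mul, one_mul, List.length_nil, swap_zero]
  | cons X l ih => subst hl; rw [word_cons, mul_assoc, List.length_cons, swap_succ_tD_mul, ih rfl,
      mul_assoc]

/-- Length at least two ensures that both exchanged factors lie in `x`. -/
theorem swapZero_mul {n : ℕ} {x : TensorAlg k H A} (hx : x ∈ words k H A (n + 2))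
    (y : TensorAlg k H A) : swapZero k H A (x * y) = swapZero k H A x * y := by
  refine words_ext (F := swapZero k H A ∘ₗ LinearMap.mulRight k y)
    (G := LinearMap.mulRight k y ∘ₗ swapZero k H A) (fun l hl => ?_) hx
  match l with
  | [] => simp at hl
  | [X] => simp at hl
  | X :: Y :: v =>
    simp only [LinearMap.comp_apply, LinearMap.mulRight_apply, word_cons, swapZero_tD_tD_mul,
      mul_assoc]

theorem swapZero_sig (X Y : Der k H A) :
    swapZero k H A (sig k H A X Y) = tD k H A X * tD k H A Y := by
  rw [← sig_sig, sig_apply, map_sum]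
  refine Finset.sum_congr rfl fun r _ => ?_
  rw [← mul_one (tD k H A (derAct k H A r.2 X)), swapZero_tD_tD_mul, mul_one]

theorem swap_mem {p n : ℕ} {x : TensorAlg k H A} (hx : x ∈ words k H A (p + 2 + n)) :
    swap k H A p x ∈ words k H A (p + 2 + n) := by
  refine words_induction (n := p + 2 + n) (p := fun x => swap k H A p x ∈ words k H A (p + 2 + n))
    (by simp) (fun x y hx hy => by rw [map_add]; exact add_mem hx hy)
    (fun c x hx => by rw [map_smul]; exact Submodule.smul_mem _ c hx) (fun l hl => ?_) x hx
  clear hx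
  induction p generalizing l with
  | zero =>
    match l with
    | [] => simp at hl; omega
    | [X] => simp at hl; omega
    | X :: Y :: v =>
      simp only [word_cons, swap_zero, swapZero_tD_tD_mul, List.length_cons] at hl ⊢
      obtain rfl : v.length = n := by omega
      rw [zero_add]
      exact words_mul (sig_mem X Y) (word_mem v)
  | succ p ih =>
    match l with
    | [] => simp at hl; omega
    | X :: v =>
      rw [word_cons, swap_succ_tD_mul, show p + 1 + 2 + n = 1 + (p + 2 + n) by omega]
      exact words_mul (tD_mem X) (ih v (by simp at hl; omega))

/-- Triangularity makes the exchange an involution, but only when both positions exist; on shorter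
words the map is zero. -/
theorem swap_swap {p n : ℕ} {x : TensorAlg k H A} (hx : x ∈ words k H A (p + 2 + n)) :
    swap k H A p (swap k H A p x) = x := by
  refine words_ext (F := swap k H A p ∘ₗ swap k H A p) (G := LinearMap.id) (fun l hl => ?_) hx
  clear hx
  simp only [LinearMap.comp_apply, LinearMap.id_apply]
  induction p generalizing l with
  | zero =>
    match l with
    | [] => simp at hl; omega
    | [X] => simp at hl; omega
    | X :: Y :: v =>
      simp only [word_cons, swap_zero, swapZero_tD_tD_mul]
      rw [swapZero_mul (n := 0) (sig_mem X Y), swapZero_sig, mul_assoc]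
  | succ p ih =>
    match l with
    | [] => simp at hl; omega
    | X :: v => rw [word_cons, swap_succ_tD_mul, swap_succ_tD_mul, ih v (by simp at hl; omega)]

section
variable (k H A)

/-- The braided move of the factor in the position `p + m` to the left across `m` factors. -/
noncomputable def moveLeft : ℕ → ℕ → (TensorAlg k H A →ₗ[k] TensorAlg k H A)
  | _, 0 => LinearMap.id
  | p, m + 1 => swap k H A p ∘ₗ moveLeft (p + 1) m

/-- The braided move of the factor in the position `p` to the right across `m` factors. -/
noncomputable def moveRight : ℕ → ℕ → (TensorAlg k H A →ₗ[k] TensorAlg k H A)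
  | _, 0 => LinearMap.id
  | p, m + 1 => moveRight (p + 1) m ∘ₗ swap k H A p

end

theorem moveLeft_mem {p m n N : ℕ} (hN : p + m + 1 + n = N) {x : TensorAlg k H A}
    (hx : x ∈ words k H A N) : moveLeft k H A p m x ∈ words k H A N := by
  induction m generalizing p n with
  | zero => exact hx
  | succ m ih =>
    obtain rfl : N = p + 2 + (m + n) := by omega
    exact swap_mem (ih (p := p + 1) (n := n) (by omega))

theorem moveLeft_moveRight {p m n N : ℕ} (hN : p + m + 1 + n = N) {x : TensorAlg k H A}
    (hx : x ∈ words k H A N) : moveLeft k H A p m (moveRight k H A p m x) = x := by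
  induction m generalizing p n x with
  | zero => rfl
  | succ m ih =>
    obtain rfl : N = p + 2 + (m + n) := by omega
    change swap k H A p (moveLeft k H A (p + 1) m (moveRight k H A (p + 1) m (swap k H A p x))) = x
    rw [ih (p := p + 1) (n := n) (by omega) (swap_mem hx), swap_swap hx]

theorem moveLeft_tActH (p m : ℕ) {n : ℕ} {x : TensorAlg k H A} (hn : p + m + 1 ≤ n)
    (hx : x ∈ words k H A n) (ξ : H) :
    moveLeft k H A p m (tActH k H A ξ x) = tActH k H A ξ (moveLeft k H A p m x) := by
  induction m generalizing p with
  | zero => rfl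
  | succ m ih =>
    change swap k H A p (moveLeft k H A (p + 1) m _) = _
    rw [ih _ (by omega), swap_tActH p
      (moveLeft_mem (n := n - (p + m + 2)) (by omega) hx)]
    rfl

theorem moveRight_tActH (p m : ℕ) {n : ℕ} {x : TensorAlg k H A} (hn : p + m + 1 ≤ n)
    (hx : x ∈ words k H A n) (ξ : H) :
    moveRight k H A p m (tActH k H A ξ x) = tActH k H A ξ (moveRight k H A p m x) := by
  induction m generalizing p x with
  | zero => rfl
  | succ m ih =>
    change moveRight k H A (p + 1) m (swap k H A p _) = _
    obtain ⟨d, rfl⟩ := Nat.exists_eq_add_of_le (show p + 2 ≤ n by omega)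
    rw [swap_tActH p hx, ih (p + 1) (by omega) (swap_mem hx)]
    rfl

/-- Adjacent exchanges compose, by the hexagon `(id ⊗ Δ)(R⁻¹) = R⁻¹₁₂ R⁻¹₁₃`, to one braiding with
the whole block. This links the composites of `swap` to the closed form of `exchange`. -/
theorem moveLeft_word {p m : ℕ} (u l : List (Der k H A)) (hu : u.length = p) (hl : l.length = m)
    (Y : Der k H A) (v : TensorAlg k H A) :
    moveLeft k H A p m (word u * (word l * (tD k H A Y * v))) =
      ∑ r ∈ legs (Rinv k H), word u * (tD k H A (derAct k H A r.1 Y) *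
        (tActH k H A r.2 (word l) * v)) := by
  induction l generalizing u p m with
  | nil =>
    obtain rfl : 0 = m := hl
    have h := legs_Rinv_counit_right (derAct k H A) (fun Y => word u * (tD k H A Y * v)) Y
    simp only [word_nil, tActH_one, one_mul, smul_mul_assoc, mul_smul_comm]
    exact h.symm
  | cons Z l ih =>
    subst hl
    have hm : ∀ ξ (X Y : TensorAlg k H A), tActH k H A ξ (X * Y) = _ := isMulAction_tActH
    have h1 := ih (u ++ [Z]) (p := p + 1) (by simp [hu]) rfl
    have h2 := legs_hexR (derAct k H A) (derAct k H A) (tActH k H A)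
      (fun Y Z l => word u * (tD k H A Y * ((tD k H A Z * l) * v))) Y Z (word l)
    simp only [word_append, word_cons, word_nil, mul_one, mul_assoc] at h1
    change swap k H A p (moveLeft k H A (p + 1) l.length _) = _
    rw [word_cons, mul_assoc, h1, map_sum]
    simp only [hm, tActH_tD, Finset.sum_mul, Finset.mul_sum]
    rw [h2, Finset.sum_comm]
    refine Finset.sum_congr rfl fun r _ => ?_
    rw [swap_mul (by rw [← hu]; exact word_mem u), swapZero_tD_tD_mul, sig_apply, Finset.sum_mul,
      Finset.mul_sum]
    simp only [mul_assoc]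

/-- The mirror image of `moveLeft_word`, with the hexagon for `(Δ ⊗ id)(R⁻¹)`. -/
theorem moveRight_word {p m : ℕ} (u l : List (Der k H A)) (hu : u.length = p) (hl : l.length = m)
    (X : Der k H A) (v : TensorAlg k H A) :
    moveRight k H A p m (word u * (tD k H A X * (word l * v))) =
      ∑ r ∈ legs (Rinv k H), word u * (tActH k H A r.1 (word l) *
        (tD k H A (derAct k H A r.2 X) * v)) := by
  induction l generalizing u p m X with
  | nil =>
    obtain rfl : 0 = m := hl
    have h := legs_Rinv_counit_left (derAct k H A) (fun Y => word u * (tD k H A Y * v)) X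
    simp only [word_nil, tActH_one, one_mul, smul_mul_assoc, mul_smul_comm]
    exact h.symm
  | cons Z l ih =>
    subst hl
    have hm : ∀ ξ (X Y : TensorAlg k H A), tActH k H A ξ (X * Y) = _ := isMulAction_tActH
    have h1 := fun Z X => ih (u ++ [Z]) (p := p + 1) (by simp [hu]) rfl X
    have h2 := legs_hexL (derAct k H A) (tActH k H A) (derAct k H A)
      (fun Z l X => word u * ((tD k H A Z * l) * (tD k H A X * v))) Z (word l) X
    simp only [word_append, word_cons, word_nil, mul_one, mul_assoc] at h1
    change moveRight k H A (p + 1) l.length (swap k H A p _) = _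
    rw [word_cons, mul_assoc, swap_mul (by rw [← hu]; exact word_mem u), swapZero_tD_tD_mul,
      sig_apply, Finset.sum_mul, Finset.mul_sum, map_sum]
    simp only [hm, tActH_tD, Finset.sum_mul, Finset.mul_sum]
    rw [h2, Finset.sum_comm]
    refine Finset.sum_congr rfl fun r _ => ?_
    rw [mul_assoc, h1]
    simp only [mul_assoc]

theorem moveLeft_mul {p m : ℕ} {u z : TensorAlg k H A} (hu : u ∈ words k H A p)
    (hz : z ∈ words k H A m) (Y : Der k H A) (v : TensorAlg k H A) :
    moveLeft k H A p m (u * (z * (tD k H A Y * v))) =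
      ∑ r ∈ legs (Rinv k H), u * (tD k H A (derAct k H A r.1 Y) * (tActH k H A r.2 z * v)) := by
  refine words_induction (p := fun u => moveLeft k H A p m (u * (z * (tD k H A Y * v))) =
      ∑ r ∈ legs (Rinv k H), u * (tD k H A (derAct k H A r.1 Y) * (tActH k H A r.2 z * v)))
    (by simp) (fun x y hx hy => by simp only [add_mul, map_add, hx, hy, Finset.sum_add_distrib])
    (fun c x hx => by simp only [smul_mul_assoc, map_smul, hx, Finset.smul_sum])
    (fun u hu => ?_) u hu
  refine words_induction (p := fun z => moveLeft k H A p m (word u * (z * (tD k H A Y * v))) =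
      ∑ r ∈ legs (Rinv k H), word u * (tD k H A (derAct k H A r.1 Y) * (tActH k H A r.2 z * v)))
    (by simp) (fun x y hx hy => by
      simp only [add_mul, mul_add, map_add, hx, hy, Finset.sum_add_distrib])
    (fun c x hx => by simp only [smul_mul_assoc, mul_smul_comm, map_smul, hx, Finset.smul_sum])
    (fun l hl => moveLeft_word u l hu hl Y v) z hz

theorem moveRight_mul {p m : ℕ} {u z : TensorAlg k H A} (hu : u ∈ words k H A p)
    (hz : z ∈ words k H A m) (X : Der k H A) (v : TensorAlg k H A) :
    moveRight k H A p m (u * (tD k H A X * (z * v))) =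
      ∑ r ∈ legs (Rinv k H), u * (tActH k H A r.1 z * (tD k H A (derAct k H A r.2 X) * v)) := by
  refine words_induction (p := fun u => moveRight k H A p m (u * (tD k H A X * (z * v))) =
      ∑ r ∈ legs (Rinv k H), u * (tActH k H A r.1 z * (tD k H A (derAct k H A r.2 X) * v)))
    (by simp) (fun x y hx hy => by simp only [add_mul, map_add, hx, hy, Finset.sum_add_distrib])
    (fun c x hx => by simp only [smul_mul_assoc, map_smul, hx, Finset.smul_sum])
    (fun u hu => ?_) u hu
  refine words_induction (p := fun z => moveRight k H A p m (word u * (tD k H A X * (z * v))) =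
      ∑ r ∈ legs (Rinv k H), word u * (tActH k H A r.1 z * (tD k H A (derAct k H A r.2 X) * v)))
    (by simp) (fun x y hx hy => by
      simp only [add_mul, mul_add, map_add, hx, hy, Finset.sum_add_distrib])
    (fun c x hx => by simp only [smul_mul_assoc, mul_smul_comm, map_smul, hx, Finset.smul_sum])
    (fun l hl => moveRight_word u l hu hl X v) z hz

end Exchange

/-! ### Brackets of tensors with generators, where generators have shifted parity. -/

section Generators
variable {k H A : Type*} [CommRing k] [Ring H] [HopfAlgebra k H] [Triangular k H] [Ring A]
  [Algebra k A] [Module H A] [IsScalarTower k H A] [ModuleAlgebra k H A]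

section
variable (k H A)

/-- The space `A × Der` of generators of the tensor algebra. -/
def Gen : Type _ := A × Der k H A

noncomputable instance : AddCommGroup (Gen k H A) := inferInstanceAs (AddCommGroup (A × Der k H A))
noncomputable instance : Module k (Gen k H A) := inferInstanceAs (Module k (A × Der k H A))

/-- The inclusion of `A` into the generators. -/
noncomputable def Gen.inl : A →ₗ[k] Gen k H A := LinearMap.inl k A (Der k H A)
/-- The inclusion of the braided derivations into the generators. -/
noncomputable def Gen.inr : Der k H A →ₗ[k] Gen k H A := LinearMap.inr k A (Der k H A)
/-- The projection of the generators to `A`. -/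
noncomputable def Gen.fst : Gen k H A →ₗ[k] A := LinearMap.fst k A (Der k H A)
/-- The projection of the generators to the braided derivations. -/
noncomputable def Gen.snd : Gen k H A →ₗ[k] Der k H A := LinearMap.snd k A (Der k H A)

variable {k H A}

@[simp] theorem Gen.fst_inl (a : A) : Gen.fst k H A (Gen.inl k H A a) = a := rfl
@[simp] theorem Gen.snd_inl (a : A) : Gen.snd k H A (Gen.inl k H A a) = 0 := rfl
@[simp] theorem Gen.fst_inr (X : Der k H A) : Gen.fst k H A (Gen.inr k H A X) = 0 := rfl
@[simp] theorem Gen.snd_inr (X : Der k H A) : Gen.snd k H A (Gen.inr k H A X) = X := rfl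

theorem Gen.ext {v w : Gen k H A} (h1 : Gen.fst k H A v = Gen.fst k H A w)
    (h2 : Gen.snd k H A v = Gen.snd k H A w) : v = w := Prod.ext h1 h2

theorem Gen.eq_add (w : Gen k H A) :
    w = Gen.inl k H A (Gen.fst k H A w) + Gen.inr k H A (Gen.snd k H A w) :=
  Gen.ext (by simp) (by simp)

variable (k H A)

/-- The action on the generators with parities shifted by one. -/
noncomputable def sW : Super H →ₐ[k] Module.End k (Gen k H A) :=
  AlgHom.ofLinearMap
    (LinearMap.mk₂ k (fun ξ w => Gen.inl k H A (opr k H A (Super.ev k 1 ξ) (Gen.fst k H A w)) +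
        Gen.inr k H A (derAct k H A (Super.ev k 0 ξ) (Gen.snd k H A w)))
      (fun x y w => by simp only [map_add, LinearMap.add_apply]; abel)
      (fun c x w => by simp only [map_smul, LinearMap.smul_apply, smul_add])
      (fun x v w => by simp only [map_add]; abel)
      (fun c x w => by simp only [map_smul, smul_add]))
    (LinearMap.ext fun w => by simp [← Gen.eq_add])
    (fun x y => LinearMap.ext fun w => by simp [mul_smul])

end

theorem sW_apply (ξ : Super H) (w : Gen k H A) : sW k H A ξ w =
    Gen.inl k H A (Super.ev k 1 ξ • Gen.fst k H A w) +
      Gen.inr k H A (derAct k H A (Super.ev k 0 ξ) (Gen.snd k H A w)) := rfl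

@[simp] theorem fst_sW (ξ : Super H) (w : Gen k H A) :
    Gen.fst k H A (sW k H A ξ w) = Super.ev k 1 ξ • Gen.fst k H A w := by simp [sW_apply]
@[simp] theorem snd_sW (ξ : Super H) (w : Gen k H A) :
    Gen.snd k H A (sW k H A ξ w) = derAct k H A (Super.ev k 0 ξ) (Gen.snd k H A w) := by
  simp [sW_apply]
theorem sW_inl (ξ : Super H) (a : A) :
    sW k H A ξ (Gen.inl k H A a) = Gen.inl k H A (Super.ev k 1 ξ • a) := by simp [sW_apply]
theorem sW_inr (ξ : Super H) (X : Der k H A) :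
    sW k H A ξ (Gen.inr k H A X) = Gen.inr k H A (derAct k H A (Super.ev k 0 ξ) X) := by
  simp [sW_apply]

variable [BraidedCommutative k H A]

section
variable (k H A)

/-- The brackets of algebra elements with generators. -/
noncomputable def brA : A →ₗ[k] Gen k H A →ₗ[k] TensorAlg k H A :=
  ((algDer k H A).compl₂ (Gen.snd k H A)).compr₂ (tA k H A).toLinearMap

/-- The brackets of braided derivations with generators. -/
noncomputable def brD : Der k H A →ₗ[k] Gen k H A →ₗ[k] TensorAlg k H A :=
  ((evalL k H A).compl₂ (Gen.fst k H A)).compr₂ (tA k H A).toLinearMap +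
    ((bracketL k H A).compl₂ (Gen.snd k H A)).compr₂ (tD k H A)

end

@[simp] theorem brA_apply (a : A) (w : Gen k H A) :
    brA k H A a w = tA k H A (algDer k H A a (Gen.snd k H A w)) := rfl
@[simp] theorem brD_apply (X : Der k H A) (w : Gen k H A) : brD k H A X w =
    tA k H A (X.1 (Gen.fst k H A w)) + tD k H A (Der.bracket X (Gen.snd k H A w)) := rfl

/-- This lemma and the next two are the compatibilities with the bimodule relations that are needed
to extend the brackets of generators to a derivation. No sign occurs, because a derivation is even
after the shift, and because the one odd argument `b ∈ A` contributes only where it is paired with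
an even factor. -/
theorem brA_mul (a b : A) : brA k H A (a * b) =
    postMul k (Gen k H A) (tA k H A a) (brA k H A b) +
      twist (sW k H A) (tAct k H A) (brA k H A a) (tA k H A b) := by
  refine LinearMap.ext fun w => ?_
  have h := legs_ev_Rinv (derAct k H A) (opr k H A) (fun Y b => algDer k H A a Y * b) 0 0 (Gen.snd k H A w) b
  simp only [Algebra.lsmul_coe, ksign_zero_left, one_smul] at h
  simp only [LinearMap.add_apply, twist_apply, postMul_apply, brA_apply, snd_sW, tAct_tA,
    ← map_mul, ← map_sum, h, ← map_add, algDer_mul]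

theorem brD_lact (a : A) (X : Der k H A) : brD k H A (Der.lact a X) =
    postMul k (Gen k H A) (tA k H A a) (brD k H A X) +
      twist (sW k H A) (tAct k H A) (brA k H A a) (tD k H A X) := by
  refine LinearMap.ext fun w => ?_
  have h := legs_ev_Rinv (derAct k H A) (derAct k H A)
    (fun Y X => tA k H A (algDer k H A a Y) * tD k H A X) 0 1 (Gen.snd k H A w) X
  simp only [ksign_zero_left, one_smul, tA_mul_tD] at h
  simp only [LinearMap.add_apply, twist_apply, postMul_apply, brA_apply, brD_apply, snd_sW,
    tAct_tD, h, bracket_lact, map_add, map_sum, mul_add, tA_mul_tD, Der.lact_apply, map_mul,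
    add_assoc]

theorem brD_ract (X : Der k H A) (a : A) : brD k H A (Der.ract X a) =
    postMul k (Gen k H A) (tD k H A X) (brA k H A a) +
      twist (sW k H A) (tAct k H A) (brD k H A X) (tA k H A a) := by
  refine LinearMap.ext fun w => ?_
  have h1 := legs_ev_Rinv (opr k H A) (opr k H A)
    (fun b a => tA k H A (X.1 b) * tA k H A a) 1 0 (Gen.fst k H A w) a
  have h2 := legs_ev_Rinv (derAct k H A) (opr k H A)
    (fun Y a => tD k H A (bracketL k H A X Y) * tA k H A a) 0 0 (Gen.snd k H A w) a
  simp only [Algebra.lsmul_coe, ksign_zero_right, one_smul, bracketL_apply] at h1 h2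
  simp only [LinearMap.add_apply, twist_apply, postMul_apply, brA_apply, brD_apply, fst_sW, snd_sW,
    tAct_tA, add_mul, Finset.sum_add_distrib, h1, h2]
  simp only [← map_mul, ← map_sum, ract_apply, bracket_ract, map_add, tD_mul_tA]
  abel

section
variable (k H A)

/-- The bracket of tensors with generators. -/
noncomputable def tBr : TensorAlg k H A →ₗ[k] Gen k H A →ₗ[k] TensorAlg k H A :=
  tDeriv isMulAction_tAct (AlgHom.id k _) (brA k H A) (brD k H A) brA_mul brD_lact brD_ract

end

theorem tBr_tA (a : A) : tBr k H A (tA k H A a) = brA k H A a :=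
  tDeriv_tA _ _ _ _ _ _ _ tAct_one a
theorem tBr_tD (X : Der k H A) : tBr k H A (tD k H A X) = brD k H A X :=
  tDeriv_tD _ _ _ _ _ _ _ tAct_one X
theorem tBr_mul (x y : TensorAlg k H A) : tBr k H A (x * y) =
    postMul k (Gen k H A) x (tBr k H A y) + twist (sW k H A) (tAct k H A) (tBr k H A x) y :=
  tDeriv_mul _ _ _ _ _ _ _ tAct_one x y

attribute [irreducible] tBr

theorem tBr_mul_apply (x y : TensorAlg k H A) (w : Gen k H A) : tBr k H A (x * y) w =
    x * tBr k H A y w + ∑ r ∈ legs (Rinv k (Super H)),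
      tBr k H A x (sW k H A r.1 w) * tAct k H A r.2 y := by
  rw [tBr_mul, LinearMap.add_apply, twist_apply, postMul_apply]

theorem tAct_brA (ξ : Super H) (a : A) (w : Gen k H A) : tAct k H A ξ (brA k H A a w) =
    ∑ p ∈ legs (comul (R := k) ξ), brA k H A (Super.ev k 0 p.1 • a) (sW k H A p.2 w) := by
  have h := legs_ev_comul (opr k H A) (derAct k H A) (fun a Y => algDer k H A a Y) 0 0 ξ a (Gen.snd k H A w)
  simp only [Algebra.lsmul_coe, add_zero] at h
  simp only [brA_apply, snd_sW, tAct_tA, ← map_sum, h, smul_algDer]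

theorem tAct_brD (ξ : Super H) (X : Der k H A) (w : Gen k H A) :
    tAct k H A ξ (brD k H A X w) = ∑ p ∈ legs (comul (R := k) ξ),
      brD k H A (derAct k H A (Super.ev k 1 p.1) X) (sW k H A p.2 w) := by
  have h1 := legs_ev_comul (derAct k H A) (opr k H A) (fun X b => evalL k H A X b) 1 1 ξ X (Gen.fst k H A w)
  have h2 := legs_ev_comul (derAct k H A) (derAct k H A) (fun X Y => bracketL k H A X Y) 1 0 ξ X (Gen.snd k H A w)
  simp only [Algebra.lsmul_coe, add_zero, evalL_apply, bracketL_apply,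
    show (1 + 1 : ZMod 2) = 0 from rfl] at h1 h2
  simp only [brD_apply, fst_sW, snd_sW, map_add, tAct_tA, tAct_tD, Finset.sum_add_distrib, ← map_sum, h1,
    h2, smul_eval, derAct_bracket]

theorem tAct_tBr (ξ : Super H) (x : TensorAlg k H A) (w : Gen k H A) :
    tAct k H A ξ (tBr k H A x w) = ∑ p ∈ legs (comul (R := k) ξ),
      tBr k H A (tAct k H A p.1 x) (sW k H A p.2 w) := by
  have key := equivariant_mul (ρW := sW k H A) (ρ := tAct k H A) isMulAction_tAct isMulAction_tAct
    (AlgHom.id k _) (fun ξ x => by simp) (tBr k H A) tBr_mul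
  revert ξ w
  induction x using tInduction with
  | hadd x y hx hy =>
    intro ξ w
    simp only [map_add, LinearMap.add_apply, hx, hy, Finset.sum_add_distrib]
  | hA a =>
    intro ξ w
    simp only [tAct_tA, tBr_tA, tAct_brA]
  | hmulA a x hx =>
    refine key _ _ (fun ξ w => ?_) hx
    simp only [tAct_tA, tBr_tA, tAct_brA]
  | hmulD X x hx =>
    refine key _ _ (fun ξ w => ?_) hx
    simp only [tAct_tD, tBr_tD, tAct_brD]

theorem tBr_one : tBr k H A 1 = 0 := by
  rw [← map_one (tA k H A), tBr_tA]
  refine LinearMap.ext fun w => ?_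
  simp [algDer_apply, ModuleAlgebra.smul_one (k := k), der_one]

/-! ### Brackets of tensors with braided derivations -/

/-- A derivation is even after the parity shift, so the Leibniz rule for brackets with it is that of
the unsigned action. -/
theorem tBr_mul_der {n : ℕ} (x : TensorAlg k H A) {y : TensorAlg k H A} (hy : y ∈ words k H A n)
    (Z : Der k H A) : tBr k H A (x * y) (Gen.inr k H A Z) = x * tBr k H A y (Gen.inr k H A Z) +
      ∑ r ∈ legs (Rinv k H), tBr k H A x (Gen.inr k H A (derAct k H A r.1 Z)) * tActH k H A r.2 y := by
  have h := legs_ev_Rinv (derAct k H A) (tActH k H A) (fun Z y => tBr k H A x (Gen.inr k H A Z) * y) 0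
    (n : ZMod 2) Z y
  simp only [ksign_zero_left, one_smul] at h
  rw [tBr_mul_apply]
  simp only [sW_inr, tAct_words hy, h]

theorem tBr_tD_mul_der {n : ℕ} (X : Der k H A) {y : TensorAlg k H A} (hy : y ∈ words k H A n)
    (Z : Der k H A) : tBr k H A (tD k H A X * y) (Gen.inr k H A Z) = tD k H A X * tBr k H A y (Gen.inr k H A Z) +
      ∑ r ∈ legs (Rinv k H),
        tD k H A (Der.bracket X (derAct k H A r.1 Z)) * tActH k H A r.2 y := by
  rw [tBr_mul_der _ hy]
  simp only [tBr_tD, brD_apply, Gen.fst_inr, Gen.snd_inr, map_zero, zero_add]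

theorem tBr_der_mem {n : ℕ} {x : TensorAlg k H A} (hx : x ∈ words k H A n) (Z : Der k H A) :
    tBr k H A x (Gen.inr k H A Z) ∈ words k H A n := by
  refine words_induction (n := n) (p := fun x => tBr k H A x (Gen.inr k H A Z) ∈ words k H A n)
    (by simp) (fun x y hx hy => by rw [map_add]; exact add_mem hx hy)
    (fun c x hx => by rw [map_smul]; exact Submodule.smul_mem _ c hx) (fun l hl => ?_) x hx
  clear hx
  subst hl
  induction l generalizing Z with
  | nil => rw [word_nil, tBr_one]; exact zero_mem _
  | cons X l ih =>
    rw [word_cons, tBr_tD_mul_der _ (word_mem l), List.length_cons, add_comm l.length]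
    exact add_mem (words_mul (tD_mem X) (ih Z))
      (Submodule.sum_mem _ fun r _ => words_mul (tD_mem _) (tActH_mem (word_mem l) _))

/-- Both sides consist of a term with `[X, Z]` and a term with `[Y, Z]`, in exchanged order. The
hexagons match the terms with `[Y, Z]`; for those with `[X, Z]` the crossing of `Y` and `Z` in
addition cancels by `R⁻¹ R⁻¹₂₁ = 1`. -/
theorem swapZero_tBr_der_two (X Y Z : Der k H A) :
    swapZero k H A (tBr k H A (tD k H A X * tD k H A Y) (Gen.inr k H A Z)) =
      tBr k H A (sig k H A X Y) (Gen.inr k H A Z) := by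
  have hd : ∀ X Y Z : Der k H A, tBr k H A (tD k H A X * tD k H A Y) (Gen.inr k H A Z) =
      tD k H A X * tD k H A (Der.bracket Y Z) + ∑ r ∈ legs (Rinv k H),
        tD k H A (Der.bracket X (derAct k H A r.1 Z)) * tD k H A (derAct k H A r.2 Y) :=
      fun X Y Z => by
    rw [tBr_tD_mul_der _ (tD_mem Y)]
    simp only [tBr_tD, brD_apply, Gen.fst_inr, Gen.snd_inr, map_zero, zero_add, tActH_tD]
  have hs : ∀ X Y : Der k H A, swapZero k H A (tD k H A X * tD k H A Y) = sig k H A X Y :=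
    fun X Y => by rw [← mul_one (tD k H A Y), swapZero_tD_tD_mul, mul_one]
  have h1 := legs_hexL (derAct k H A) (derAct k H A) (derAct k H A)
    (fun Y Z X => tD k H A (bracketL k H A Y Z) * tD k H A X) Y Z X
  have h2 := fun s : H × H => legs_hexR (derAct k H A) (derAct k H A) (derAct k H A)
    (fun Y X Z => tD k H A Y * tD k H A (bracketL k H A X Z)) (derAct k H A s.2 Y) X
      (derAct k H A s.1 Z)
  have h3 := fun r : H × H => legs_Rinv_flip (derAct k H A) (derAct k H A)
    (fun Y Z => tD k H A (derAct k H A r.1 Y) * tD k H A (bracketL k H A (derAct k H A r.2 X) Z))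
      Y Z
  simp only [bracketL_apply] at h1 h2 h3
  rw [hd, map_add, hs, map_sum, sig_apply, sig_apply, map_sum, LinearMap.sum_apply]
  simp only [hs, hd, Finset.sum_add_distrib]
  rw [add_comm]
  congr 1
  · simp only [sig_apply, derAct_bracket, map_sum, Finset.mul_sum, h2]
    rw [Finset.sum_comm]
    exact Finset.sum_congr rfl fun r _ => h3 r
  · simp only [derAct_bracket, map_sum, Finset.sum_mul, h1]
    exact Finset.sum_comm

/-- The bracket acts on the first two factors, where the previous lemma applies, or on the remaining
ones, which the exchange does not touch. Hence invariance under the exchange is inherited by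
brackets with derivations. -/
theorem swapZero_tBr_der {n : ℕ} {x : TensorAlg k H A} (hx : x ∈ words k H A (n + 2))
    (Z : Der k H A) :
    swapZero k H A (tBr k H A x (Gen.inr k H A Z)) = tBr k H A (swapZero k H A x) (Gen.inr k H A Z) := by
  refine words_ext (F := swapZero k H A ∘ₗ (tBr k H A).flip (Gen.inr k H A Z))
    (G := (tBr k H A).flip (Gen.inr k H A Z) ∘ₗ swapZero k H A) (fun l hl => ?_) hx
  match l with
  | [] => simp at hl
  | [X] => simp at hl
  | X :: Y :: v =>
    simp only [LinearMap.comp_apply, LinearMap.flip_apply, word_cons, swapZero_tD_tD_mul]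
    have h2 : ∀ Z, tBr k H A (tD k H A X * tD k H A Y) (Gen.inr k H A Z) ∈ words k H A (0 + 2) := fun Z =>
      tBr_der_mem (words_mul (tD_mem X) (tD_mem Y)) Z
    rw [← mul_assoc, tBr_mul_der _ (word_mem v), tBr_mul_der _ (word_mem v), map_add, map_sum,
      mul_assoc, swapZero_tD_tD_mul]
    simp only [swapZero_mul (h2 _), swapZero_tBr_der_two]

end Generators

/-! ### Brackets of tensors with elements of `A` and contraction of the first factor. -/

section Contraction
variable {k H A : Type*} [CommRing k] [Ring H] [HopfAlgebra k H] [Triangular k H] [Ring A]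
  [Algebra k A] [Module H A] [IsScalarTower k H A] [ModuleAlgebra k H A]
  [BraidedCommutative k H A]

section
variable (k H A)

/-- The action of `H` on the generators. -/
noncomputable def sH : H →ₐ[k] Module.End k (Gen k H A) := (sW k H A).comp (Super.const k)

/-- Evaluation of braided derivations with values in the tensor algebra. -/
noncomputable def evalT : Der k H A →ₗ[k] Gen k H A →ₗ[k] TensorAlg k H A :=
  ((evalL k H A).compl₂ (Gen.fst k H A)).compr₂ (tA k H A).toLinearMap

end

@[simp] theorem fst_sH (ξ : H) (w : Gen k H A) :
    Gen.fst k H A (sH k H A ξ w) = ξ • Gen.fst k H A w := fst_sW _ w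

@[simp] theorem evalT_apply (X : Der k H A) (w : Gen k H A) :
    evalT k H A X w = tA k H A (X.1 (Gen.fst k H A w)) := rfl

theorem evalT_lact (a : A) (X : Der k H A) :
    evalT k H A (Der.lact a X) = postMul k (Gen k H A) (tA k H A a) (evalT k H A X) :=
  LinearMap.ext fun b => by simp [Der.lact_apply]

theorem evalT_ract (X : Der k H A) (a : A) : evalT k H A (Der.ract X a) =
    twist (sH k H A) (tActH k H A) (evalT k H A X) (tA k H A a) :=
  LinearMap.ext fun w => by
    rw [twist_apply]
    simp only [evalT_apply, ract_apply, map_sum, map_mul, tActH_tA, fst_sH]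

section
variable (k H A)

/-- The contraction of the first factor, `X ⊗ z ↦ (b ↦ X(R₁⁻¹ ▷ b) (R₂⁻¹ ▷ z))`. -/
noncomputable def contract : TensorAlg k H A →ₗ[k] Gen k H A →ₗ[k] TensorAlg k H A :=
  tFold (N := Gen k H A →ₗ[k] TensorAlg k H A) ((postMul k (Gen k H A)).comp ((tA k H A).comp (projA k H A))) 0
    ((twist (sH k H A) (tActH k H A)) ∘ₗ evalT k H A)
    (by simp)
    (fun a X x => by simp [evalT_lact, twist_postMul])
    (fun X a x => by simp [evalT_ract, twist_twist isMulAction_tActH])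

/-- The bracket with elements of `A`. -/
noncomputable def tBrA : TensorAlg k H A →ₗ[k] Gen k H A →ₗ[k] TensorAlg k H A :=
  (tBr k H A).compl₂ (Gen.inl k H A ∘ₗ Gen.fst k H A)

end

theorem contract_tD_mul (X : Der k H A) (x : TensorAlg k H A) : contract k H A (tD k H A X * x) =
    twist (sH k H A) (tActH k H A) (evalT k H A X) x :=
  (tFold_tD_mul _ _ _ _ _ _ X x).trans (by simp)

attribute [irreducible] contract

@[simp] theorem tBrA_apply (x : TensorAlg k H A) (w : Gen k H A) :
    tBrA k H A x w = tBr k H A x (Gen.inl k H A (Gen.fst k H A w)) := rfl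

theorem tBrA_tA_mul (a : A) (x : TensorAlg k H A) :
    tBrA k H A (tA k H A a * x) = postMul k (Gen k H A) (tA k H A a) (tBrA k H A x) := by
  refine LinearMap.ext fun b => ?_
  simp only [tBrA_apply, tBr_mul_apply, postMul_apply, sW_inl, tBr_tA, brA_apply, Gen.snd_inl,
    map_zero, zero_mul, Finset.sum_const_zero, add_zero]

section
variable (k H A)

/-- The bracket with elements of `A` on all but the first two factors. -/
noncomputable def tBrTail : TensorAlg k H A →ₗ[k] Gen k H A →ₗ[k] TensorAlg k H A :=
  tShift (N := Gen k H A →ₗ[k] TensorAlg k H A) (postMul k (Gen k H A))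
    (tShift (N := Gen k H A →ₗ[k] TensorAlg k H A) (postMul k (Gen k H A)) (tBrA k H A)
      tBrA_tA_mul)
    (tShift_tA_mul _ _ _)

end

theorem tBrTail_tD_mul (X Y : Der k H A) (x : TensorAlg k H A) (b : A) :
    tBrTail k H A (tD k H A X * (tD k H A Y * x)) (Gen.inl k H A b) =
      tD k H A X * (tD k H A Y * tBr k H A x (Gen.inl k H A b)) := by
  rw [tBrTail, tShift_tD_mul, tShift_tD_mul]; rfl

attribute [irreducible] tBrTail

/-- An element of `A` is odd after the shift, so crossing `n` derivations costs `(-1)ⁿ`. -/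
theorem tBr_tD_mul_alg {n : ℕ} (x : TensorAlg k H A) {y : TensorAlg k H A}
    (hy : y ∈ words k H A n) (b : A) : tBr k H A (x * y) (Gen.inl k H A b) =
      x * tBr k H A y (Gen.inl k H A b) + ksign 1 n • ∑ r ∈ legs (Rinv k H),
        tBr k H A x (Gen.inl k H A (r.1 • b)) * tActH k H A r.2 y := by
  have h := legs_ev_Rinv (opr k H A) (tActH k H A) (fun b y => tBr k H A x (Gen.inl k H A b) * y)
    1 (n : ZMod 2) b y
  simp only [Algebra.lsmul_coe] at h
  rw [tBr_mul_apply]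
  simp only [sW_inl, tAct_words hy, h]

theorem tBr_tD_inl (X : Der k H A) (b : A) :
    tBr k H A (tD k H A X) (Gen.inl k H A b) = tA k H A (X.1 b) := by
  simp only [tBr_tD, brD_apply, Gen.fst_inl, Gen.snd_inl]
  rw [← bracketL_apply, map_zero, map_zero, add_zero]

/-- Contracting `σ(X, Y)` evaluates `Y` and leaves `X` on its right; moving the function `Y(b)` back
across `X` undoes the braiding. -/
theorem twist_sig (X Y : Der k H A) (b : A) : ∑ r ∈ legs (Rinv k H),
    twist (sH k H A) (tActH k H A) (evalT k H A (derAct k H A r.1 Y))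
      (tD k H A (derAct k H A r.2 X)) (Gen.inl k H A b) = tD k H A X * tA k H A (Y.1 b) := by
  have h := legs_hexL (derAct k H A) (opr k H A) (derAct k H A)
    (fun Y b X => tA k H A (evalL k H A Y b) * tD k H A X) Y b X
  have h2 := braidedComm_tActH_tA (tD k H A X) (Y.1 b)
  simp only [Algebra.lsmul_coe, evalL_apply] at h
  simp only [BraidedComm, tActH_tA, tActH_tD] at h2
  rw [h2]
  simp only [twist_apply, evalT_apply, fst_sH, Gen.fst_inl, tActH_tD, smul_eval, map_sum,
    Finset.sum_mul, h]
  exact Finset.sum_comm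

/-- The bracket of `X ⊗ Y ⊗ v` with an element of `A`. -/
theorem tBr_alg {n : ℕ} {x : TensorAlg k H A} (hx : x ∈ words k H A (n + 2)) (b : A) :
    tBr k H A x (Gen.inl k H A b) = tBrTail k H A x (Gen.inl k H A b) + ksign 1 n •
      (contract k H A (swapZero k H A x) (Gen.inl k H A b) - contract k H A x (Gen.inl k H A b)) := by
  refine words_ext (F := (tBr k H A).flip (Gen.inl k H A b))
      (G := (tBrTail k H A).flip (Gen.inl k H A b) +
      ksign 1 n • ((contract k H A).flip (Gen.inl k H A b) ∘ₗ swapZero k H A -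
        (contract k H A).flip (Gen.inl k H A b)))
      (fun l hl => ?_) hx
  match l with
  | [] => simp at hl
  | [X] => simp at hl
  | X :: Y :: v =>
    obtain rfl : v.length = n := by simpa using hl
    change tBr k H A _ (Gen.inl k H A b) = tBrTail k H A _ (Gen.inl k H A b) + ksign 1 v.length •
      (contract k H A (swapZero k H A _) (Gen.inl k H A b) - contract k H A _ (Gen.inl k H A b))
    simp only [word_cons]
    -- The bracket of two factors with `b` is a difference: `b` crosses the odd `Y` to reach `X`,
    -- which gives the minus sign. By `h4` the first term is the contraction after the exchange; by
    -- `h2` the second is the contraction itself.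
    have h1 : ∀ b, tBr k H A (tD k H A X * tD k H A Y) (Gen.inl k H A b) =
        tD k H A X * tA k H A (Y.1 b) -
          twist (sH k H A) (tActH k H A) (evalT k H A X) (tD k H A Y) (Gen.inl k H A b) := fun b => by
      rw [tBr_tD_mul_alg _ (tD_mem Y), tBr_tD_inl, twist_apply]
      simp only [tBr_tD_inl, fst_sH, Gen.fst_inl, evalT_apply,
        show ksign 1 ((1 : ℕ) : ZMod 2) = -1 from rfl]
      rw [neg_one_zsmul, sub_eq_add_neg]
    have h2 : ∀ X Y, contract k H A (tD k H A X * (tD k H A Y * word v)) (Gen.inl k H A b) =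
        ∑ r ∈ legs (Rinv k H), twist (sH k H A) (tActH k H A) (evalT k H A X) (tD k H A Y)
          (sH k H A r.1 (Gen.inl k H A b)) * tActH k H A r.2 (word v) := fun X Y => by
      rw [contract_tD_mul, ← twist_twist isMulAction_tActH]
      exact twist_apply (twist (sH k H A) (tActH k H A) (evalT k H A X) (tD k H A Y)) (word v)
        (Gen.inl k H A b)
    have h3 : ∀ ξ, sH k H A ξ (Gen.inl k H A b) = Gen.inl k H A (ξ • b) := fun ξ => sW_inl _ b
    simp only [h3] at h2
    have h4 : contract k H A (sig k H A X Y * word v) (Gen.inl k H A b) =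
        ∑ r ∈ legs (Rinv k H), tD k H A X * tA k H A (Y.1 (r.1 • b)) *
          tActH k H A r.2 (word v) := by
      simp only [sig_apply, Finset.sum_mul, map_sum, LinearMap.sum_apply, mul_assoc, h2]
      rw [Finset.sum_comm]
      refine Finset.sum_congr rfl fun r _ => ?_
      rw [← Finset.sum_mul, twist_sig, mul_assoc]
    have h5 := tBr_tD_mul_alg (tD k H A X * tD k H A Y) (word_mem v) b
    simp only [h1, sub_mul, Finset.sum_sub_distrib, mul_assoc (tD k H A X) (tD k H A Y)] at h5
    have h6 := swapZero_tD_tD_mul X Y (word v)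
    have h7 := tBrTail_tD_mul X Y (word v) b
    exact h5.trans (congrArg₂ (· + ·) h7.symm (congrArg (ksign 1 v.length • ·)
      (congrArg₂ (· - ·) ((congrArg (fun z => contract k H A z (Gen.inl k H A b)) h6).trans h4).symm
        (h2 X Y).symm)))

theorem swapZero_tBrTail {n : ℕ} {x : TensorAlg k H A} (hx : x ∈ words k H A (n + 2)) (b : A) :
    swapZero k H A (tBrTail k H A x (Gen.inl k H A b)) =
      tBrTail k H A (swapZero k H A x) (Gen.inl k H A b) := by
  refine words_ext (F := swapZero k H A ∘ₗ (tBrTail k H A).flip (Gen.inl k H A b))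
    (G := (tBrTail k H A).flip (Gen.inl k H A b) ∘ₗ swapZero k H A) (fun l hl => ?_) hx
  match l with
  | [] => simp at hl
  | [X] => simp at hl
  | X :: Y :: v =>
    simp only [LinearMap.comp_apply, LinearMap.flip_apply, word_cons, swapZero_tD_tD_mul,
      tBrTail_tD_mul, sig_apply, Finset.sum_mul, map_sum, mul_assoc]

/-- The bracket of a word of length one with `b` lies in `A`, outside the span of the empty word;
the factor `Y` in front absorbs it. -/
theorem tD_mul_tBr_alg_mem (Y : Der k H A) (l : List (Der k H A)) (b : A) :
    tD k H A Y * tBr k H A (word l) (Gen.inl k H A b) ∈ words k H A l.length := by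
  induction l generalizing Y with
  | nil => rw [word_nil, tBr_one, LinearMap.zero_apply, mul_zero]; exact zero_mem _
  | cons X l ih =>
    rw [word_cons, tBr_tD_mul_alg _ (word_mem l), mul_add, List.length_cons, add_comm l.length]
    refine add_mem (words_mul (tD_mem Y) (ih X)) ?_
    rw [mul_smul_comm, Finset.mul_sum]
    refine zsmul_mem (Submodule.sum_mem _ fun r _ => ?_) _
    rw [← mul_assoc, tBr_tD_inl]
    exact words_mul (words_mul_tA (n := 0) _ (tD_mem Y)) (tActH_mem (word_mem l) _)

theorem tBrTail_mem {n : ℕ} {x : TensorAlg k H A} (hx : x ∈ words k H A (n + 2)) (b : A) :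
    tBrTail k H A x (Gen.inl k H A b) ∈ words k H A (n + 1) := by
  refine words_induction (n := n + 2) (p := fun x => tBrTail k H A x (Gen.inl k H A b) ∈ words k H A (n + 1))
    (by simp) (fun x y hx hy => by rw [map_add]; exact add_mem hx hy)
    (fun c x hx => by rw [map_smul]; exact Submodule.smul_mem _ c hx) (fun l hl => ?_) x hx
  match l with
  | [] => simp at hl
  | [X] => simp at hl
  | X :: Y :: v =>
    obtain rfl : v.length = n := by simpa using hl
    rw [word_cons, word_cons, tBrTail_tD_mul, add_comm]
    exact words_mul (tD_mem X) (tD_mul_tBr_alg_mem Y v b)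

/-- With no factor after the first two, the tail contributes `⟦1, b⟧ = 0`. This case is separate
because the tail then has no two factors left to exchange. -/
theorem tBrTail_two {x : TensorAlg k H A} (hx : x ∈ words k H A 2) (b : A) :
    tBrTail k H A x (Gen.inl k H A b) = 0 := by
  refine words_ext (F := (tBrTail k H A).flip (Gen.inl k H A b)) (G := 0) (fun l hl => ?_) hx
  match l with
  | [] => simp at hl
  | [X] => simp at hl
  | X :: Y :: v =>
    obtain rfl : v = [] := by simpa using hl
    rw [LinearMap.flip_apply, word_cons, word_cons, tBrTail_tD_mul, word_nil, tBr_one]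
    simp

end Contraction

/-! ### The defining relations of multivector fields and the descent of the brackets with
generators. -/

section Relations
variable {k H A : Type*} [CommRing k] [Ring H] [HopfAlgebra k H] [Triangular k H] [Ring A]
  [Algebra k A] [Module H A] [IsScalarTower k H A] [ModuleAlgebra k H A]
  [BraidedCommutative k H A]

section
variable (k H A)

/-- The braided exchange of the factors in the positions `i` and `i + m + 1`. -/
noncomputable def exch (i m : ℕ) : TensorAlg k H A →ₗ[k] TensorAlg k H A :=
  moveRight k H A i (m + 1) ∘ₗ moveLeft k H A (i + 1) m

end

theorem list_split {α : Type*} (l : List α) {i j : ℕ} (hij : i < j) (hj : j < l.length) :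
    l = l.take i ++ ([l[i]] ++ ((l.take j).drop (i + 1) ++ ([l[j]] ++ l.drop (j + 1)))) := by
  have h1 : (l.take j).drop i = l[i] :: (l.take j).drop (i + 1) := by
    rw [List.drop_eq_getElem_cons (by rw [List.length_take]; omega)]
    simp
  have h2 : l.take i = (l.take j).take i := by rw [List.take_take, min_eq_left hij.le]
  rw [List.singleton_append, List.singleton_append, ← List.drop_eq_getElem_cons hj,
    ← List.cons_append, ← h1, h2, ← List.append_assoc, List.take_append_drop,
    List.take_append_drop]

/-- The `j`-th factor is first brought next to the `i`-th, with one `R⁻¹` for the block between;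
then the `i`-th factor is moved to the right across the resulting block of `m + 1` factors, with a
second `R⁻¹`. -/
theorem toTensorAlg_exchange {n : ℕ} (X : Fin n → Der k H A) (i j : Fin n) (hij : i < j) (m : ℕ)
    (hm : (j : ℕ) = i + m + 1) :
    toTensorAlg k H A (exchange X i j) = exch k H A i m (word (List.ofFn X)) := by
  have hs := list_split (List.ofFn X) (i := i) (j := j) hij (by simp)
  simp only [List.getElem_ofFn, Fin.eta] at hs
  have hu : word ((List.ofFn X).take i) ∈ words k H A i := by
    have := word_mem ((List.ofFn X).take i)
    rwa [List.length_take, List.length_ofFn, min_eq_left i.2.le] at this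
  have hz : word (((List.ofFn X).take j).drop (i + 1)) ∈ words k H A m := by
    have := word_mem (((List.ofFn X).take j).drop (i + 1))
    rwa [List.length_drop, List.length_take, List.length_ofFn, min_eq_left j.2.le,
      show (j : ℕ) - (i + 1) = m by omega] at this
  conv_rhs => rw [hs]
  simp only [exchange, map_mul, map_sum, toTensorAlg_tensor, toTensorAlg_diagonal, toTensorAlg_ι,
    ← derAct_apply, word_append, word_cons, word_nil, mul_one]
  generalize word ((List.ofFn X).take i) = u at *
  generalize word (((List.ofFn X).take j).drop (i + 1)) = z at *
  generalize word ((List.ofFn X).drop (j + 1)) = v at *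
  have h1 := moveLeft_mul (words_mul hu (tD_mem (X i))) hz (X j) v
  have h2 : ∀ r : H × H, moveRight k H A i (m + 1) (u * (tD k H A (X i) *
      (tD k H A (derAct k H A r.1 (X j)) * (tActH k H A r.2 z * v)))) =
      ∑ r' ∈ legs (Rinv k H), u * (tActH k H A r'.1 (tD k H A (derAct k H A r.1 (X j)) *
        tActH k H A r.2 z) * (tD k H A (derAct k H A r'.2 (X i)) * v)) := fun r => by
    have h := moveRight_mul (m := m + 1) hu
      (by rw [add_comm]; exact words_mul (tD_mem (derAct k H A r.1 (X j))) (tActH_mem hz r.2))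
      (X i) v
    rwa [mul_assoc (tD k H A (derAct k H A r.1 (X j)))] at h
  rw [exch, LinearMap.comp_apply, ← mul_assoc u, h1, map_sum]
  simp only [mul_assoc u, h2]
  rw [Finset.sum_comm, Finset.sum_mul, Finset.mul_sum]
  refine Finset.sum_congr rfl fun r' _ => ?_
  rw [Finset.sum_mul, Finset.sum_mul, Finset.mul_sum]
  exact Finset.sum_congr rfl fun r _ => by simp only [mul_assoc]

/-- Needed because the relations are formulated for finite sums of factorizing tensors rather than
for linear combinations. -/
theorem exists_eq_sum {n : ℕ} {x : TensorAlg k H A} (hx : x ∈ words k H A (n + 1)) :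
    ∃ (m : ℕ) (X : Fin m → Fin (n + 1) → Der k H A), x = ∑ s, word (List.ofFn (X s)) := by
  suffices h : ∃ L : List (Fin (n + 1) → Der k H A),
      x = (L.map fun X => word (List.ofFn X)).sum by
    obtain ⟨L, rfl⟩ := h
    refine ⟨L.length, fun s => L.get s, ?_⟩
    rw [← List.sum_ofFn]
    congr 1
    conv_lhs => rw [← List.ofFn_get L]
    rw [List.map_ofFn]
    rfl
  refine words_induction (n := n + 1) (p := fun x => ∃ L : List (Fin (n + 1) → Der k H A),
      x = (L.map fun X => word (List.ofFn X)).sum) ⟨[], rfl⟩ ?_ ?_ (fun l hl => ?_) x hx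
  · rintro _ _ ⟨L, rfl⟩ ⟨M, rfl⟩
    exact ⟨L ++ M, by simp⟩
  · rintro c _ ⟨L, rfl⟩
    -- The scalar is absorbed into the first factor, which exists since the length is positive.
    refine ⟨L.map fun X => Fin.cons (c • X 0) fun i => X i.succ, ?_⟩
    induction L with
    | nil => simp
    | cons X L ih =>
      rw [List.map_cons, List.map_cons, List.sum_cons, smul_add, ih, List.map_cons, List.sum_cons]
      simp [List.ofFn_succ]
  · refine ⟨[fun i => l.get (i.cast hl.symm)], ?_⟩
    rw [List.map_singleton, List.sum_singleton, ← List.ofFn_congr hl, List.ofFn_get]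

theorem wedgeRel_of_exch {i m n : ℕ} {x : TensorAlg k H A} (hx : x ∈ words k H A (i + m + 2 + n))
    (h : exch k H A i m x = x) : WedgeRel k H A x 0 := by
  obtain ⟨M, X, rfl⟩ := exists_eq_sum (n := i + m + 1 + n)
    (show x ∈ words k H A (i + m + 1 + n + 1) by convert hx using 2; omega)
  let a : Fin (i + m + 1 + n + 1) := ⟨i, by omega⟩
  let b : Fin (i + m + 1 + n + 1) := ⟨i + m + 1, by omega⟩
  have hab : a < b := Fin.mk_lt_mk.2 (by omega)
  have h1 : toTensorAlg k H A (∑ s, tensor (List.ofFn (X s))) = ∑ s, word (List.ofFn (X s)) := by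
    simp only [map_sum, toTensorAlg_tensor]
  have h2 : toTensorAlg k H A (∑ s, exchange (X s) a b) =
      exch k H A i m (∑ s, word (List.ofFn (X s))) := by
    simp only [map_sum]
    exact Finset.sum_congr rfl fun s _ => toTensorAlg_exchange (X s) a b hab m rfl
  rw [← h1]
  exact WedgeRel.mk a b hab X (by rw [h2, h, h1])

theorem WedgeRel.exists_exch {x y : TensorAlg k H A} (h : WedgeRel k H A x y) :
    y = 0 ∧ ∃ i m n, x ∈ words k H A (i + m + 2 + n) ∧ exch k H A i m x = x := by
  obtain @⟨N, M, i, j, hij, X, h⟩ := h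
  have hij' : (i : ℕ) < j := hij
  have hj := j.2
  refine ⟨rfl, i, j - i - 1, N - (i + (j - i - 1) + 2), ?_, ?_⟩
  · rw [show (i : ℕ) + (j - i - 1) + 2 + (N - (i + (j - i - 1) + 2)) = N by omega, map_sum]
    refine Submodule.sum_mem _ fun s _ => ?_
    rw [toTensorAlg_tensor]
    have := word_mem (List.ofFn (X s))
    rwa [List.length_ofFn] at this
  · refine Eq.trans ?_ h.symm
    rw [map_sum, map_sum, map_sum]
    refine Finset.sum_congr rfl fun s _ => ?_
    rw [toTensorAlg_tensor, toTensorAlg_exchange (X s) i j hij (j - i - 1) (by omega)]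

section
variable (k H A)

/-- The projection of the tensor algebra to the multivector fields. -/
noncomputable def tM : TensorAlg k H A →ₐ[k] MV k H A := RingQuot.mkAlgHom k (WedgeRel k H A)

end

theorem tM_surjective : Function.Surjective (tM k H A) := RingQuot.mkAlgHom_surjective k _

theorem tM_rel {x : TensorAlg k H A} (h : WedgeRel k H A x 0) : tM k H A x = 0 :=
  (RingQuot.mkAlgHom_rel k h).trans (map_zero _)

/-- The elements with the property form a two-sided ideal that contains the relations, so the
quotient map factors through the quotient by this ideal. -/
theorem ker_tM_induction {p : TensorAlg k H A → Prop} (h0 : p 0)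
    (hadd : ∀ {x y}, p x → p y → p (x + y))
    (hl : ∀ {x y}, p y → p (x * y)) (hr : ∀ {x y}, p x → p (x * y))
    (hrel : ∀ x, WedgeRel k H A x 0 → p x) {x : TensorAlg k H A} (hx : tM k H A x = 0) : p x := by
  let I : TwoSidedIdeal (TensorAlg k H A) := TwoSidedIdeal.mk' {x | p x} h0 hadd
    (fun {x} hx => by
      have h : -1 * x = -x := neg_one_mul x
      rw [← h]
      exact hl hx) hl hr
  have hI : ∀ x, x ∈ I ↔ p x := fun x => TwoSidedIdeal.mem_mk' _ _ _ _ _ _ x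
  let f : MV k H A →+* I.ringCon.Quotient := RingQuot.lift ⟨I.ringCon.mk', fun y z h => by
    obtain rfl : z = 0 := (WedgeRel.exists_exch h).1
    rw [map_zero]
    exact I.ringCon.eq.2 ((TwoSidedIdeal.mem_iff I y).1 ((hI y).2 (hrel y h)))⟩
  have h1 : f (tM k H A x) = I.ringCon.mk' x := by
    rw [tM, ← AlgHom.coe_toRingHom, RingQuot.mkAlgHom_coe]
    exact RingQuot.lift_mkRingHom_apply _ _ _
  rw [hx, map_zero] at h1
  exact (hI x).1 ((TwoSidedIdeal.mem_iff I x).2 (I.ringCon.eq.1 h1.symm))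

theorem exch_tActH (i m : ℕ) {n : ℕ} {x : TensorAlg k H A} (hx : x ∈ words k H A (i + m + 2 + n))
    (ξ : H) : exch k H A i m (tActH k H A ξ x) = tActH k H A ξ (exch k H A i m x) := by
  rw [exch, LinearMap.comp_apply, LinearMap.comp_apply, moveLeft_tActH (i + 1) m (by omega) hx,
    moveRight_tActH i (m + 1) (by omega) (moveLeft_mem (n := n) (by omega) hx)]

/-- Exchanges are equivariant, so an invariant tensor stays invariant under the action, and products
are treated by the coproduct. This is the existence of the induced action. -/
theorem tM_tAct {x : TensorAlg k H A} (hx : tM k H A x = 0) (ξ : Super H) :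
    tM k H A (tAct k H A ξ x) = 0 := by
  have hm : ∀ ξ x y, tAct k H A ξ (x * y) = _ := isMulAction_tAct (k := k) (H := H) (A := A)
  revert ξ
  refine ker_tM_induction (p := fun x => ∀ ξ, tM k H A (tAct k H A ξ x) = 0) (fun ξ => ?_)
    (fun hx hy ξ => ?_) (fun hx ξ => ?_) (fun hx ξ => ?_) (fun x h ξ => ?_) hx
  · rw [map_zero, map_zero]
  · rw [map_add, map_add, hx, hy, add_zero]
  · rw [hm, map_sum]
    exact Finset.sum_eq_zero fun p _ => by rw [map_mul, hx, mul_zero]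
  · rw [hm, map_sum]
    exact Finset.sum_eq_zero fun p _ => by rw [map_mul, hx, zero_mul]
  · obtain ⟨-, i, m, n, hx, h⟩ := h.exists_exch
    rw [tAct_words hx]
    exact tM_rel (wedgeRel_of_exch (tActH_mem hx _) (by rw [exch_tActH i m hx, h]))

theorem tM_eq_zero_of_swapZero {n : ℕ} {x : TensorAlg k H A} (hx : x ∈ words k H A (n + 2))
    (h : swapZero k H A x = x) : tM k H A x = 0 := by
  refine tM_rel (wedgeRel_of_exch (i := 0) (m := 0) (n := n) (by convert hx using 2; omega) ?_)
  rw [exch, LinearMap.comp_apply]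
  simpa [moveLeft, moveRight, swap_zero] using h

/-- The elements whose class and whose brackets with all generators vanish. -/
def NullBr (x : TensorAlg k H A) : Prop :=
  tM k H A x = 0 ∧ ∀ w, tM k H A (tBr k H A x w) = 0

theorem NullBr.zero : NullBr (0 : TensorAlg k H A) := ⟨map_zero _, fun w => by simp⟩

theorem NullBr.add {x y : TensorAlg k H A} (hx : NullBr x) (hy : NullBr y) : NullBr (x + y) :=
  ⟨by rw [map_add, hx.1, hy.1, add_zero],
    fun w => by rw [map_add, LinearMap.add_apply, map_add, hx.2, hy.2, add_zero]⟩

theorem NullBr.mul_left {x : TensorAlg k H A} (hx : NullBr x) (y : TensorAlg k H A) :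
    NullBr (y * x) := by
  refine ⟨by rw [map_mul, hx.1, mul_zero], fun w => ?_⟩
  rw [tBr_mul_apply, map_add, map_mul, hx.2, mul_zero, zero_add, map_sum]
  exact Finset.sum_eq_zero fun r _ => by rw [map_mul, tM_tAct hx.1, mul_zero]

theorem NullBr.neg {x : TensorAlg k H A} (hx : NullBr x) : NullBr (-x) := by
  have h : -1 * x = -x := neg_one_mul x
  rw [← h]
  exact hx.mul_left _

theorem NullBr.mul_right {x : TensorAlg k H A} (hx : NullBr x) (y : TensorAlg k H A) :
    NullBr (x * y) := by
  refine ⟨by rw [map_mul, hx.1, zero_mul], fun w => ?_⟩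
  rw [tBr_mul_apply, map_add, map_mul, hx.1, zero_mul, zero_add, map_sum]
  exact Finset.sum_eq_zero fun r _ => by rw [map_mul, hx.2, zero_mul]

/-- The core of the descent: each bracket of a tensor invariant in its first two factors is either
again such a tensor or zero. -/
theorem NullBr.of_swapZero {n : ℕ} {x : TensorAlg k H A} (hx : x ∈ words k H A (n + 2))
    (h : swapZero k H A x = x) : NullBr x := by
  refine ⟨tM_eq_zero_of_swapZero hx h, fun w => ?_⟩
  rw [Gen.eq_add w, map_add, map_add]
  have h1 : tM k H A (tBr k H A x (Gen.inr k H A (Gen.snd k H A w))) = 0 :=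
    tM_eq_zero_of_swapZero (tBr_der_mem hx _) (by rw [swapZero_tBr_der hx, h])
  -- Invariance makes the two contractions equal, and only the bracket on the factors after the
  -- second is left.
  rw [h1, add_zero, tBr_alg hx, h, sub_self]
  refine (congrArg _ ((congrArg (_ + ·) (smul_zero _)).trans (add_zero _))).trans ?_
  cases n with
  | zero => rw [tBrTail_two hx, map_zero]
  | succ n =>
    exact tM_eq_zero_of_swapZero (n := n) (tBrTail_mem hx _) (by rw [swapZero_tBrTail hx, h])

/-- The exchange is an involution, so this sum is invariant. -/
theorem NullBr.mul_add_sig (X Y : Der k H A) :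
    NullBr (tD k H A X * tD k H A Y + sig k H A X Y) := by
  refine NullBr.of_swapZero (n := 0)
    (add_mem (words_mul (n := 1) (m := 1) (tD_mem X) (tD_mem Y)) (sig_mem X Y)) ?_
  rw [map_add, swapZero_sig, ← mul_one (tD k H A Y), swapZero_tD_tD_mul, mul_one, mul_one, add_comm]

theorem NullBr.add_swap {p n : ℕ} {x : TensorAlg k H A} (hx : x ∈ words k H A (p + 2 + n)) :
    NullBr (x + swap k H A p x) := by
  refine words_induction (n := p + 2 + n) (p := fun x => NullBr (x + swap k H A p x))
    (by rw [map_zero, add_zero]; exact .zero) (fun x y hx hy => ?_) (fun c x hx => ?_)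
    (fun l hl => ?_) x hx
  · rw [map_add, add_add_add_comm]; exact hx.add hy
  · rw [map_smul, ← smul_add, Algebra.smul_def]; exact hx.mul_left _
  · have hu : (l.take p).length = p := by rw [List.length_take]; omega
    have hs : l = l.take p ++ l.drop p := (List.take_append_drop p l).symm
    have hd : (l.drop p).length = 2 + n := by rw [List.length_drop]; omega
    generalize l.take p = u at *
    generalize l.drop p = v at *
    subst hs
    match v with
    | [] => simp at hd; omega
    | [X] => simp at hd; omega
    | X :: Y :: v =>
      have hu' : word u ∈ words k H A p := hu ▸ word_mem u
      rw [word_append, swap_mul hu', word_cons, word_cons, swapZero_tD_tD_mul, ← mul_add,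
        ← mul_assoc, ← add_mul]
      exact ((NullBr.mul_add_sig X Y).mul_right _).mul_left _

/-- By `NullBr.add_swap` adjacent exchanges act as `-1` modulo null tensors, so nullity may be
tested after rearranging the factors. -/
theorem NullBr.of_swap {p n : ℕ} {x : TensorAlg k H A} (hx : x ∈ words k H A (p + 2 + n))
    (h : NullBr (swap k H A p x)) : NullBr x := by
  have := (NullBr.add_swap hx).add h.neg
  rwa [add_neg_cancel_right] at this

theorem NullBr.of_moveLeft {p m n N : ℕ} (hN : p + m + 1 + n = N) {x : TensorAlg k H A}
    (hx : x ∈ words k H A N) (h : NullBr (moveLeft k H A p m x)) : NullBr x := by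
  induction m generalizing p with
  | zero => exact h
  | succ m ih =>
    refine ih (p := p + 1) (by omega) (NullBr.of_swap (p := p) (n := m + n) ?_ h)
    convert moveLeft_mem (p := p + 1) (m := m) (n := n) (by omega) hx using 2
    omega

section
variable (k H A)

/-- The move of the factors in the positions `i` and `i + 1` to the front. -/
noncomputable def moveTwo (i : ℕ) : TensorAlg k H A →ₗ[k] TensorAlg k H A :=
  moveLeft k H A 1 i ∘ₗ moveLeft k H A 0 i

end

theorem moveTwo_mul {i : ℕ} {u : TensorAlg k H A} (hu : u ∈ words k H A i) (X Y : Der k H A)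
    (v : TensorAlg k H A) : moveTwo k H A i (u * (tD k H A X * tD k H A Y * v)) =
      ∑ r ∈ legs (Rinv k H), tActH k H A r.1 (tD k H A X * tD k H A Y) *
        (tActH k H A r.2 u * v) := by
  have hm : ∀ ξ x y, tActH k H A ξ (x * y) = _ := isMulAction_tActH (k := k) (H := H) (A := A)
  have h1 := moveLeft_mul (p := 0) (u := 1) (word_mem []) hu X (tD k H A Y * v)
  have h2 : ∀ r : H × H, moveLeft k H A 1 i (tD k H A (derAct k H A r.1 X) *
      (tActH k H A r.2 u * (tD k H A Y * v))) = _ := fun r =>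
    moveLeft_mul (tD_mem (derAct k H A r.1 X)) (tActH_mem hu r.2) Y v
  have h3 := legs_hexL (derAct k H A) (derAct k H A) (tActH k H A)
    (fun X Y u => tD k H A X * (tD k H A Y * (u * v))) X Y u
  simp only [one_mul] at h1
  rw [moveTwo, LinearMap.comp_apply, mul_assoc, h1, map_sum]
  simp only [h2, hm, Finset.sum_mul, mul_assoc, tActH_tD]
  rw [Finset.sum_comm]
  exact h3.symm

/-- Moving the pair across the `i` factors in front acts on the pair as a whole, and the action
commutes with the exchange inside the pair. -/
theorem moveTwo_swap {i n : ℕ} {x : TensorAlg k H A} (hx : x ∈ words k H A (i + 2 + n)) :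
    moveTwo k H A i (swap k H A i x) = swapZero k H A (moveTwo k H A i x) := by
  refine words_ext (F := moveTwo k H A i ∘ₗ swap k H A i) (G := swapZero k H A ∘ₗ moveTwo k H A i)
    (fun l hl => ?_) hx
  have hu : (l.take i).length = i := by rw [List.length_take]; omega
  have hs : l = l.take i ++ l.drop i := (List.take_append_drop i l).symm
  have hd : (l.drop i).length = 2 + n := by rw [List.length_drop]; omega
  generalize l.take i = u at *
  generalize l.drop i = v at *
  subst hs
  match v with
  | [] => simp at hd; omega
  | [X] => simp at hd; omega
  | X :: Y :: v =>
    have hu' : word u ∈ words k H A i := hu ▸ word_mem u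
    have hXY : tD k H A X * tD k H A Y ∈ words k H A (0 + 2) :=
      words_mul (n := 1) (m := 1) (tD_mem X) (tD_mem Y)
    have h1 : swapZero k H A (tD k H A X * tD k H A Y) = sig k H A X Y := by
      rw [← mul_one (tD k H A Y), swapZero_tD_tD_mul, mul_one]
    have h2 : ∀ ξ, swapZero k H A (tActH k H A ξ (tD k H A X * tD k H A Y)) =
        tActH k H A ξ (sig k H A X Y) := fun ξ => by
      have := swap_tActH 0 hXY ξ
      rwa [swap_zero, h1] at this
    rw [LinearMap.comp_apply, LinearMap.comp_apply, word_append, swap_mul hu', word_cons, word_cons,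
      swapZero_tD_tD_mul, ← mul_assoc (tD k H A X), moveTwo_mul hu', map_sum]
    simp only [swapZero_mul (tActH_mem hXY _), h2]
    simp only [sig_apply, Finset.sum_mul, Finset.mul_sum, map_sum, moveTwo_mul hu']
    exact Finset.sum_comm

/-- The exchange at distance is conjugate to an adjacent one. The rearranged tensor is therefore
invariant under `swap i`, and after the pair has been moved to the front it is invariant under the
exchange of the first two factors. No division by 2 is needed. -/
theorem NullBr.of_exch {i m n : ℕ} {x : TensorAlg k H A} (hx : x ∈ words k H A (i + m + 2 + n))
    (h : exch k H A i m x = x) : NullBr x := by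
  have hy := moveLeft_mem (p := i + 1) (m := m) (n := n) (by omega) hx
  refine NullBr.of_moveLeft (p := i + 1) (m := m) (n := n) (by omega) hx ?_
  -- `exch` is `swap i` between `moveLeft (i + 1) m` and its inverse `moveRight (i + 1) m`; applying
  -- `moveLeft` to `exch x = x` cancels the latter.
  have h1 : swap k H A i (moveLeft k H A (i + 1) m x) = moveLeft k H A (i + 1) m x := by
    have hs : swap k H A i (moveLeft k H A (i + 1) m x) ∈ words k H A (i + m + 2 + n) := by
      have := swap_mem (p := i) (n := m + n)
        (x := moveLeft k H A (i + 1) m x) (by convert hy using 2; omega)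
      convert this using 2; omega
    have h2 := moveLeft_moveRight (p := i + 1) (m := m) (n := n) (by omega) hs
    rw [← h2]
    exact congrArg _ h
  generalize moveLeft k H A (i + 1) m x = y at *
  have h0 := moveLeft_mem (p := 0) (m := i) (n := 1 + m + n) (by omega) hy
  have h01 := moveLeft_mem (p := 1) (m := i) (n := m + n) (by omega) h0
  refine NullBr.of_moveLeft (p := 0) (m := i) (n := 1 + m + n) (by omega) hy ?_
  refine NullBr.of_moveLeft (p := 1) (m := i) (n := m + n) (by omega) h0 ?_
  refine NullBr.of_swapZero (n := i + m + n) (by convert h01 using 2; omega) ?_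
  have := moveTwo_swap (i := i) (n := m + n) (x := y) (by convert hy using 2; omega)
  rw [h1] at this
  exact this.symm

theorem nullBr_of_tM {x : TensorAlg k H A} (hx : tM k H A x = 0) : NullBr x :=
  ker_tM_induction .zero (fun hx hy => hx.add hy) (fun hx => hx.mul_left _)
    (fun hx => hx.mul_right _)
    (fun x h => by obtain ⟨-, i, m, n, hx, h⟩ := h.exists_exch; exact .of_exch hx h) hx

end Relations

/-! ### Parity shifts in sums over legs, and uniqueness of the adjoint action. -/

section ShiftLegs
variable {k H V W P : Type*} [CommRing k] [Ring H] [HopfAlgebra k H]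
  [AddCommGroup V] [Module k V] [AddCommGroup W] [Module k W] [AddCommGroup P] [Module k P]
  (ρ₁ : Super H →ₐ[k] Module.End k V) (ρ₂ : Super H →ₐ[k] Module.End k W)

theorem legs_comul_shift_left (f : V → W → P) (ξ : Super H) (v : V) (w : W)
    (hf : Bilin k f := by
      constructor <;> intros <;> simp [add_mul, mul_add, Finset.sum_add_distrib, Finset.smul_sum]) :
    ∑ p ∈ legs (comul (R := k) (Super.shift k ξ)), f (ρ₁ p.1 v) (ρ₂ p.2 w) =
      ∑ p ∈ legs (comul (R := k) ξ), f (ρ₁ (Super.shift k p.1) v) (ρ₂ p.2 w) := by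
  rw [sum_legs_eq ρ₁ ρ₂ f (hf := hf), Super.comul_shift]
  conv_lhs => rw [← sum_legs (comul (R := k) ξ)]
  simp

theorem legs_comul_shift_right (f : V → W → P) (ξ : Super H) (v : V) (w : W)
    (hf : Bilin k f := by
      constructor <;> intros <;> simp [add_mul, mul_add, Finset.sum_add_distrib, Finset.smul_sum]) :
    ∑ p ∈ legs (comul (R := k) (Super.shift k ξ)), f (ρ₁ p.1 v) (ρ₂ p.2 w) =
      ∑ p ∈ legs (comul (R := k) ξ), f (ρ₁ p.1 v) (ρ₂ (Super.shift k p.2) w) := by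
  rw [sum_legs_eq ρ₁ ρ₂ f (hf := hf), Super.comul_shift']
  conv_lhs => rw [← sum_legs (comul (R := k) ξ)]
  simp

variable [Triangular k H]

theorem legs_Rinv_shift_left (f : V → W → P) (v : V) (w : W)
    (hf : Bilin k f := by
      constructor <;> intros <;> simp [add_mul, mul_add, Finset.sum_add_distrib, Finset.smul_sum]) :
    ∑ r ∈ legs (Rinv k (Super H)), f (ρ₁ (Super.shift k r.1) v) (ρ₂ r.2 w) =
      ∑ r ∈ legs (Rinv k (Super H)), f (ρ₁ r.1 v) (ρ₂ r.2 (ρ₂ Super.par w)) := by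
  have h := congrArg (ev2 ρ₁ ρ₂ hf.toLin v w) (Super.map_shift_left_Rinv (k := k) (H := H))
  rw [← sum_legs (Rinv k (Super H))] at h
  simp only [map_sum, TensorProduct.map_tmul, Finset.mul_sum,
    Algebra.TensorProduct.tmul_mul_tmul, one_mul, Super.par_mul] at h
  simpa using h

end ShiftLegs

section AdjUnique
open WithConv
variable {k H A : Type*} [CommRing k] [Ring H] [HopfAlgebra k H] [Ring A] [Algebra k A]
  [Module H A] [IsScalarTower k H A]

/-- The hypothesis says `l * c = D * l` in the convolution algebra, and `l` has the right inverse
`s` given by the antipode. The adjoint action of a concrete operator can thus be found without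
computing antipodes. -/
theorem adj_eq_of_smul_apply {X : Module.End k A} (D : H →ₗ[k] Module.End k A)
    (h : ∀ ξ a, ξ • X a = ∑ p ∈ legs (comul (R := k) ξ), D p.1 (p.2 • a)) (ξ : H) :
    adj k H A ξ X = D ξ := by
  let l := toConv (opr k H A).toLinearMap
  let s := toConv ((opr k H A).toLinearMap ∘ₗ antipode k)
  let c := toConv ((counit (R := k) (A := H)).smulRight X)
  have h1 : l * c = toConv D * l := by
    ext ξ a
    rw [conv_const_right, conv_apply_legs]
    simpa [l, LinearMap.sum_apply] using h ξ a
  have h2 : l * s = 1 := opr_conv_antipode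
  have h3 : l * (c * s) = toConv D := by rw [← mul_assoc, h1, mul_assoc, h2, mul_one]
  rw [adj_eq_conv]
  exact congrArg (fun f => f ξ) h3

end AdjUnique

/-! ### From derivations in the first argument to braided derivations in the second. -/

section RightDerivation
variable {k H M N : Type*} [CommRing k] [Ring H] [HopfAlgebra k H] [Triangular k H]
  [Ring M] [Algebra k M] [Module (Super H) M] [IsScalarTower k (Super H) M]

section
variable (k H M)

/-- The action with shifted parities. -/
noncomputable def sM : Super H →ₐ[k] Module.End k M :=
  (opr k (Super H) M).comp (Super.shift k)

end

theorem sM_apply (ξ : Super H) (z : M) : sM k H M ξ z = Super.shift k ξ • z := rfl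

variable [AddCommGroup N] [Module k N]

/-- Equivariant right derivations in the first variable. -/
structure IsRightDer (ρ : Super H →ₐ[k] Module.End k N) (d : M →ₗ[k] N →ₗ[k] M) : Prop where
  map_mul : ∀ x y n, d (x * y) n =
    x * d y n + ∑ r ∈ legs (Rinv k (Super H)), d x (ρ r.1 n) * (r.2 • y)
  smul_apply : ∀ (ξ : Super H) x n, ξ • d x n =
    ∑ p ∈ legs (comul (R := k) ξ), d (p.1 • x) (ρ p.2 n)

/-- The map `n ↦ (z ↦ -d (R₁⁻¹ ▷ z) (R₂⁻¹ ▷ n))`. -/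
noncomputable def flipDer (ρ : Super H →ₐ[k] Module.End k N) (d : M →ₗ[k] N →ₗ[k] M) :
    N →ₗ[k] Module.End k M :=
  LinearMap.mk₂ k (fun n z => -∑ r ∈ legs (Rinv k (Super H)), d (sM k H M r.1 z) (ρ r.2 n))
    (fun n n' z => by simp only [map_add, Finset.sum_add_distrib, neg_add])
    (fun c n z => by simp only [map_smul, ← Finset.smul_sum, smul_neg])
    (fun n z z' => by
      simp only [map_add, LinearMap.add_apply, Finset.sum_add_distrib, neg_add])
    (fun c n z => by simp only [map_smul, LinearMap.smul_apply, ← Finset.smul_sum, smul_neg])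

variable {ρ : Super H →ₐ[k] Module.End k N} {d : M →ₗ[k] N →ₗ[k] M}

theorem flipDer_apply (n : N) (z : M) : flipDer ρ d n z =
    -∑ r ∈ legs (Rinv k (Super H)), d (sM k H M r.1 z) (ρ r.2 n) := rfl

/-- The bracket is odd: the parity shift sits on its second argument before the flip and again after
it. The shift can be transferred between the legs of a coproduct. -/
theorem smul_flipDer (hd : IsRightDer ρ d) (ξ : Super H) (n : N) (z : M) :
    ξ • flipDer ρ d n z =
      ∑ p ∈ legs (comul (R := k) ξ), flipDer ρ d (ρ p.1 n) (p.2 • z) := by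
  have h1 := fun r : Super H × Super H => legs_comul_shift_left (opr k (Super H) M) ρ
    (fun z n => d z n) (Super.shift k ξ) (sM k H M r.1 z) (ρ r.2 n)
  have h2 := legs_comul_Rinv (sM k H M) ρ (fun z n => d z n) (Super.shift k ξ) z n
  have h3 := legs_comul_shift_right ρ (opr k (Super H) M) (fun n z => flipDer ρ d n z)
    (Super.shift k ξ) n z
  simp only [Super.shift_shift, Algebra.lsmul_coe, ← sM_apply] at h1 h3
  rw [h3, flipDer_apply, smul_neg, Finset.smul_sum]
  simp only [hd.smul_apply, h1, h2, flipDer_apply, Finset.sum_neg_distrib]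

theorem adj_flipDer (hd : IsRightDer ρ d) (ξ : Super H) (n : N) :
    adj k (Super H) M ξ (flipDer ρ d n) = flipDer ρ d (ρ ξ n) :=
  adj_eq_of_smul_apply (flipDer ρ d ∘ₗ ρ.toLinearMap.flip n) (fun ξ z => smul_flipDer hd ξ n z) ξ

/-- Leibniz in the first argument turns into the braided Leibniz rule after the flip. The hexagon
splits the crossing of `n` with `xy`. In the term with `y` on the right, the crossing of `n` with
`y` cancels against the one in the Leibniz rule of `d`. -/
theorem flipDer_mem [ModuleAlgebra k (Super H) M] (hd : IsRightDer ρ d) (n : N) :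
    flipDer ρ d n ∈ Der k (Super H) M := by
  rw [mem_Der]
  intro x y
  let F : M → M → N → M := fun x y n => x * d y n
  let G : M → M → N → M := fun x y n => ∑ r ∈ legs (Rinv k (Super H)),
    d x (ρ r.1 n) * opr k (Super H) M r.2 y
  have h0 : ∀ r : Super H × Super H, d (sM k H M r.1 (x * y)) (ρ r.2 n) =
      ∑ p ∈ legs (comul (R := k) r.1), F (p.1 • x) (sM k H M p.2 y) (ρ r.2 n) +
      ∑ p ∈ legs (comul (R := k) r.1), G (sM k H M p.1 x) (p.2 • y) (ρ r.2 n) := fun r => by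
    have h1 := legs_comul_shift_right (opr k (Super H) M) (opr k (Super H) M)
      (fun x y => F x y (ρ r.2 n)) r.1 x y
      (by constructor <;> intros <;> simp [F, add_mul, mul_add])
    have h2 := legs_comul_shift_left (opr k (Super H) M) (opr k (Super H) M)
      (fun x y => G x y (ρ r.2 n)) r.1 x y
      (by
        constructor <;> intros <;>
          simp [G, -Algebra.lsmul_coe, add_mul, mul_add, Finset.sum_add_distrib, Finset.smul_sum])
    simp only [Algebra.lsmul_coe, ← sM_apply] at h1 h2
    rw [sM_apply, ModuleAlgebra.smul_mul (k := k), map_sum, LinearMap.sum_apply, ← h1, ← h2,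
      ← Finset.sum_add_distrib]
    exact Finset.sum_congr rfl fun p _ => hd.map_mul _ _ _
  have h1 := legs_hexL (opr k (Super H) M) (sM k H M) ρ F x y n
    (by constructor <;> intros <;> simp [F, add_mul, mul_add])
  have h2 := legs_hexL (sM k H M) (opr k (Super H) M) ρ G x y n
    (by
        constructor <;> intros <;>
          simp [G, -Algebra.lsmul_coe, add_mul, mul_add, Finset.sum_add_distrib, Finset.smul_sum])
  have h3 := fun s : Super H × Super H => legs_Rinv_flip ρ (opr k (Super H) M)
    (fun n y => d (sM k H M s.1 x) n * y) (ρ s.2 n) y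
  simp only [Algebra.lsmul_coe] at h1 h2 h3
  simp only [adj_flipDer hd, flipDer_apply, h0, Finset.sum_add_distrib, h1, h2, neg_add, neg_mul,
    mul_neg, Finset.sum_neg_distrib, Finset.sum_mul]
  rw [add_comm]
  congr 2
  · simp only [G, Algebra.lsmul_coe]
    rw [Finset.sum_comm]
    exact Finset.sum_congr rfl fun s _ => h3 s
  · simp only [F, Finset.mul_sum]
    rw [Finset.sum_comm]

/-- Removing the shift from the first leg of `R⁻¹` puts the parity operator on `x`, and what remains
is the right action of that element on the braided derivation `D`. -/
theorem twist_mem [ModuleAlgebra k (Super H) M] [BraidedCommutative k (Super H) M]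
    {D : Module.End k M} (hD : D ∈ Der k (Super H) M) (x : M) :
    twist (sM k H M) (opr k (Super H) M) D x ∈ Der k (Super H) M := by
  convert (Der.ract ⟨D, hD⟩ ((Super.par : Super H) • x)).2
  refine LinearMap.ext fun z => ?_
  rw [twist_apply, ract_apply]
  exact legs_Rinv_shift_left (opr k (Super H) M) (opr k (Super H) M) (fun z x => D z * x) z x

end RightDerivation

section GeneratorSkew
variable {k H A : Type*} [CommRing k] [Ring H] [HopfAlgebra k H] [Triangular k H] [Ring A]
  [Algebra k A] [Module H A] [IsScalarTower k H A] [ModuleAlgebra k H A]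
  [BraidedCommutative k H A]

section
variable (k H A)

/-- The generators as elements of the tensor algebra. -/
noncomputable def tG : Gen k H A →ₗ[k] TensorAlg k H A :=
  (tA k H A).toLinearMap ∘ₗ Gen.fst k H A + tD k H A ∘ₗ Gen.snd k H A

end

theorem tG_apply (w : Gen k H A) :
    tG k H A w = tA k H A (Gen.fst k H A w) + tD k H A (Gen.snd k H A w) := rfl

theorem tG_inl (a : A) : tG k H A (Gen.inl k H A a) = tA k H A a := by simp [tG_apply]
theorem tG_inr (X : Der k H A) : tG k H A (Gen.inr k H A X) = tD k H A X := by simp [tG_apply]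

theorem tAct_tG (ξ : Super H) (w : Gen k H A) :
    tAct k H A (Super.shift k ξ) (tG k H A w) = tG k H A (sW k H A ξ w) := by
  simp only [tG_apply, map_add, tAct_tA, tAct_tD, fst_sW, snd_sW, Super.ev_shift, zero_add,
    show (1 + 1 : ZMod 2) = 0 from rfl]

theorem tBr_tG (u w : Gen k H A) : tBr k H A (tG k H A u) w =
    tA k H A (algDer k H A (Gen.fst k H A u) (Gen.snd k H A w)) +
      (tA k H A ((Gen.snd k H A u).1 (Gen.fst k H A w)) +
        tD k H A (Der.bracket (Gen.snd k H A u) (Gen.snd k H A w))) := by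
  rw [tG_apply, map_add, LinearMap.add_apply, tBr_tA, tBr_tD, brA_apply, brD_apply]

/-- The mixed brackets are related by the definition of `algDer` and its inverse formula, and the
brackets of derivations by skew symmetry of the commutator. In shifted parities at most one entry of
each nonzero bracket is odd, so no signs enter. -/
theorem tBr_tG_skew (u w : Gen k H A) : tBr k H A (tG k H A u) w =
    -∑ r ∈ legs (Rinv k (Super H)), tBr k H A (tG k H A (sW k H A r.1 w)) (sW k H A r.2 u) := by
  have h1 := legs_ev_Rinv (opr k H A) (derAct k H A) (fun a Y => algDer k H A a Y) 1 0
    (Gen.fst k H A w) (Gen.snd k H A u)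
  have h2 := legs_ev_Rinv (derAct k H A) (opr k H A) (fun Y a => evalL k H A Y a) 0 1
    (Gen.snd k H A w) (Gen.fst k H A u)
  have h3 := legs_ev_Rinv (derAct k H A) (derAct k H A) (fun X Y => bracketL k H A X Y) 0 0
    (Gen.snd k H A w) (Gen.snd k H A u)
  simp only [Algebra.lsmul_coe, evalL_apply, bracketL_apply, ksign_zero_left, ksign_zero_right,
    one_smul] at h1 h2 h3
  simp only [tBr_tG, fst_sW, snd_sW, Finset.sum_add_distrib, ← map_sum, h1, h2, h3]
  rw [bracket_skew (Gen.snd k H A u), eval_eq_algDer (Gen.snd k H A u), algDer_apply]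
  have h4 : ∀ X : Der k H A, tD k H A (-X) = -tD k H A X := fun X =>
    eq_neg_of_add_eq_zero_left ((map_add (tD k H A) (-X) X).symm.trans
      ((congrArg (tD k H A) (neg_add_cancel X)).trans (map_zero _)))
  simp only [map_neg, h4]
  abel

end GeneratorSkew

/-! ### Construction of the bracket on a quotient of the tensor algebra. -/

section Model
variable {k H A : Type*} [CommRing k] [Ring H] [HopfAlgebra k H] [Triangular k H] [Ring A]
  [Algebra k A] [Module H A] [IsScalarTower k H A] [ModuleAlgebra k H A]
  [BraidedCommutative k H A] {M : Type*}
  [Ring M] [Algebra k M] [Module (Super H) M] [IsScalarTower k (Super H) M]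

/-- An equivariant quotient `M` of the tensor algebra to which the brackets with generators
descend, and in which the braided derivations anticommute. -/
structure IsModel (q : TensorAlg k H A →ₐ[k] M) (b : M →ₗ[k] Gen k H A →ₗ[k] M) : Prop where
  surjective : Function.Surjective q
  smul_map : ∀ (ξ : Super H) x, ξ • q x = q (tAct k H A ξ x)
  br_map : ∀ x w, b (q x) w = q (tBr k H A x w)
  map_sig : ∀ X Y, q (tD k H A X * tD k H A Y) = -q (sig k H A X Y)

namespace IsModel

variable {q : TensorAlg k H A →ₐ[k] M} {b : M →ₗ[k] Gen k H A →ₗ[k] M}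

theorem moduleAlgebra (h : IsModel q b) : ModuleAlgebra k (Super H) M where
  smul_mul ξ x y := by
    have hm : ∀ ξ x y, tAct k H A ξ (x * y) = _ := isMulAction_tAct (k := k) (H := H) (A := A)
    obtain ⟨x, rfl⟩ := h.surjective x
    obtain ⟨y, rfl⟩ := h.surjective y
    rw [← map_mul, h.smul_map, hm, map_sum]
    simp only [h.smul_map, map_mul]
  smul_one ξ := by
    rw [← map_one q, h.smul_map, tAct_one, map_smul]

theorem isMulAction_opr [ModuleAlgebra k (Super H) M] : IsMulAction (opr k (Super H) M) :=
  fun ξ x y => ModuleAlgebra.smul_mul ξ x y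

/-- For two odd derivations the Koszul sign of `Super H` turns anticommutation into braided
commutation. The hexagons extend this from generators to all products, first in one argument and
then in the other. -/
theorem braidedCommutative (h : IsModel q b) : BraidedCommutative k (Super H) M where
  mul_comm x y := by
    have := h.moduleAlgebra
    have hA : ∀ (x : M) (a : A), BraidedComm (opr k (Super H) M) x (q (tA k H A a)) := fun x a => by
      obtain ⟨x, rfl⟩ := h.surjective x
      have := congrArg q (braidedComm_tA x a)
      rw [map_mul, map_sum] at this
      simpa only [BraidedComm, Algebra.lsmul_coe, h.smul_map, map_mul] using this
    have hDD : ∀ X Y, BraidedComm (opr k (Super H) M) (q (tD k H A X)) (q (tD k H A Y)) := by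
      intro X Y
      have h1 := legs_ev_Rinv (derAct k H A) (derAct k H A) (fun Y X => tD k H A Y * tD k H A X)
        1 1 Y X
      simp only [BraidedComm, Algebra.lsmul_coe, h.smul_map, tAct_tD, ← map_mul, ← map_sum, h1]
      rw [← sig_apply, h.map_sig, show ksign 1 1 = -1 from rfl, neg_one_zsmul, map_neg]
    have hD : ∀ (x : M) (Y : Der k H A),
        BraidedComm (opr k (Super H) M) x (q (tD k H A Y)) := fun x => by
      obtain ⟨x, rfl⟩ := h.surjective x
      induction x using tInduction with
      | hadd x y hx hy => exact fun Y => by rw [map_add]; exact (hx Y).add_left (hy Y)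
      | hA a =>
        refine fun Y => .symm fun ξ η => ?_
        simp only [Algebra.lsmul_coe, h.smul_map (x := tA k H A a), tAct_tA]
        exact hA _ _
      | hmulA a x hx =>
        intro Y
        rw [map_mul]
        refine .mul_left isMulAction_opr (fun ξ => .symm fun ξ η => ?_) (hx Y)
        simp only [Algebra.lsmul_coe, h.smul_map (x := tA k H A a), tAct_tA]
        exact hA _ _
      | hmulD X x hx =>
        intro Y
        rw [map_mul]
        refine .mul_left isMulAction_opr (fun ξ => ?_) (hx Y)
        simp only [Algebra.lsmul_coe, h.smul_map, tAct_tD]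
        exact hDD _ _
    have key : ∀ y x : M, BraidedComm (opr k (Super H) M) y x := fun y x => by
      obtain ⟨x, rfl⟩ := h.surjective x
      revert y
      induction x using tInduction with
      | hadd x y hx hy => exact fun z => by rw [map_add]; exact (hx z).add_right (hy z)
      | hA a => exact fun y => hA y a
      | hmulA a x hx =>
        intro y
        rw [map_mul]
        exact .mul_right isMulAction_opr (hA y a) fun ξ => hx _
      | hmulD X x hx =>
        intro y
        rw [map_mul]
        exact .mul_right isMulAction_opr (hD y X) fun ξ => hx _
    exact key y x

/-- The generators as elements of `M`. -/
noncomputable def gen (_ : IsModel q b) : Gen k H A →ₗ[k] M := q.toLinearMap ∘ₗ tG k H A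

theorem gen_apply (h : IsModel q b) (w : Gen k H A) : h.gen w = q (tG k H A w) := rfl

theorem sM_gen (h : IsModel q b) (ξ : Super H) (w : Gen k H A) :
    sM k H M ξ (h.gen w) = h.gen (sW k H A ξ w) := by
  rw [sM_apply, gen_apply, h.smul_map, tAct_tG, gen_apply]

theorem smul_gen (h : IsModel q b) (ξ : Super H) (w : Gen k H A) :
    ξ • h.gen w = h.gen (sW k H A (Super.shift k ξ) w) := by
  rw [← h.sM_gen, sM_apply, Super.shift_shift]

theorem isRightDer (h : IsModel q b) : IsRightDer (sW k H A) b where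
  map_mul x y n := by
    obtain ⟨x, rfl⟩ := h.surjective x
    obtain ⟨y, rfl⟩ := h.surjective y
    rw [← map_mul, h.br_map, tBr_mul_apply, map_add, map_sum, map_mul, h.br_map]
    simp only [h.br_map, h.smul_map, map_mul]
  smul_apply ξ x n := by
    obtain ⟨x, rfl⟩ := h.surjective x
    rw [h.br_map, h.smul_map, tAct_tBr, map_sum]
    simp only [h.smul_map, h.br_map]

/-- Skew symmetry on generators shows that the braided derivation `flipDer u` has the values
required of the bracket with `u`. -/
theorem br_gen (h : IsModel q b) (u w : Gen k H A) :
    b (h.gen u) w = flipDer (sW k H A) b u (h.gen w) := by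
  rw [flipDer_apply, h.gen_apply u, h.br_map, tBr_tG_skew, map_neg, map_sum]
  refine congrArg _ (Finset.sum_congr rfl fun r _ => ?_)
  rw [h.sM_gen, gen_apply, h.br_map]

/-- A braided derivation is determined by its values on generators; this is the tool by which
identities of the bracket are proved. -/
theorem der_eq_zero (h : IsModel q b) {D : Module.End k M} (hD : D ∈ Der k (Super H) M)
    (h0 : ∀ w, D (h.gen w) = 0) : D = 0 := by
  have := h.moduleAlgebra
  have hadj : ∀ D : Module.End k M, (∀ w, D (h.gen w) = 0) → ∀ ξ w,
      adj k (Super H) M ξ D (h.gen w) = 0 := fun D h0 ξ w => by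
    rw [adj_apply]
    exact Finset.sum_eq_zero fun p _ => by rw [h.smul_gen, h0, smul_zero]
  refine LinearMap.ext fun z => ?_
  obtain ⟨x, rfl⟩ := h.surjective z
  rw [LinearMap.zero_apply]
  have key : ∀ (D : Module.End k M) (w : Gen k H A) (x : M), D ∈ Der k (Super H) M →
      (∀ w, D (h.gen w) = 0) → (∀ D ∈ Der k (Super H) M, (∀ w, D (h.gen w) = 0) → D x = 0) →
      D (h.gen w * x) = 0 := fun D w x hD h0 ih => by
    rw [mem_Der.1 hD, h0, zero_mul, zero_add]
    exact Finset.sum_eq_zero fun r _ => by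
      rw [ih _ (adj_mem hD _) (hadj D h0 _), mul_zero]
  -- The braided Leibniz rule brings in the translates `R₂⁻¹ ▷ D`, so the induction must range over
  -- all such `D`. The translates vanish on generators too, since the generators are stable under
  -- the action.
  revert D
  induction x using tInduction with
  | hadd x y hx hy => exact fun hD h0 => by rw [map_add, map_add, hx hD h0, hy hD h0, add_zero]
  | hA a => exact fun hD h0 => by rw [← tG_inl]; exact h0 _
  | hmulA a x ih =>
    intro D hD h0
    rw [map_mul, ← tG_inl]
    exact key D _ _ hD h0 fun D hD h0 => ih hD h0
  | hmulD X x ih =>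
    intro D hD h0
    rw [map_mul, ← tG_inr]
    exact key D _ _ hD h0 fun D hD h0 => ih hD h0

theorem der_ext (h : IsModel q b) {D D' : Module.End k M} (hD : D ∈ Der k (Super H) M)
    (hD' : D' ∈ Der k (Super H) M) (h0 : ∀ w, D (h.gen w) = D' (h.gen w)) : D = D' :=
  sub_eq_zero.1 (h.der_eq_zero (sub_mem hD hD') fun w => by
    rw [LinearMap.sub_apply, h0, sub_self])

/-- For a generator the derivation is `flipDer`. For a product `u x` it is `u` times the derivation
of `x` plus a right multiple of the derivation of `u`; braided derivations of a braided commutative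
algebra are closed under both operations. -/
theorem exists_der (h : IsModel q b) (x : M) :
    ∃ D ∈ Der k (Super H) M, ∀ w, D (h.gen w) = b x w := by
  have := h.moduleAlgebra
  have := h.braidedCommutative
  have key : ∀ (u : Gen k H A) (x : M), (∃ D ∈ Der k (Super H) M, ∀ w, D (h.gen w) = b x w) →
      ∃ D ∈ Der k (Super H) M, ∀ w, D (h.gen w) = b (h.gen u * x) w := by
    rintro u x ⟨D, hD, hx⟩
    refine ⟨_, add_mem (mulLeft_mul_mem (h.gen u) hD)
      (twist_mem (flipDer_mem h.isRightDer u) x), fun w => ?_⟩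
    rw [h.isRightDer.map_mul, LinearMap.add_apply, twist_apply]
    simp only [Module.End.mul_apply, LinearMap.mulLeft_apply, hx, h.sM_gen, ← h.br_gen,
      Algebra.lsmul_coe]
  obtain ⟨x, rfl⟩ := h.surjective x
  induction x using tInduction with
  | hadd x y hx hy =>
    obtain ⟨D, hD, hx⟩ := hx
    obtain ⟨D', hD', hy⟩ := hy
    exact ⟨D + D', add_mem hD hD', fun w => by
      rw [LinearMap.add_apply, hx, hy, map_add, map_add, LinearMap.add_apply]⟩
  | hA a =>
    exact ⟨_, flipDer_mem h.isRightDer (Gen.inl k H A a), fun w => by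
      rw [← h.br_gen, gen_apply, tG_inl]⟩
  | hmulA a x hx =>
    rw [map_mul, ← tG_inl]
    exact key _ _ hx
  | hmulD X x hx =>
    rw [map_mul, ← tG_inr]
    exact key _ _ hx

/-- The Schouten-Nijenhuis bracket. -/
noncomputable def bracket (h : IsModel q b) : M →ₗ[k] M →ₗ[k] M where
  toFun x := (h.exists_der x).choose
  map_add' x y := h.der_ext (h.exists_der _).choose_spec.1
    (add_mem (h.exists_der x).choose_spec.1 (h.exists_der y).choose_spec.1) fun w => by
      rw [LinearMap.add_apply, (h.exists_der _).choose_spec.2, (h.exists_der _).choose_spec.2,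
        (h.exists_der _).choose_spec.2, map_add, LinearMap.add_apply]
  map_smul' c x := h.der_ext (h.exists_der _).choose_spec.1
    (Submodule.smul_mem _ c (h.exists_der x).choose_spec.1) fun w => by
      rw [RingHom.id_apply, LinearMap.smul_apply, (h.exists_der _).choose_spec.2,
        (h.exists_der _).choose_spec.2, map_smul, LinearMap.smul_apply]

theorem bracket_mem (h : IsModel q b) (x : M) : h.bracket x ∈ Der k (Super H) M :=
  (h.exists_der x).choose_spec.1

theorem bracket_gen (h : IsModel q b) (x : M) (w : Gen k H A) : h.bracket x (h.gen w) = b x w :=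
  (h.exists_der x).choose_spec.2 w

theorem gen_bracket (h : IsModel q b) (u : Gen k H A) (z : M) :
    h.bracket (h.gen u) z = flipDer (sW k H A) b u z := by
  have := h.moduleAlgebra
  exact LinearMap.congr_fun (h.der_ext (h.bracket_mem _) (flipDer_mem h.isRightDer u) fun w => by
    rw [h.bracket_gen, h.br_gen]) z

/-- Both sides are braided derivations in `z`, and on generators they agree by the Leibniz rule of
`b`. -/
theorem mul_bracket (h : IsModel q b) (x y z : M) : h.bracket (x * y) z =
    x * h.bracket y z + ∑ r ∈ legs (Rinv k (Super H)),
      h.bracket x (sM k H M r.1 z) * (r.2 • y) := by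
  have := h.moduleAlgebra
  have := h.braidedCommutative
  have := LinearMap.congr_fun (h.der_ext (h.bracket_mem (x * y))
    (add_mem (mulLeft_mul_mem x (h.bracket_mem y)) (twist_mem (h.bracket_mem x) y)) fun w => by
      rw [h.bracket_gen, h.isRightDer.map_mul, LinearMap.add_apply, twist_apply]
      simp only [Module.End.mul_apply, LinearMap.mulLeft_apply, h.sM_gen, h.bracket_gen,
        Algebra.lsmul_coe]) z
  rw [this, LinearMap.add_apply, twist_apply]
  rfl

/-- For a generator as first argument this is the equivariance of `flipDer`; `equivariant_mul`
carries it to products. -/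
theorem smul_bracket (h : IsModel q b) (ξ : Super H) (x z : M) : ξ • h.bracket x z =
    ∑ p ∈ legs (comul (R := k) ξ), h.bracket (p.1 • x) (sM k H M p.2 z) := by
  have := h.moduleAlgebra
  have hgen : ∀ (u : Gen k H A) (ξ : Super H) (z : M), ξ • h.bracket (h.gen u) z =
      ∑ p ∈ legs (comul (R := k) ξ), h.bracket (p.1 • h.gen u) (sM k H M p.2 z) := by
    intro u ξ z
    have h1 := legs_comul_shift_left (sW k H A) (opr k (Super H) M)
      (fun u z => flipDer (sW k H A) b u z) (Super.shift k ξ) u z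
    have h2 := legs_comul_shift_right ((sW k H A).comp (Super.shift k)) (opr k (Super H) M)
      (fun u z => flipDer (sW k H A) b u z) ξ u z
    simp only [Super.shift_shift, Algebra.lsmul_coe, AlgHom.comp_apply, ← sM_apply] at h1 h2
    simp only [h.smul_gen, h.gen_bracket, smul_flipDer h.isRightDer, h1, h2]
  have key := equivariant_mul (ρW := sM k H M) (ρ := opr k (Super H) M) isMulAction_opr
    isMulAction_opr (AlgHom.id k M) (fun ξ x => rfl) h.bracket
    (fun x y => LinearMap.ext fun z => by
      rw [h.mul_bracket, LinearMap.add_apply, twist_apply]; rfl)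
  obtain ⟨x, rfl⟩ := h.surjective x
  revert ξ z
  induction x using tInduction with
  | hadd x y hx hy =>
    intro ξ z
    simp only [map_add, LinearMap.add_apply, smul_add, hx, hy, Finset.sum_add_distrib]
  | hA a => rw [← tG_inl]; exact hgen _
  | hmulA a x hx =>
    rw [map_mul, ← tG_inl]
    exact key _ _ (hgen _) hx
  | hmulD X x hx =>
    rw [map_mul, ← tG_inr]
    exact key _ _ (hgen _) hx

end IsModel
end Model

/-! ### Symmetry of the braided Jacobi identity in its arguments, and its proof for the bracket. -/

section BraidedLie
variable {k H V : Type*} [CommRing k] [Ring H] [HopfAlgebra k H] [Triangular k H]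
  [AddCommGroup V] [Module k V] {ρ : H →ₐ[k] Module.End k V} {B : V →ₗ[k] V →ₗ[k] V}

/-- The defect of the braided Jacobi identity. -/
noncomputable def jacobiator (ρ : H →ₐ[k] Module.End k V) (B : V →ₗ[k] V →ₗ[k] V) (x y z : V) : V :=
  B x (B y z) - B (B x y) z - ∑ r ∈ legs (Rinv k H), B (ρ r.1 y) (B (ρ r.2 x) z)

theorem jacobiator_swap_left
    (hs : ∀ x y, B y x = -∑ r ∈ legs (Rinv k H), B (ρ r.1 x) (ρ r.2 y)) (x y z : V) :
    jacobiator ρ B y x z = -∑ r ∈ legs (Rinv k H), jacobiator ρ B (ρ r.1 x) (ρ r.2 y) z := by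
  have h := legs_Rinv_flip ρ ρ (fun y x => B y (B x z)) y x
  simp only [jacobiator, Finset.sum_sub_distrib, h]
  rw [hs x y, map_neg, map_sum, LinearMap.neg_apply, LinearMap.sum_apply]
  abel

/-- Skew symmetry exchanges the second and third of the three terms of the defect, up to sign, while
the first only changes its sign; the hexagons and `R⁻¹ R⁻¹₂₁ = 1` collect the crossings. -/
theorem jacobiator_swap_right
    (he : ∀ ξ x y, ρ ξ (B x y) = ∑ p ∈ legs (comul (R := k) ξ), B (ρ p.1 x) (ρ p.2 y))
    (hs : ∀ x y, B y x = -∑ r ∈ legs (Rinv k H), B (ρ r.1 x) (ρ r.2 y)) (x y z : V) :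
    jacobiator ρ B x y z = -∑ r ∈ legs (Rinv k H), jacobiator ρ B x (ρ r.1 z) (ρ r.2 y) := by
  have h1 := legs_hexR ρ ρ ρ (fun z x y => B z (B x y)) z x y
  have h2 := fun r : H × H => legs_hexL ρ ρ ρ (fun x z y => B (B x z) y) (ρ r.2 x) z (ρ r.1 y)
  have h3 := fun s : H × H => legs_Rinv_flip ρ ρ (fun x y => B (B x (ρ s.1 z)) (ρ s.2 y)) x y
  have e1 : B x (B y z) = -∑ s ∈ legs (Rinv k H), B x (B (ρ s.1 z) (ρ s.2 y)) := by
    rw [hs z y, map_neg, map_sum]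
  have e2 : B (B x y) z = -∑ s ∈ legs (Rinv k H), ∑ r ∈ legs (Rinv k H),
      B (ρ r.1 (ρ s.1 z)) (B (ρ r.2 x) (ρ s.2 y)) := by
    rw [hs z (B x y), Finset.sum_comm, ← h1]
    simp only [he, map_sum]
  have e3 : ∑ r ∈ legs (Rinv k H), B (ρ r.1 y) (B (ρ r.2 x) z) =
      -∑ s ∈ legs (Rinv k H), B (B x (ρ s.1 z)) (ρ s.2 y) := by
    simp only [← h3]
    simp only [hs (B _ z), he, map_sum, LinearMap.sum_apply, h2, Finset.sum_neg_distrib]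
    rw [Finset.sum_comm]
  simp only [jacobiator, Finset.sum_sub_distrib]
  rw [e1, e2, e3]
  abel

theorem jacobiator_add_left (x x' y z : V) :
    jacobiator ρ B (x + x') y z = jacobiator ρ B x y z + jacobiator ρ B x' y z := by
  simp only [jacobiator, map_add, LinearMap.add_apply, Finset.sum_add_distrib]
  abel

theorem jacobiator_add_mid (x y y' z : V) :
    jacobiator ρ B x (y + y') z = jacobiator ρ B x y z + jacobiator ρ B x y' z := by
  simp only [jacobiator, map_add, LinearMap.add_apply, Finset.sum_add_distrib]
  abel

theorem jacobiator_add_right (x y z z' : V) :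
    jacobiator ρ B x y (z + z') = jacobiator ρ B x y z + jacobiator ρ B x y z' := by
  simp only [jacobiator, map_add, Finset.sum_add_distrib]
  abel

end BraidedLie

namespace IsModel
variable {k H A : Type*} [CommRing k] [Ring H] [HopfAlgebra k H] [Triangular k H] [Ring A]
  [Algebra k A] [Module H A] [IsScalarTower k H A] [ModuleAlgebra k H A]
  [BraidedCommutative k H A] {M : Type*}
  [Ring M] [Algebra k M] [Module (Super H) M] [IsScalarTower k (Super H) M]
  {q : TensorAlg k H A →ₐ[k] M} {b : M →ₗ[k] Gen k H A →ₗ[k] M}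

theorem isRightDer_bracket (h : IsModel q b) : IsRightDer (sM k H M) h.bracket :=
  ⟨h.mul_bracket, h.smul_bracket⟩

theorem sM_bracket (h : IsModel q b) (ξ : Super H) (x z : M) : sM k H M ξ (h.bracket x z) =
    ∑ p ∈ legs (comul (R := k) ξ), h.bracket (sM k H M p.1 x) (sM k H M p.2 z) := by
  rw [sM_apply, h.smul_bracket]
  exact legs_comul_shift_left (opr k (Super H) M) (sM k H M) (fun x z => h.bracket x z) ξ x z

/-- As functions of `x` both sides are braided derivations. On generators the right side contains
two successive flips, which cancel. -/
theorem bracket_skew (h : IsModel q b) (x y : M) : h.bracket y x =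
    -∑ r ∈ legs (Rinv k (Super H)), h.bracket (sM k H M r.1 x) (sM k H M r.2 y) := by
  have := h.moduleAlgebra
  refine LinearMap.congr_fun (h.der_ext (h.bracket_mem y) (flipDer_mem h.isRightDer_bracket y)
    fun w => ?_) x
  have h1 := legs_Rinv_flip (sM k H M) (sW k H A) (fun y w => b y w) y w
  rw [h.bracket_gen, flipDer_apply]
  simp only [h.sM_gen, h.gen_bracket, flipDer_apply, Finset.sum_neg_distrib, neg_neg, h1]

/-- By uniqueness of the adjoint action this is equivariance of the bracket, with the shift moved to
the first argument. -/
theorem adj_bracket (h : IsModel q b) (ξ : Super H) (x : M) :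
    adj k (Super H) M ξ (h.bracket x) = h.bracket (sM k H M ξ x) := by
  refine adj_eq_of_smul_apply (h.bracket ∘ₗ (sM k H M).toLinearMap.flip x) (fun ξ z => ?_) ξ
  have h1 := legs_comul_shift_left (opr k (Super H) M) (sM k H M) (fun x z => h.bracket x z)
    (Super.shift k ξ) x z
  have h2 := legs_comul_shift_right (sM k H M) (opr k (Super H) M) (fun x z => h.bracket x z)
    (Super.shift k ξ) x z
  simp only [Super.shift_shift, Algebra.lsmul_coe, ← sM_apply] at h1 h2
  rw [h.smul_bracket, h1]
  exact h2.symm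

theorem bracket_mul (h : IsModel q b) (x y z : M) : h.bracket x (y * z) =
    h.bracket x y * z + ∑ r ∈ legs (Rinv k (Super H)),
      (r.1 • y) * h.bracket (sM k H M r.2 x) z := by
  rw [mem_Der.1 (h.bracket_mem x)]
  simp only [h.adj_bracket]

theorem gen_inr_inr (h : IsModel q b) (X Y : Der k H A) :
    h.bracket (h.gen (Gen.inr k H A X)) (h.gen (Gen.inr k H A Y)) =
      h.gen (Gen.inr k H A (Der.bracket X Y)) := by
  rw [h.bracket_gen, gen_apply, h.br_map, tBr_tG, gen_apply, tG_inr]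
  simp only [Gen.fst_inr, Gen.snd_inr, map_zero, zero_add, LinearMap.zero_apply]

theorem gen_inr_inl (h : IsModel q b) (X : Der k H A) (a : A) :
    h.bracket (h.gen (Gen.inr k H A X)) (h.gen (Gen.inl k H A a)) =
      h.gen (Gen.inl k H A (X.1 a)) := by
  rw [h.bracket_gen, gen_apply, h.br_map, tBr_tG, gen_apply, tG_inl]
  simp only [Gen.fst_inr, Gen.snd_inr, Gen.fst_inl, Gen.snd_inl, map_zero, zero_add,
    ← bracketL_apply, add_zero]

theorem gen_inl_inl (h : IsModel q b) (a c : A) :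
    h.bracket (h.gen (Gen.inl k H A a)) (h.gen (Gen.inl k H A c)) = 0 := by
  rw [h.bracket_gen, gen_apply, h.br_map, tBr_tG]
  simp only [Gen.fst_inl, Gen.snd_inl, map_zero, ← bracketL_apply, add_zero,
    ZeroMemClass.coe_zero, LinearMap.zero_apply]

theorem jacobiator_inr_inr (h : IsModel q b) (X Y : Der k H A) (w : Gen k H A) :
    jacobiator (sM k H M) h.bracket (h.gen (Gen.inr k H A X)) (h.gen (Gen.inr k H A Y))
      (h.gen w) = 0 := by
  rw [Gen.eq_add w, map_add, jacobiator_add_right]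
  generalize Gen.fst k H A w = a
  generalize Gen.snd k H A w = Z
  have h1 := legs_ev_Rinv (derAct k H A) (derAct k H A) (fun Y X => evalL k H A Y (evalL k H A X a))
    0 0 Y X
  have h2 := legs_ev_Rinv (derAct k H A) (derAct k H A)
    (fun Y X => bracketL k H A Y (bracketL k H A X Z)) 0 0 Y X
  simp only [evalL_apply, bracketL_apply, ksign_zero_left, one_smul] at h1 h2
  have h3 : Der.bracket X (Der.bracket Y Z) = Der.bracket (Der.bracket X Y) Z +
      ∑ r ∈ legs (Rinv k H), Der.bracket (derAct k H A r.1 Y)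
        (Der.bracket (derAct k H A r.2 X) Z) :=
    Subtype.ext ((commutator_jacobi isMulAction_adj X.1 Y.1 Z.1).trans
      (by simp [Der.bracket, coe_derAct]))
  simp only [jacobiator, h.sM_gen, sW_inr, h.gen_inr_inl, h.gen_inr_inr, ← map_sum, h1, h2]
  have h4 := congrArg (fun W => h.gen (Gen.inr k H A W)) h3
  simp only [map_add] at h4
  rw [h4, Der.bracket_apply]
  simp only [← derAct_apply, map_sub, sub_sub_cancel, sub_self, zero_add, add_sub_cancel_left]

/-- With at least two derivations among the arguments this reduces, by exchanging arguments, to the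
Jacobi identity of braided derivations, possibly evaluated at a function. With two or more functions
all three terms vanish. -/
theorem jacobiator_gen (h : IsModel q b) (u v w : Gen k H A) :
    jacobiator (sM k H M) h.bracket (h.gen u) (h.gen v) (h.gen w) = 0 := by
  have h1 : ∀ X a w, jacobiator (sM k H M) h.bracket (h.gen (Gen.inr k H A X))
      (h.gen (Gen.inl k H A a)) (h.gen w) = 0 := fun X a w => by
    rw [Gen.eq_add w, map_add, jacobiator_add_right,
      jacobiator_swap_right h.sM_bracket h.bracket_skew _ _ (h.gen (Gen.inr k H A _))]
    simp only [h.sM_gen, sW_inr, h.jacobiator_inr_inr, Finset.sum_const_zero, neg_zero, add_zero]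
    simp only [jacobiator, h.sM_gen, sW_inr, sW_inl, h.gen_inr_inl, h.gen_inl_inl, map_zero,
      Finset.sum_const_zero, sub_zero]
  have h2 : ∀ a X w, jacobiator (sM k H M) h.bracket (h.gen (Gen.inl k H A a))
      (h.gen (Gen.inr k H A X)) (h.gen w) = 0 := fun a X w => by
    rw [jacobiator_swap_left h.bracket_skew]
    simp only [h.sM_gen, sW_inr, sW_inl, h1, Finset.sum_const_zero, neg_zero]
  have h3 : ∀ a c w, jacobiator (sM k H M) h.bracket (h.gen (Gen.inl k H A a))
      (h.gen (Gen.inl k H A c)) (h.gen w) = 0 := fun a c w => by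
    rw [Gen.eq_add w, map_add, jacobiator_add_right,
      jacobiator_swap_right h.sM_bracket h.bracket_skew _ _ (h.gen (Gen.inr k H A _))]
    simp only [h.sM_gen, sW_inr, h2, Finset.sum_const_zero, neg_zero, add_zero]
    simp only [jacobiator, h.sM_gen, sW_inl, h.gen_inl_inl, map_zero, LinearMap.zero_apply,
      Finset.sum_const_zero, sub_zero]
  rw [Gen.eq_add u, Gen.eq_add v, map_add, map_add, jacobiator_add_left, jacobiator_add_mid,
    jacobiator_add_mid, h.jacobiator_inr_inr, h1, h2, h3]
  simp only [add_zero]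

theorem jacobiator_eq_zero (h : IsModel q b) (x y z : M) :
    jacobiator (sM k H M) h.bracket x y z = 0 := by
  have := h.moduleAlgebra
  have key : ∀ x y, (∀ w, jacobiator (sM k H M) h.bracket x y (h.gen w) = 0) →
      ∀ z, jacobiator (sM k H M) h.bracket x y z = 0 := fun x y h0 z => by
    -- The defect is the commutator of `⟦x, ·⟧` and `⟦y, ·⟧` minus `⟦⟦x, y⟧, ·⟧`, hence a braided
    -- derivation in `z`, so vanishing on generators suffices. Exchanging arguments then releases
    -- the other two.
    have hJ : ∀ z, (commutator (adj k (Super H) M) (h.bracket x) (h.bracket y) -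
        h.bracket (h.bracket x y)) z = jacobiator (sM k H M) h.bracket x y z := fun z => by
      simp only [commutator, h.adj_bracket, LinearMap.sub_apply, LinearMap.sum_apply,
        Module.End.mul_apply, jacobiator]
      abel
    rw [← hJ, h.der_eq_zero (sub_mem (comp_sub_mem (h.bracket_mem x) (h.bracket_mem y))
      (h.bracket_mem _)) (fun w => (hJ _).trans (h0 w)), LinearMap.zero_apply]
  have h1 : ∀ u v z, jacobiator (sM k H M) h.bracket (h.gen u) (h.gen v) z = 0 := fun u v =>
    key _ _ (h.jacobiator_gen u v)
  have h2 : ∀ u y z, jacobiator (sM k H M) h.bracket (h.gen u) y z = 0 := fun u y =>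
    key _ _ fun w => by
      rw [jacobiator_swap_right h.sM_bracket h.bracket_skew]
      simp only [h.sM_gen, h1, Finset.sum_const_zero, neg_zero]
  refine key _ _ (fun w => ?_) z
  rw [jacobiator_swap_right h.sM_bracket h.bracket_skew]
  simp only [h.sM_gen, jacobiator_swap_left (ρ := sM k H M) h.bracket_skew (h.gen _), h2, Finset.sum_const_zero, neg_zero]

end IsModel

/-! ### Signs, degrees, and the identities for homogeneous elements over `H`. -/

theorem ksign_one_natCast (n : ℕ) : ksign 1 (n : ZMod 2) = (-1) ^ n := by
  induction n with
  | zero => simp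
  | succ n ih => rw [Nat.cast_succ, ksign_add_right, ih, pow_succ]; rfl

theorem coe_negOnePow_mul (p q : ℤ) : ((Int.negOnePow (p * q) : ℤˣ) : ℤ) = ksign p q := by
  rw [ksign]
  split_ifs with hpq
  · rw [Int.negOnePow_odd _ ((ZMod.intCast_eq_one_iff_odd.1 hpq.1).mul
      (ZMod.intCast_eq_one_iff_odd.1 hpq.2))]
    rfl
  · rw [ZMod.intCast_eq_one_iff_odd, ZMod.intCast_eq_one_iff_odd, ← Int.odd_mul, Int.not_odd_iff_even] at hpq
    rw [Int.negOnePow_even _ hpq]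
    rfl

section Degrees
variable {k H A : Type*} [CommRing k] [Ring H] [HopfAlgebra k H] [Triangular k H] [Ring A]
  [Algebra k A] [Module H A] [IsScalarTower k H A] [ModuleAlgebra k H A]
  [BraidedCommutative k H A] {M : Type*} [Ring M] [Algebra k M]

/-- The image of the tensors of degree `n`. -/
def mDeg (q : TensorAlg k H A →ₐ[k] M) (n : ℕ) : Submodule k M :=
  Submodule.span k {x | ∃ (a : A) (X : Fin n → Der k H A),
    x = q (tA k H A a) * q (word (List.ofFn X))}

variable {q : TensorAlg k H A →ₐ[k] M}

theorem tA_mul_word_mem_mDeg (a : A) (l : List (Der k H A)) :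
    q (tA k H A a) * q (word l) ∈ mDeg q l.length :=
  Submodule.subset_span ⟨a, l.get, by rw [List.ofFn_get]⟩

theorem tA_mem_mDeg (a : A) : q (tA k H A a) ∈ mDeg q 0 := by
  have := tA_mul_word_mem_mDeg (q := q) a []
  rwa [word_nil, map_one, mul_one] at this

theorem words_mem_mDeg {n : ℕ} {x : TensorAlg k H A} (hx : x ∈ words k H A n) : q x ∈ mDeg q n := by
  refine words_induction (n := n) (p := fun x => q x ∈ mDeg q n) (by rw [map_zero]; exact zero_mem _)
    (fun x y hx hy => by rw [map_add]; exact add_mem hx hy)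
    (fun c x hx => by rw [map_smul]; exact Submodule.smul_mem _ c hx) (fun l hl => ?_) x hx
  have := tA_mul_word_mem_mDeg (q := q) 1 l
  rwa [map_one, map_one, one_mul, hl] at this

theorem word_mem_mDeg (l : List (Der k H A)) : q (word l) ∈ mDeg q l.length :=
  words_mem_mDeg (word_mem l)

theorem tD_mem_mDeg (X : Der k H A) : q (tD k H A X) ∈ mDeg q 1 := words_mem_mDeg (tD_mem X)

theorem mem_mDeg_zero {x : M} (hx : x ∈ mDeg q 0) : ∃ a, x = q (tA k H A a) := by
  refine Submodule.span_induction (p := fun x _ => ∃ a, x = q (tA k H A a)) ?_ ⟨0, by simp⟩ ?_ ?_ hx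
  · rintro _ ⟨a, X, rfl⟩
    exact ⟨a, by rw [List.ofFn_zero, word_nil, map_one, mul_one]⟩
  · rintro _ _ _ _ ⟨a, rfl⟩ ⟨c, rfl⟩
    exact ⟨a + c, by rw [map_add, map_add]⟩
  · rintro r _ _ ⟨a, rfl⟩
    exact ⟨r • a, by rw [map_smul, map_smul]⟩

theorem mem_mDeg_succ {n : ℕ} {x : M} (hx : x ∈ mDeg q (n + 1)) :
    ∃ t ∈ words k H A (n + 1), q t = x := by
  have h : mDeg q (n + 1) ≤ (words k H A (n + 1)).map q.toLinearMap := Submodule.span_le.2 (by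
    rintro _ ⟨a, X, rfl⟩
    refine ⟨_, tA_mul_mem a ?_, map_mul q _ _⟩
    have := word_mem (List.ofFn X)
    rwa [List.length_ofFn] at this)
  exact h hx

theorem mDeg_induction {p : M → Prop} (hadd : ∀ x y, p x → p y → p (x + y))
    (hsmul : ∀ (c : k) x, p x → p (c • x)) {n : ℕ}
    (h : ∀ X : Fin (n + 1) → Der k H A, p (q (word (List.ofFn X)))) {x : M}
    (hx : x ∈ mDeg q (n + 1)) : p x := by
  obtain ⟨t, ht, rfl⟩ := mem_mDeg_succ hx
  refine words_induction (n := n + 1) (p := fun t => p (q t)) ?_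
    (fun x y hx hy => by rw [map_add]; exact hadd _ _ hx hy)
    (fun c x hx => by rw [map_smul]; exact hsmul _ _ hx) (fun l hl => ?_) t ht
  · have := hsmul 0 _ (h 0)
    rwa [zero_smul, ← map_zero q] at this
  · have := h (fun i => l.get (i.cast hl.symm))
    rwa [← List.ofFn_congr hl, List.ofFn_get] at this

theorem mDeg_mul {n m : ℕ} {x y : M} (hx : x ∈ mDeg q n) (hy : y ∈ mDeg q m) :
    x * y ∈ mDeg q (n + m) := by
  have hr : ∀ {n : ℕ} {x : M} (a : A), x ∈ mDeg q n → x * q (tA k H A a) ∈ mDeg q n := by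
    intro n x a hx
    cases n with
    | zero =>
      obtain ⟨c, rfl⟩ := mem_mDeg_zero hx
      rw [← map_mul, ← map_mul]
      exact tA_mem_mDeg _
    | succ n =>
      obtain ⟨t, ht, rfl⟩ := mem_mDeg_succ hx
      rw [← map_mul]
      exact words_mem_mDeg (words_mul_tA a ht)
  refine Submodule.span_induction (p := fun y _ => x * y ∈ mDeg q (n + m)) ?_ ?_ ?_ ?_ hy
  · rintro _ ⟨c, Y, rfl⟩
    rw [← mul_assoc]
    refine Submodule.span_induction (p := fun x _ => x * q (word (List.ofFn Y)) ∈ mDeg q (n + m))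
      ?_ ?_ ?_ ?_ (hr c hx)
    · rintro _ ⟨a, X, rfl⟩
      rw [mul_assoc, ← map_mul q (word _), ← word_append]
      have := tA_mul_word_mem_mDeg (q := q) a (List.ofFn X ++ List.ofFn Y)
      rwa [List.length_append, List.length_ofFn, List.length_ofFn] at this
    · rw [zero_mul]; exact zero_mem _
    · intro x y _ _ hx hy
      rw [add_mul]; exact add_mem hx hy
    · intro r x _ hx
      rw [smul_mul_assoc]; exact Submodule.smul_mem _ r hx
  · rw [mul_zero]; exact zero_mem _
  · intro x y _ _ hx hy
    rw [mul_add]; exact add_mem hx hy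
  · intro r x _ hx
    rw [mul_smul_comm]; exact Submodule.smul_mem _ r hx

variable [Module (Super H) M] [IsScalarTower k (Super H) M]

section
variable (k H M)

/-- The action of `H` on a module over `Super H`. -/
noncomputable def hAct : H →ₐ[k] Module.End k M := (opr k (Super H) M).comp (Super.const k)

end

namespace IsModel
variable {b : M →ₗ[k] Gen k H A →ₗ[k] M}

theorem hAct_map (h : IsModel q b) (ξ : H) (x : TensorAlg k H A) :
    hAct k H M ξ (q x) = q (tActH k H A ξ x) := h.smul_map _ _

theorem hAct_tA (h : IsModel q b) (ξ : H) (a : A) :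
    hAct k H M ξ (q (tA k H A a)) = q (tA k H A (ξ • a)) := by rw [h.hAct_map, tActH_tA]

theorem hAct_tD (h : IsModel q b) (ξ : H) (X : Der k H A) :
    hAct k H M ξ (q (tD k H A X)) = q (tD k H A (derAct k H A ξ X)) := by
  rw [h.hAct_map, tActH_tD]

theorem hAct_mem (h : IsModel q b) {n : ℕ} {x : M} (hx : x ∈ mDeg q n) (ξ : H) :
    hAct k H M ξ x ∈ mDeg q n := by
  cases n with
  | zero =>
    obtain ⟨c, rfl⟩ := mem_mDeg_zero hx
    rw [h.hAct_tA]
    exact tA_mem_mDeg _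
  | succ n =>
    obtain ⟨t, ht, rfl⟩ := mem_mDeg_succ hx
    rw [h.hAct_map]
    exact words_mem_mDeg (tActH_mem ht ξ)

/-- The translation from `Super H` to `H` in degree `n`. Each identity below is the sign-free one
over `Super H` read through this lemma, with parity `n + 1` for arguments acted upon through `sM`.
-/
theorem smul_of_mem (h : IsModel q b) {n : ℕ} {x : M} (hx : x ∈ mDeg q n) (ξ : Super H) :
    ξ • x = hAct k H M (Super.ev k n ξ) x := by
  cases n with
  | zero =>
    obtain ⟨c, rfl⟩ := mem_mDeg_zero hx
    rw [h.hAct_tA, h.smul_map, tAct_tA, Nat.cast_zero]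
  | succ n =>
    obtain ⟨t, ht, rfl⟩ := mem_mDeg_succ hx
    rw [h.hAct_map, h.smul_map, tAct_words ht]

theorem sM_of_mem (h : IsModel q b) {n : ℕ} {x : M} (hx : x ∈ mDeg q n) (ξ : Super H) :
    sM k H M ξ x = hAct k H M (Super.ev k (n + 1) ξ) x := by
  rw [sM_apply, h.smul_of_mem hx, Super.ev_shift]

theorem isMulAction_hAct (h : IsModel q b) : IsMulAction (hAct k H M) := by
  have := h.moduleAlgebra
  exact (isMulAction_opr (k := k) (H := H) (M := M)).comp_const

theorem hAct_one (h : IsModel q b) (ξ : H) :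
    hAct k H M ξ 1 = counit (R := k) ξ • (1 : M) := by
  rw [← map_one q, h.hAct_map, tActH_one, map_smul]

theorem mul_comm_of_mem (h : IsModel q b) {m n : ℕ} {x y : M} (hx : x ∈ mDeg q m)
    (hy : y ∈ mDeg q n) : x * y =
      ksign n m • ∑ r ∈ legs (Rinv k H), hAct k H M r.1 y * hAct k H M r.2 x := by
  have := h.braidedCommutative
  have h1 := legs_ev_Rinv (hAct k H M) (hAct k H M) (fun y x => y * x) n m y x
  rw [BraidedCommutative.mul_comm (k := k) (H := Super H) y x, ← h1]
  simp only [h.smul_of_mem hx, h.smul_of_mem hy]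

theorem hAct_bracket (h : IsModel q b) (ξ : H) (x y : M) : hAct k H M ξ (h.bracket x y) =
    ∑ p ∈ legs (comul (R := k) ξ), h.bracket (hAct k H M p.1 x) (hAct k H M p.2 y) := by
  have h1 := legs_comul_const (ρ₁ := opr k (Super H) M) (ρ₂ := sM k H M)
    (fun x y => h.bracket x y) ξ x y
  exact (h.smul_bracket _ _ _).trans h1

theorem bracket_mul_of_mem (h : IsModel q b) {m n : ℕ} {x y : M} (hx : x ∈ mDeg q m)
    (hy : y ∈ mDeg q n) (z : M) : h.bracket x (y * z) = h.bracket x y * z +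
      ksign n (m + 1) • ∑ r ∈ legs (Rinv k H),
        hAct k H M r.1 y * h.bracket (hAct k H M r.2 x) z := by
  have h1 := legs_ev_Rinv (hAct k H M) (hAct k H M) (fun y x => y * h.bracket x z) n (m + 1) y x
  rw [h.bracket_mul, ← h1]
  simp only [h.smul_of_mem hy, h.sM_of_mem hx]

theorem mul_bracket_of_mem (h : IsModel q b) {m n : ℕ} {y z : M} (x : M) (hy : y ∈ mDeg q m)
    (hz : z ∈ mDeg q n) : h.bracket (x * y) z = x * h.bracket y z +
      ksign (n + 1) m • ∑ r ∈ legs (Rinv k H),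
        h.bracket x (hAct k H M r.1 z) * hAct k H M r.2 y := by
  have h1 := legs_ev_Rinv (hAct k H M) (hAct k H M) (fun z y => h.bracket x z * y) (n + 1) m z y
  rw [h.mul_bracket, ← h1]
  simp only [h.smul_of_mem hy, h.sM_of_mem hz]

theorem bracket_skew_of_mem (h : IsModel q b) {m n : ℕ} {x y : M} (hx : x ∈ mDeg q m)
    (hy : y ∈ mDeg q n) : h.bracket y x = -(ksign (m + 1) (n + 1) • ∑ r ∈ legs (Rinv k H),
      h.bracket (hAct k H M r.1 x) (hAct k H M r.2 y)) := by
  have h1 := legs_ev_Rinv (hAct k H M) (hAct k H M) (fun x y => h.bracket x y) (m + 1) (n + 1) x y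
  rw [h.bracket_skew, ← h1]
  simp only [h.sM_of_mem hx, h.sM_of_mem hy]

theorem bracket_jacobi_of_mem (h : IsModel q b) {m n : ℕ} {x y : M} (hx : x ∈ mDeg q m)
    (hy : y ∈ mDeg q n) (z : M) : h.bracket x (h.bracket y z) = h.bracket (h.bracket x y) z +
      ksign (n + 1) (m + 1) • ∑ r ∈ legs (Rinv k H),
        h.bracket (hAct k H M r.1 y) (h.bracket (hAct k H M r.2 x) z) := by
  have h1 := legs_ev_Rinv (hAct k H M) (hAct k H M) (fun y x => h.bracket y (h.bracket x z))
    (n + 1) (m + 1) y x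
  have h2 := h.jacobiator_eq_zero x y z
  rw [jacobiator, sub_sub, sub_eq_zero] at h2
  rw [h2, ← h1]
  simp only [h.sM_of_mem hx, h.sM_of_mem hy]

end IsModel
end Degrees

/-! ### The explicit formulas for the bracket of wedge products. -/

section ListLemmas
variable {α : Type*} {n : ℕ} (X : Fin (n + 1) → α)

theorem ofFn_castSucc_append : List.ofFn X =
    List.ofFn (fun i : Fin n => X i.castSucc) ++ [X (Fin.last n)] := by
  rw [List.ofFn_succ', List.concat_eq_append]

theorem take_ofFn_castSucc (i : Fin n) :
    (List.ofFn X).take i = (List.ofFn fun i : Fin n => X i.castSucc).take i := by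
  rw [ofFn_castSucc_append, List.take_append_of_le_length (by rw [List.length_ofFn]; exact i.2.le)]

theorem drop_ofFn_castSucc (i : Fin n) : (List.ofFn X).drop (i + 1) =
    (List.ofFn fun i : Fin n => X i.castSucc).drop (i + 1) ++ [X (Fin.last n)] := by
  rw [ofFn_castSucc_append, List.drop_append_of_le_length (by rw [List.length_ofFn]; exact i.2)]

theorem take_ofFn_last : (List.ofFn X).take n = List.ofFn fun i : Fin n => X i.castSucc := by
  rw [ofFn_castSucc_append, List.take_append_of_le_length (by rw [List.length_ofFn]),
    List.take_of_length_le (by rw [List.length_ofFn])]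

theorem drop_ofFn_last : (List.ofFn X).drop (n + 1) = [] :=
  List.drop_eq_nil_of_le (by rw [List.length_ofFn])

end ListLemmas

namespace IsModel
variable {k H A : Type*} [CommRing k] [Ring H] [HopfAlgebra k H] [Triangular k H] [Ring A]
  [Algebra k A] [Module H A] [IsScalarTower k H A] [ModuleAlgebra k H A]
  [BraidedCommutative k H A] {M : Type*}
  [Ring M] [Algebra k M] [Module (Super H) M] [IsScalarTower k (Super H) M]
  {q : TensorAlg k H A →ₐ[k] M} {b : M →ₗ[k] Gen k H A →ₗ[k] M}

theorem bracket_tA_tA (h : IsModel q b) (a c : A) :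
    h.bracket (q (tA k H A a)) (q (tA k H A c)) = 0 := by
  rw [← tG_inl, ← tG_inl]
  exact h.gen_inl_inl a c

theorem bracket_tD_tA (h : IsModel q b) (X : Der k H A) (a : A) :
    h.bracket (q (tD k H A X)) (q (tA k H A a)) = q (tA k H A (X.1 a)) := by
  rw [← tG_inl, ← tG_inl, ← tG_inr]
  exact h.gen_inr_inl X a

theorem bracket_tD_tD (h : IsModel q b) (X Y : Der k H A) :
    h.bracket (q (tD k H A X)) (q (tD k H A Y)) = q (tD k H A (Der.bracket X Y)) := by
  rw [← tG_inr, ← tG_inr, ← tG_inr]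
  exact h.gen_inr_inr X Y

theorem bracket_tA_tD (h : IsModel q b) (a : A) (X : Der k H A) :
    h.bracket (q (tA k H A a)) (q (tD k H A X)) =
      -∑ r ∈ legs (Rinv k H), q (tA k H A ((derAct k H A r.1 X).1 (r.2 • a))) := by
  rw [h.bracket_skew_of_mem (tD_mem_mDeg X) (tA_mem_mDeg a)]
  simp only [h.hAct_tD, h.hAct_tA, h.bracket_tD_tA]
  rw [Nat.cast_one, show (1 + 1 : ZMod 2) = 0 from rfl, ksign_zero_left, one_smul]

theorem bracket_one (h : IsModel q b) (z : M) : h.bracket 1 z = 0 := by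
  have h2 : h.bracket 1 = 0 := by
    have := h.moduleAlgebra
    refine h.der_eq_zero (h.bracket_mem 1) fun w => ?_
    rw [h.bracket_gen, ← map_one q, h.br_map, tBr_one, LinearMap.zero_apply, map_zero]
  rw [h2, LinearMap.zero_apply]

theorem bracket_one_right (h : IsModel q b) (x : M) : h.bracket x 1 = 0 := by
  have := h.moduleAlgebra
  rw [h.bracket_skew]
  simp only [sM_apply, ModuleAlgebra.smul_one (k := k), map_smul, h.bracket_one,
    LinearMap.smul_apply, smul_zero, Finset.sum_const_zero, neg_zero]

theorem bracket_der_mem (h : IsModel q b) {n : ℕ} {x : M} (hx : x ∈ mDeg q n) (X : Der k H A) :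
    h.bracket x (q (tD k H A X)) ∈ mDeg q n := by
  cases n with
  | zero =>
    obtain ⟨c, rfl⟩ := mem_mDeg_zero hx
    rw [h.bracket_tA_tD]
    exact neg_mem (sum_mem fun r _ => tA_mem_mDeg _)
  | succ n =>
    obtain ⟨t, ht, rfl⟩ := mem_mDeg_succ hx
    rw [← tG_inr, ← h.gen_apply, h.bracket_gen, h.br_map]
    exact words_mem_mDeg (tBr_der_mem ht X)

/-- The Leibniz rule in the first argument splits off the first factor; to reach it, `a` crosses the
other `n` factors, whence the sign. -/
theorem bracket_word_tA (h : IsModel q b) (n : ℕ) (X : Fin n → Der k H A) (a : A) :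
    h.bracket (q (word (List.ofFn X))) (q (tA k H A a)) =
      ∑ i : Fin n, (-1 : ℤ) ^ (n - (i + 1 : ℕ)) • ∑ r ∈ legs (Rinv k H),
        q (word ((List.ofFn X).take i)) * q (tA k H A ((X i).1 (r.1 • a))) *
          hAct k H M r.2 (q (word ((List.ofFn X).drop (i + 1)))) := by
  induction n with
  | zero => simp [h.bracket_one]
  | succ n ih =>
    have hw : q (word (List.ofFn fun i : Fin n => X i.succ)) ∈ mDeg q n := by
      have := word_mem_mDeg (q := q) (List.ofFn fun i : Fin n => X i.succ)
      rwa [List.length_ofFn] at this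
    rw [List.ofFn_succ, word_cons, map_mul, h.mul_bracket_of_mem _ hw (tA_mem_mDeg a), ih,
      Fin.sum_univ_succ, add_comm]
    simp only [h.hAct_tA, h.bracket_tD_tA, Nat.cast_zero, zero_add, ksign_one_natCast,
      Fin.val_zero, List.take_zero, word_nil, map_one, one_mul, List.drop_succ_cons, List.drop_zero,
      Fin.val_succ, List.take_succ_cons, word_cons, map_mul, Nat.add_sub_add_right,
      Finset.mul_sum, mul_smul_comm, mul_assoc, Nat.add_sub_cancel]

/-- The Leibniz rule in the second argument splits off the last factor; the legs of the coproduct in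
the formula come from the hexagon applied to the word in front. -/
theorem bracket_tA_word (h : IsModel q b) (n : ℕ) (X : Fin n → Der k H A) (a : A) :
    h.bracket (q (tA k H A a)) (q (word (List.ofFn X))) =
      ∑ i : Fin n, (-1 : ℤ) ^ (i + 1 : ℕ) • ∑ r ∈ legs (Rinv k H),
        ∑ p ∈ legs (comul (R := k) r.1),
          hAct k H M p.1 (q (word ((List.ofFn X).take i))) *
            q (tA k H A ((derAct k H A p.2 (X i)).1 (r.2 • a))) *
            q (word ((List.ofFn X).drop (i + 1))) := by
  revert a
  induction n with
  | zero =>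
    intro a
    rw [Fin.sum_univ_zero, List.ofFn_zero, word_nil, map_one, h.bracket_one_right]
  | succ n ih =>
    intro a
    have hw : q (word (List.ofFn fun i : Fin n => X i.castSucc)) ∈ mDeg q n := by
      have := word_mem_mDeg (q := q) (List.ofFn fun i : Fin n => X i.castSucc)
      rwa [List.length_ofFn] at this
    have h1 := legs_hexL (hAct k H M) (derAct k H A) (opr k H A)
      (fun w X a => w * q (tA k H A (evalL k H A X a)))
      (q (word (List.ofFn fun i : Fin n => X i.castSucc))) (X (Fin.last n)) a
    simp only [evalL_apply, Algebra.lsmul_coe] at h1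
    rw [Fin.sum_univ_castSucc]
    simp only [Fin.val_castSucc, Fin.val_last, take_ofFn_castSucc, drop_ofFn_castSucc,
      take_ofFn_last, drop_ofFn_last, word_nil, map_one, mul_one, h1]
    conv_lhs => rw [ofFn_castSucc_append, word_append, word_cons, word_nil, mul_one, map_mul]
    rw [h.bracket_mul_of_mem (tA_mem_mDeg a) hw, ih]
    congr 1
    · simp only [word_append, word_cons, word_nil, mul_one, map_mul, Finset.sum_mul,
        smul_mul_assoc, mul_assoc]
    · simp only [h.hAct_tA, h.bracket_tA_tD, Nat.cast_zero, zero_add, ksign_comm _ 1,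
        ksign_one_natCast, mul_neg, Finset.sum_neg_distrib, Finset.mul_sum]
      rw [Finset.sum_comm, smul_neg, pow_succ, mul_neg_one, neg_smul]

/-- The terms `[R₁⁻¹ ▷ X, R'₁⁻¹ ▷ Y] ∧ (R'₂⁻¹ ▷ ((R₂⁻¹ ▷ u) ∧ c))` of the bracket. -/
noncomputable def term (q : TensorAlg k H A →ₐ[k] M) (X Y : Der k H A) (u c : M) : M :=
  ∑ r ∈ legs (Rinv k H), ∑ r' ∈ legs (Rinv k H),
    q (tD k H A (Der.bracket (derAct k H A r.1 X) (derAct k H A r'.1 Y))) *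
      hAct k H M r'.2 (hAct k H M r.2 u * c)

theorem sum_term_mul (h : IsModel q b) (X Y : Der k H A) (u c v : M) :
    ∑ s ∈ legs (Rinv k H), term q X (derAct k H A s.1 Y) u c * hAct k H M s.2 v =
      term q X Y u (c * v) := by
  have hm : ∀ ξ x y, hAct k H M ξ (x * y) = _ := h.isMulAction_hAct
  have h1 := fun r : H × H => legs_hexR (derAct k H A) (hAct k H M) (hAct k H M)
    (fun Y c v => q (tD k H A (bracketL k H A (derAct k H A r.1 X) Y)) * (c * v)) Y
      (hAct k H M r.2 u * c) v
  simp only [bracketL_apply, ← Finset.mul_sum, ← hm] at h1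
  simp only [term, Finset.sum_mul]
  rw [Finset.sum_comm]
  refine Finset.sum_congr rfl fun r _ => ?_
  rw [← mul_assoc, h1, Finset.sum_comm]
  simp only [mul_assoc]

/-- In the formula the commutator stands in front, so `u` has to be moved behind it by graded
braided commutativity. -/
theorem mul_tD_bracket (h : IsModel q b) (X Y : Der k H A) {n : ℕ} {u : M} (hu : u ∈ mDeg q n) :
    u * q (tD k H A (Der.bracket X Y)) = (-1 : ℤ) ^ n • term q X Y u 1 := by
  have h1 := legs_hexL (derAct k H A) (derAct k H A) (hAct k H M)
    (fun X Y u => q (tD k H A (bracketL k H A X Y)) * u) X Y u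
  simp only [bracketL_apply] at h1
  rw [h.mul_comm_of_mem hu (tD_mem_mDeg _), Nat.cast_one, ksign_one_natCast]
  congr 1
  simp only [h.hAct_tD, derAct_bracket, map_sum, Finset.sum_mul, h1, term, mul_one]
  rw [Finset.sum_comm]

theorem bracket_word_tD (h : IsModel q b) (n : ℕ) (X : Fin n → Der k H A) (Y : Der k H A) :
    h.bracket (q (word (List.ofFn X))) (q (tD k H A Y)) =
      ∑ i : Fin n, (-1 : ℤ) ^ (i : ℕ) • term q (X i) Y (q (word ((List.ofFn X).take i)))
        (q (word ((List.ofFn X).drop (i + 1)))) := by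
  revert Y
  induction n with
  | zero => simp [h.bracket_one]
  | succ n ih =>
    intro Y
    have hw : q (word (List.ofFn fun i : Fin n => X i.castSucc)) ∈ mDeg q n := by
      have := word_mem_mDeg (q := q) (List.ofFn fun i : Fin n => X i.castSucc)
      rwa [List.length_ofFn] at this
    rw [Fin.sum_univ_castSucc]
    simp only [Fin.val_castSucc, Fin.val_last, take_ofFn_castSucc, drop_ofFn_castSucc,
      take_ofFn_last, drop_ofFn_last, word_nil, map_one]
    conv_lhs => rw [ofFn_castSucc_append, word_append, word_cons, word_nil, mul_one, map_mul]
    rw [h.mul_bracket_of_mem _ (tD_mem_mDeg _) (tD_mem_mDeg _), h.bracket_tD_tD,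
      h.mul_tD_bracket _ _ hw, add_comm, Nat.cast_one, show (1 + 1 : ZMod 2) = 0 from rfl,
      ksign_zero_left, one_smul]
    congr 1
    simp only [h.hAct_tD, ih, Finset.sum_mul, smul_mul_assoc, word_append, word_cons, word_nil,
      mul_one, map_mul]
    rw [Finset.sum_comm]
    refine Finset.sum_congr rfl fun i _ => ?_
    rw [← Finset.smul_sum, ← h.sum_term_mul]
    simp only [h.hAct_tD]

/-- The Leibniz rule puts `y` in front of the bracket; moving it behind undoes the crossing with `x`
and leaves only the one with `Y`. -/
theorem mul_bracket_tD (h : IsModel q b) {m n : ℕ} {x y : M} (hx : x ∈ mDeg q n)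
    (hy : y ∈ mDeg q m) (Y : Der k H A) : ∑ s ∈ legs (Rinv k H),
      hAct k H M s.1 y * h.bracket (hAct k H M s.2 x) (q (tD k H A Y)) =
    ksign m n • ∑ s ∈ legs (Rinv k H),
      h.bracket x (q (tD k H A (derAct k H A s.1 Y))) * hAct k H M s.2 y := by
  have h1 := fun s : H × H => legs_hexL (hAct k H M) (derAct k H A) (hAct k H M)
    (fun x Y y => h.bracket x (q (tD k H A Y)) * y) (hAct k H M s.2 x) Y (hAct k H M s.1 y)
  have h2 := fun r : H × H => legs_Rinv_flip (hAct k H M) (hAct k H M)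
    (fun x y => h.bracket x (q (tD k H A (derAct k H A r.1 Y))) * hAct k H M r.2 y) x y
  have h3 : ∀ s : H × H, hAct k H M s.1 y * h.bracket (hAct k H M s.2 x) (q (tD k H A Y)) =
      ksign m n • _ := fun s => by
    rw [ksign_comm]
    exact h.mul_comm_of_mem (h.hAct_mem hy s.1) (h.bracket_der_mem (h.hAct_mem hx s.2) Y)
  simp only [h3, h.hAct_bracket, h.hAct_tD, Finset.sum_mul, h1, ← Finset.smul_sum]
  congr 1
  rw [Finset.sum_comm]
  refine Finset.sum_congr rfl fun r _ => ?_
  rw [← h2]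

theorem bracket_word_word (h : IsModel q b) (n m : ℕ) (X : Fin n → Der k H A)
    (Y : Fin m → Der k H A) :
    h.bracket (q (word (List.ofFn X))) (q (word (List.ofFn Y))) =
      ∑ i : Fin n, ∑ j : Fin m, (-1 : ℤ) ^ ((i + 1) + (j + 1) : ℕ) •
        (term q (X i) (Y j) (q (word ((List.ofFn X).take i)))
          (q (word ((List.ofFn X).drop (i + 1))) * q (word ((List.ofFn Y).take j))) *
          q (word ((List.ofFn Y).drop (j + 1)))) := by
  rw [Finset.sum_comm]
  induction m with
  | zero => rw [Fin.sum_univ_zero, List.ofFn_zero, word_nil, map_one, h.bracket_one_right]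
  | succ m ih =>
    have hX : q (word (List.ofFn X)) ∈ mDeg q n := by
      have := word_mem_mDeg (q := q) (List.ofFn X)
      rwa [List.length_ofFn] at this
    have hv : q (word (List.ofFn fun i : Fin m => Y i.castSucc)) ∈ mDeg q m := by
      have := word_mem_mDeg (q := q) (List.ofFn fun i : Fin m => Y i.castSucc)
      rwa [List.length_ofFn] at this
    -- The first sign is from the Leibniz rule, the second from moving the word `Y₁ ∧ ⋯ ∧ Yₘ` back
    -- behind the bracket; together only `(-1)ᵐ` remains.
    have hs : ksign m (n + 1) * ksign m n = (-1) ^ m := by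
      rw [ksign_add_right, mul_right_comm, ksign_mul_self, one_mul, ksign_comm, ksign_one_natCast]
    rw [Fin.sum_univ_castSucc]
    simp only [Fin.val_castSucc, Fin.val_last, take_ofFn_castSucc, drop_ofFn_castSucc,
      take_ofFn_last, drop_ofFn_last, word_nil, map_one, mul_one]
    conv_lhs => rw [ofFn_castSucc_append, word_append, word_cons, word_nil, mul_one, map_mul]
    rw [h.bracket_mul_of_mem hX hv, ih, h.mul_bracket_tD hX hv, smul_smul, hs]
    congr 1
    · simp only [Finset.sum_mul, smul_mul_assoc, mul_assoc, word_append, word_cons, word_nil,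
        mul_one, map_mul]
    · simp only [h.bracket_word_tD, Finset.sum_mul, smul_mul_assoc]
      rw [Finset.sum_comm, Finset.smul_sum]
      refine Finset.sum_congr rfl fun i _ => ?_
      rw [← Finset.smul_sum, h.sum_term_mul, smul_smul, ← pow_add]
      congr 1
      rw [show (i : ℕ) + 1 + (m + 1) = m + i + 2 by omega, pow_add _ (m + i) 2]
      norm_num

end IsModel

/-! ### The degree of the bracket. -/

namespace IsModel
variable {k H A : Type*} [CommRing k] [Ring H] [HopfAlgebra k H] [Triangular k H] [Ring A]
  [Algebra k A] [Module H A] [IsScalarTower k H A] [ModuleAlgebra k H A]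
  [BraidedCommutative k H A] {M : Type*}
  [Ring M] [Algebra k M] [Module (Super H) M] [IsScalarTower k (Super H) M]
  {q : TensorAlg k H A →ₐ[k] M} {b : M →ₗ[k] Gen k H A →ₗ[k] M}

theorem word_take_mem {n : ℕ} (X : Fin n → Der k H A) (i : Fin n) :
    q (word ((List.ofFn X).take i)) ∈ mDeg q i := by
  have := word_mem_mDeg (q := q) ((List.ofFn X).take i)
  rwa [List.length_take, List.length_ofFn, min_eq_left i.2.le] at this

theorem word_drop_mem {n : ℕ} (X : Fin n → Der k H A) (i : Fin n) :
    q (word ((List.ofFn X).drop (i + 1))) ∈ mDeg q (n - (i + 1)) := by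
  have := word_mem_mDeg (q := q) ((List.ofFn X).drop (i + 1))
  rwa [List.length_drop, List.length_ofFn] at this

theorem term_mem (h : IsModel q b) (X Y : Der k H A) {u c : M} {i j : ℕ} (hu : u ∈ mDeg q i)
    (hc : c ∈ mDeg q j) : term q X Y u c ∈ mDeg q (1 + (i + j)) :=
  sum_mem fun _ _ => sum_mem fun _ _ =>
    mDeg_mul (tD_mem_mDeg _) (h.hAct_mem (mDeg_mul (h.hAct_mem hu _) hc) _)

theorem bracket_mem_zero (h : IsModel q b) {x y : M} (hx : x ∈ mDeg q 0) (hy : y ∈ mDeg q 0) :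
    h.bracket x y = 0 := by
  obtain ⟨a, rfl⟩ := mem_mDeg_zero hx
  obtain ⟨c, rfl⟩ := mem_mDeg_zero hy
  exact h.bracket_tA_tA a c

theorem bracket_mem_mDeg (h : IsModel q b) {m n l : ℕ} (hl : m + n = l + 1) {x y : M}
    (hx : x ∈ mDeg q m) (hy : y ∈ mDeg q n) : h.bracket x y ∈ mDeg q l := by
  have e : ∀ {i j : ℕ} {x : M}, x ∈ mDeg q i → i = j → x ∈ mDeg q j := fun hx hij => hij ▸ hx
  have hx' : ∀ {m : ℕ} {x : M} (y : M), x ∈ mDeg q (m + 1) →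
      (∀ X : Fin (m + 1) → Der k H A, h.bracket (q (word (List.ofFn X))) y ∈ mDeg q l) →
      h.bracket x y ∈ mDeg q l := fun y hx hX =>
    mDeg_induction (p := fun x => h.bracket x y ∈ mDeg q l)
      (fun x x' hx hx' => by rw [map_add, LinearMap.add_apply]; exact add_mem hx hx')
      (fun c x hx => by
        rw [map_smul, LinearMap.smul_apply]; exact Submodule.smul_mem _ c hx) hX hx
  have hy' : ∀ {n : ℕ} {y : M} (x : M), y ∈ mDeg q (n + 1) →
      (∀ Y : Fin (n + 1) → Der k H A, h.bracket x (q (word (List.ofFn Y))) ∈ mDeg q l) →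
      h.bracket x y ∈ mDeg q l := fun x hy hY =>
    mDeg_induction (p := fun y => h.bracket x y ∈ mDeg q l)
      (fun y y' hy hy' => by rw [map_add]; exact add_mem hy hy')
      (fun c y hy => by rw [map_smul]; exact Submodule.smul_mem _ c hy) hY hy
  cases m with
  | zero =>
    cases n with
    | zero => omega
    | succ n =>
      obtain ⟨a, rfl⟩ := mem_mDeg_zero hx
      refine hy' _ hy fun Y => ?_
      rw [h.bracket_tA_word]
      refine sum_mem fun i _ => zsmul_mem (sum_mem fun r _ => sum_mem fun p _ => e (mDeg_mul
        (mDeg_mul (h.hAct_mem (word_take_mem Y i) _) (tA_mem_mDeg _)) (word_drop_mem Y i)) ?_) _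
      have := i.2
      omega
  | succ m =>
    refine hx' _ hx fun X => ?_
    cases n with
    | zero =>
      obtain ⟨a, rfl⟩ := mem_mDeg_zero hy
      rw [h.bracket_word_tA]
      refine sum_mem fun i _ => zsmul_mem (sum_mem fun r _ => e (mDeg_mul
        (mDeg_mul (word_take_mem X i) (tA_mem_mDeg _)) (h.hAct_mem (word_drop_mem X i) _)) ?_) _
      have := i.2
      omega
    | succ n =>
      refine hy' _ hy fun Y => ?_
      rw [h.bracket_word_word]
      refine sum_mem fun i _ => sum_mem fun j _ => zsmul_mem (e (mDeg_mul (h.term_mem _ _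
        (word_take_mem X i) (mDeg_mul (word_drop_mem X i) (word_take_mem Y j)))
        (word_drop_mem Y j)) ?_) _
      have := i.2
      have := j.2
      omega

end IsModel

/-! ### Passage from the tensor algebra to multivector fields. -/

section Descent
variable {k H A : Type*} [CommRing k] [Ring H] [HopfAlgebra k H] [Triangular k H] [Ring A]
  [Algebra k A] [Module H A] [IsScalarTower k H A] [ModuleAlgebra k H A]
  [BraidedCommutative k H A] {M N : Type*} [Ring M] [Algebra k M] [AddCommGroup N] [Module k N]

/-- A surjection of the tensor algebra with the same kernel as the projection to the multivector
fields. -/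
structure IsProj (q : TensorAlg k H A →ₐ[k] M) : Prop where
  surjective : Function.Surjective q
  map_eq_zero : ∀ x, q x = 0 ↔ tM k H A x = 0

namespace IsProj
variable {q : TensorAlg k H A →ₐ[k] M}

theorem apply_eq (h : IsProj q) (f : TensorAlg k H A →ₗ[k] N)
    (hf : ∀ x, tM k H A x = 0 → f x = 0) {x y : TensorAlg k H A} (hxy : q x = q y) :
    f x = f y := by
  have h1 : f (x - y) = 0 := hf _ ((h.map_eq_zero _).1 ((map_sub q x y).trans
    (sub_eq_zero.2 hxy)))
  exact sub_eq_zero.1 ((map_sub f x y).symm.trans h1)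

/-- Linear maps on the quotient from linear maps on tensors. -/
noncomputable def descend (h : IsProj q) (f : TensorAlg k H A →ₗ[k] N)
    (hf : ∀ x, tM k H A x = 0 → f x = 0) : M →ₗ[k] N where
  toFun x := f (Function.surjInv h.surjective x)
  map_add' x y := (h.apply_eq f hf (by
    simp only [map_add, Function.surjInv_eq h.surjective])).trans
      (map_add f _ _)
  map_smul' c x := (h.apply_eq f hf (by
    simp only [map_smul, Function.surjInv_eq h.surjective])).trans (map_smul f c _)

theorem descend_apply (h : IsProj q) (f : TensorAlg k H A →ₗ[k] N)
    (hf : ∀ x, tM k H A x = 0 → f x = 0) (x : TensorAlg k H A) :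
    h.descend f hf (q x) = f x :=
  h.apply_eq f hf (Function.surjInv_eq h.surjective _)

theorem ext (h : IsProj q) {f g : M →ₗ[k] N} (hfg : ∀ x, f (q x) = g (q x)) : f = g :=
  LinearMap.ext fun x => by
    obtain ⟨x, rfl⟩ := h.surjective x
    exact hfg x

theorem map_tAct_eq_zero (h : IsProj q) {x : TensorAlg k H A} (hx : tM k H A x = 0)
    (ξ : Super H) : q (tAct k H A ξ x) = 0 := (h.map_eq_zero _).2 (tM_tAct hx ξ)

/-- The action on the quotient as a bilinear map. -/
noncomputable def actL (h : IsProj q) : M →ₗ[k] Super H →ₗ[k] M :=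
  h.descend ((tAct k H A).toLinearMap.flip.compr₂ q.toLinearMap)
    (fun _ hx => LinearMap.ext fun ξ => h.map_tAct_eq_zero hx ξ)

theorem actL_apply (h : IsProj q) (x : TensorAlg k H A) (ξ : Super H) :
    h.actL (q x) ξ = q (tAct k H A ξ x) := by
  rw [actL, descend_apply]
  rfl

/-- The action on the quotient. -/
noncomputable def act (h : IsProj q) : Super H →ₐ[k] Module.End k M :=
  AlgHom.ofLinearMap h.actL.flip
    (h.ext fun x => by rw [LinearMap.flip_apply, actL_apply, map_one]; rfl)
    (fun ξ η => h.ext fun x => by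
      rw [Module.End.mul_apply, LinearMap.flip_apply, LinearMap.flip_apply, LinearMap.flip_apply,
        actL_apply, actL_apply, actL_apply, map_mul, Module.End.mul_apply])

/-- The quotient as a module. -/
noncomputable abbrev module (h : IsProj q) : Module (Super H) M :=
  Module.compHom _ h.act.toRingHom

theorem isScalarTower (h : IsProj q) :
    letI := h.module
    IsScalarTower k (Super H) M :=
  letI := h.module
  ⟨fun c ξ x => by
    change h.act (c • ξ) x = c • h.act ξ x
    rw [map_smul, LinearMap.smul_apply]⟩

/-- The brackets with generators on the quotient. -/
noncomputable def br (h : IsProj q) : M →ₗ[k] Gen k H A →ₗ[k] M :=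
  h.descend ((tBr k H A).compr₂ q.toLinearMap)
    (fun _ hx => LinearMap.ext fun w => (h.map_eq_zero _).2 ((nullBr_of_tM hx).2 w))

/-- The brackets descend because every tensor in the kernel is null in the sense of `NullBr`; the
anticommutation of derivations is the relation for `X ⊗ Y + σ(X, Y)`. -/
theorem isModel (h : IsProj q) :
    letI := h.module
    haveI := h.isScalarTower
    IsModel q h.br :=
  letI := h.module
  have := h.isScalarTower
  { surjective := h.surjective
    smul_map := fun ξ x => h.actL_apply x ξ
    br_map := fun x w => by rw [br, descend_apply]; rfl
    map_sig := fun X Y => by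
      have := (h.map_eq_zero _).2 (NullBr.mul_add_sig X Y).1
      rw [map_add] at this
      exact eq_neg_of_add_eq_zero_left this }

end IsProj

theorem isProj_tM : IsProj (M := MV k H A) (tM k H A) := ⟨tM_surjective, fun _ => Iff.rfl⟩

theorem wedge_eq (l : List (Der k H A)) : wedge l = tM k H A (word l) := by
  rw [wedge, word, map_list_prod, List.map_map]
  congr 1
  exact List.map_congr_left fun X _ => ofDer_eq k H A X

theorem degree_eq (n : ℕ) : degree k H A n = mDeg (M := MV k H A) (tM k H A) n := by
  rw [degree, mDeg]
  simp only [wedge_eq]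
  rfl

end Descent

/-! ### Injectivity of `A` and of the braided derivations into multivector fields. -/

section Representation
variable {k H A : Type*} [CommRing k] [Ring H] [HopfAlgebra k H] [Triangular k H] [Ring A]
  [Algebra k A] [Module H A] [IsScalarTower k H A] [ModuleAlgebra k H A]
  [BraidedCommutative k H A]

section
variable (k H A)

/-- The representation of the tensor algebra on `A ⊕ Der` in which a braided derivation `X` sends
`(b, Y)` to `(0, X · b)`. -/
noncomputable def genRep : TensorAlg k H A →ₐ[k] Module.End k (Gen k H A) :=
  tLift
    (AlgHom.ofLinearMap
      (LinearMap.mk₂ k (fun a w => Gen.inl k H A (a * Gen.fst k H A w) +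
          Gen.inr k H A (lactL k H A a (Gen.snd k H A w)))
        (fun a c w => by simp only [add_mul, map_add, LinearMap.add_apply]; abel)
        (fun r a w => by simp only [smul_mul_assoc, map_smul, LinearMap.smul_apply, smul_add])
        (fun a v w => by simp only [mul_add, map_add]; abel)
        (fun r a w => by simp only [mul_smul_comm, map_smul, smul_add]))
      (LinearMap.ext fun w => Gen.ext (by simp) (by simp [Der.lact]; rfl))
      (fun a c => LinearMap.ext fun w => Gen.ext (by simp [mul_assoc]) (by simp [lact_lact])))
    (LinearMap.mk₂ k (fun X w => Gen.inr k H A (ractL k H A X (Gen.fst k H A w)))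
      (fun X Y w => by simp only [map_add, LinearMap.add_apply])
      (fun r X w => by simp only [map_smul, LinearMap.smul_apply])
      (fun X v w => by simp only [map_add])
      (fun r X w => by simp only [map_smul]))
    (fun a X => LinearMap.ext fun w => Gen.ext (by simp) (by simp [lact_ract]))
    (fun X a => LinearMap.ext fun w => Gen.ext (by simp) (by simp [ract_ract]))

end

theorem genRep_tA (a : A) : genRep k H A (tA k H A a) (Gen.inl k H A 1) = Gen.inl k H A a := by
  rw [genRep, tLift_tA]
  refine Gen.ext (by simp) ?_
  simp only [AlgHom.ofLinearMap_apply, LinearMap.mk₂_apply, map_add, Gen.snd_inl,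
    map_zero, zero_add]

theorem genRep_tD (X : Der k H A) (w : Gen k H A) : genRep k H A (tD k H A X) w =
    Gen.inr k H A (ractL k H A X (Gen.fst k H A w)) := by
  rw [genRep, tLift_tD]
  rfl

theorem genRep_words {n : ℕ} {x : TensorAlg k H A} (hx : x ∈ words k H A (n + 2)) :
    genRep k H A x = 0 := by
  refine words_ext (F := (genRep k H A).toLinearMap) (G := 0) (fun l hl => ?_) hx
  match l with
  | [] => simp at hl
  | [X] => simp at hl
  | X :: Y :: v =>
    refine LinearMap.ext fun w => ?_
    rw [AlgHom.toLinearMap_apply, word_cons, word_cons, map_mul, map_mul, Module.End.mul_apply,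
      Module.End.mul_apply, genRep_tD, genRep_tD, Gen.fst_inr, map_zero, map_zero]
    rfl

/-- An exchange involves two positions `i < j`, so relations have length at least two and act as
zero. The values on `(1, 0)` then recover `a` and `X` from their classes. -/
theorem genRep_eq_zero {x : TensorAlg k H A} (hx : tM k H A x = 0) : genRep k H A x = 0 :=
  ker_tM_induction (p := fun x => genRep k H A x = 0) (map_zero _)
    (fun hx hy => by rw [map_add, hx, hy, add_zero]) (fun hx => by rw [map_mul, hx, mul_zero])
    (fun hx => by rw [map_mul, hx, zero_mul])
    (fun x h => by
      obtain ⟨-, i, m, n, hx, -⟩ := h.exists_exch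
      exact genRep_words (n := i + m + n) (by convert hx using 2; omega)) hx

theorem ofAlg_injective : Function.Injective (ofAlg k H : A →ₐ[k] MV k H A) :=
  (injective_iff_map_eq_zero _).2 fun a ha => by
    have h := genRep_tA (k := k) (H := H) a
    rw [genRep_eq_zero (x := tA k H A a) ha, LinearMap.zero_apply] at h
    simpa using (congrArg (Gen.fst k H A) h).symm

theorem ofDer_injective : Function.Injective (ofDer : Der k H A →ₗ[k] MV k H A) :=
  (injective_iff_map_eq_zero _).2 fun X hX => by
    have h := genRep_tD X (Gen.inl k H A 1)
    rw [genRep_eq_zero (x := tD k H A X) ((ofDer_eq k H A X).symm.trans hX), LinearMap.zero_apply,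
      Gen.fst_inl, ractL_apply, ract_one] at h
    simpa using (congrArg (Gen.snd k H A) h).symm

end Representation

/-! ### The grading by means of polynomials with coefficients in the quotient. -/

section Grading
open Polynomial
variable {k H A : Type*} [CommRing k] [Ring H] [HopfAlgebra k H] [Triangular k H] [Ring A]
  [Algebra k A] [Module H A] [IsScalarTower k H A] [ModuleAlgebra k H A]
  [BraidedCommutative k H A] {M : Type*} [Ring M] [Algebra k M]

/-- The homomorphism that sends a tensor `x` of degree `n` to `q(x) Tⁿ`. -/
noncomputable def gradHom (q : TensorAlg k H A →ₐ[k] M) : TensorAlg k H A →ₐ[k] M[X] :=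
  tLift ((CAlgHom (R := k)).comp (q.comp (tA k H A)))
    (LinearMap.mulRight k X ∘ₗ (CAlgHom (R := k)).toLinearMap ∘ₗ q.toLinearMap ∘ₗ tD k H A)
    (fun a Y => by simp [← mul_assoc, ← map_mul, tA_mul_tD])
    (fun Y a => by simp [mul_assoc, X_mul_C, ← tD_mul_tA])

theorem gradHom_tA (q : TensorAlg k H A →ₐ[k] M) (a : A) :
    gradHom q (tA k H A a) = C (q (tA k H A a)) := by
  rw [gradHom, tLift_tA]
  rfl

theorem gradHom_words (q : TensorAlg k H A →ₐ[k] M) {n : ℕ} {x : TensorAlg k H A}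
    (hx : x ∈ words k H A n) : gradHom q x = C (q x) * X ^ n := by
  refine words_ext (F := (gradHom q).toLinearMap)
    (G := LinearMap.mulRight k (X ^ n) ∘ₗ (CAlgHom (R := k)).toLinearMap ∘ₗ q.toLinearMap)
    (fun l hl => ?_) hx
  subst hl
  change gradHom q (word l) = C (q (word l)) * X ^ l.length
  clear hx
  induction l with
  | nil => simp
  | cons Y l ih =>
    have h : gradHom q (tD k H A Y) = C (q (tD k H A Y)) * X := by
      rw [gradHom, tLift_tD]
      rfl
    rw [word_cons, map_mul, h, ih, map_mul, C_mul, List.length_cons, pow_succ', mul_assoc,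
      ← mul_assoc X, X_mul_C, mul_assoc, mul_assoc]

namespace IsProj
variable {q : TensorAlg k H A →ₐ[k] M}

/-- The relations are homogeneous, so each is sent to its zero class times a power of the variable.
-/
theorem gradHom_eq_zero (h : IsProj q) {x : TensorAlg k H A} (hx : tM k H A x = 0) :
    gradHom q x = 0 :=
  ker_tM_induction (p := fun x => gradHom q x = 0) (map_zero _)
    (fun hx hy => by rw [map_add, hx, hy, add_zero]) (fun hx => by rw [map_mul, hx, mul_zero])
    (fun hx => by rw [map_mul, hx, zero_mul])
    (fun x hr => by
      obtain ⟨-, i, m, n, hx, -⟩ := hr.exists_exch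
      rw [gradHom_words _ hx, (h.map_eq_zero x).2 (tM_rel hr), C_0, zero_mul]) hx

/-- The homogeneous components. -/
noncomputable def component (h : IsProj q) (n : ℕ) : M →ₗ[k] M :=
  h.descend ((Polynomial.lcoeff M n).restrictScalars k ∘ₗ (gradHom q).toLinearMap) fun _ hx => by
    rw [LinearMap.comp_apply, AlgHom.toLinearMap_apply, h.gradHom_eq_zero hx, map_zero]

theorem component_of_mem (h : IsProj q) {m : ℕ} (n : ℕ) {x : M} (hx : x ∈ mDeg q m) :
    h.component n x = if n = m then x else 0 := by
  have hc : ∀ t, h.component n (q t) = (gradHom q t).coeff n := fun t => h.descend_apply _ _ t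
  cases m with
  | zero =>
    obtain ⟨a, rfl⟩ := mem_mDeg_zero hx
    rw [hc, gradHom_tA, coeff_C]
  | succ m =>
    obtain ⟨t, ht, rfl⟩ := mem_mDeg_succ hx
    rw [hc, gradHom_words _ ht, coeff_C_mul_X_pow]

theorem isInternal_mDeg (h : IsProj q) : DirectSum.IsInternal (mDeg q) := by
  constructor
  · have hn : ∀ n x, h.component n (DirectSum.coeAddMonoidHom (mDeg q) x) = x n := fun n x => by
      induction x using DirectSum.induction_on with
      | zero => simp
      | of m y =>
        rw [DirectSum.coeAddMonoidHom_of, h.component_of_mem n y.2]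
        split_ifs with hm
        · subst hm; rw [DirectSum.of_eq_same]
        · rw [DirectSum.of_eq_of_ne _ _ _ hm]; rfl
      | add x y hx hy => rw [map_add, map_add, hx, hy]; rfl
    intro x y hxy
    exact DFinsupp.ext fun n => Subtype.ext (by rw [← hn, ← hn]; exact congrArg _ hxy)
  · intro x
    obtain ⟨x, rfl⟩ := h.surjective x
    have hs : ∀ n, ∀ y ∈ mDeg q n, ∃ z, DirectSum.coeAddMonoidHom (mDeg q) z = y := fun n y hy =>
      ⟨DirectSum.of (fun n => mDeg q n) n ⟨y, hy⟩, DirectSum.coeAddMonoidHom_of _ _ _⟩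
    refine tInduction_word (p := fun x => ∃ z, DirectSum.coeAddMonoidHom (mDeg q) z = q x) ?_
      (fun a => hs 0 _ (tA_mem_mDeg a)) (fun n x hx => hs _ _ (words_mem_mDeg hx)) x
    rintro x y ⟨z, hz⟩ ⟨w, hw⟩
    exact ⟨z + w, by rw [map_add, hz, hw, map_add]⟩

end IsProj

theorem isInternal_degree : DirectSum.IsInternal (degree k H A) := by
  have h : degree k H A = mDeg (M := MV k H A) (tM k H A) := funext degree_eq
  rw [h]
  exact isProj_tM.isInternal_mDeg

end Grading

/-! ### Spanning, identification of the lowest degrees, and the signs in the required form. -/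

section Properties
variable {k H A : Type*} [CommRing k] [Ring H] [HopfAlgebra k H] [Triangular k H] [Ring A]
  [Algebra k A] [Module H A] [IsScalarTower k H A] [ModuleAlgebra k H A]
  [BraidedCommutative k H A] {M N : Type*} [Ring M] [Algebra k M] [AddCommMonoid N] [Module k N]
  {q : TensorAlg k H A →ₐ[k] M}

/-- Pure wedge products suffice, because a coefficient in `A` is absorbed into the first factor.
Both uniqueness statements rest on this. -/
theorem linearMap_ext (hq : Function.Surjective q) {f g : M →ₗ[k] N}
    (hA : ∀ a, f (q (tA k H A a)) = g (q (tA k H A a)))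
    (hw : ∀ n, 0 < n → ∀ X : Fin n → Der k H A,
      f (q (word (List.ofFn X))) = g (q (word (List.ofFn X)))) : f = g :=
  LinearMap.ext fun x => by
    obtain ⟨x, rfl⟩ := hq x
    refine tInduction_word (p := fun x => f (q x) = g (q x))
      (fun x y hx hy => by simp only [map_add, hx, hy]) hA (fun n x hx => ?_) x
    exact mDeg_induction (p := fun x => f x = g x) (fun x y hx hy => by rw [map_add, map_add, hx, hy])
      (fun c x hx => by rw [map_smul, map_smul, hx]) (hw _ n.succ_pos) (words_mem_mDeg hx)

theorem gradedMonoid_mDeg : SetLike.GradedMonoid (mDeg q) where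
  one_mem := by
    have := tA_mem_mDeg (q := q) (1 : A)
    rwa [map_one, map_one] at this
  mul_mem _ _ _ _ hx hy := mDeg_mul hx hy

theorem mem_mDeg_zero_iff {x : M} : x ∈ mDeg q 0 ↔ ∃ a, q (tA k H A a) = x :=
  ⟨fun hx => (mem_mDeg_zero hx).imp fun _ => Eq.symm, by rintro ⟨a, rfl⟩; exact tA_mem_mDeg a⟩

theorem mem_mDeg_one_iff {x : M} : x ∈ mDeg q 1 ↔ ∃ X, q (tD k H A X) = x := by
  refine ⟨fun hx => mDeg_induction (p := fun x => ∃ X, q (tD k H A X) = x) ?_ ?_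
    (fun X => ⟨X 0, ?_⟩) hx, by rintro ⟨X, rfl⟩; exact tD_mem_mDeg X⟩
  · rintro _ _ ⟨X, rfl⟩ ⟨Y, rfl⟩
    exact ⟨X + Y, by rw [map_add, map_add]⟩
  · rintro c _ ⟨X, rfl⟩
    exact ⟨c • X, by rw [map_smul, map_smul]⟩
  · rw [List.ofFn_succ, List.ofFn_zero, word_cons, word_nil, mul_one]

theorem intCast_natCast_sub_one (n : ℕ) : (((n : ℤ) - 1 : ℤ) : ZMod 2) = n + 1 := by
  push_cast
  rw [sub_eq_add_neg]
  rfl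

variable [Module (Super H) M] [IsScalarTower k (Super H) M]

namespace IsModel
variable {b : M →ₗ[k] Gen k H A →ₗ[k] M}

theorem mul_tA (h : IsModel q b) (x : M) (a : A) : x * q (tA k H A a) =
    ∑ r ∈ legs (Rinv k H), q (tA k H A (r.1 • a)) * hAct k H M r.2 x := by
  have key : ∀ {n x}, x ∈ mDeg q n → x * q (tA k H A a) =
      ∑ r ∈ legs (Rinv k H), q (tA k H A (r.1 • a)) * hAct k H M r.2 x := fun hx => by
    rw [h.mul_comm_of_mem hx (tA_mem_mDeg a), Nat.cast_zero, ksign_zero_left, one_smul]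
    simp only [h.hAct_tA]
  obtain ⟨x, rfl⟩ := h.surjective x
  refine tInduction_word (p := fun x => q x * q (tA k H A a) =
    ∑ r ∈ legs (Rinv k H), q (tA k H A (r.1 • a)) * hAct k H M r.2 (q x))
    (fun x y hx hy => ?_) (fun c => key (tA_mem_mDeg c)) (fun n x hx => key (words_mem_mDeg hx)) x
  simp only [map_add, add_mul, mul_add, Finset.sum_add_distrib, hx, hy]

theorem bracket_skew_negOnePow (h : IsModel q b) {m n : ℕ} {x y : M} (hx : x ∈ mDeg q m)
    (hy : y ∈ mDeg q n) : h.bracket y x =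
      -(Int.negOnePow (((m : ℤ) - 1) * ((n : ℤ) - 1)) • ∑ r ∈ legs (Rinv k H),
        h.bracket (hAct k H M r.1 x) (hAct k H M r.2 y)) := by
  rw [h.bracket_skew_of_mem hx hy, Units.smul_def, coe_negOnePow_mul, intCast_natCast_sub_one,
    intCast_natCast_sub_one]

theorem bracket_jacobi_negOnePow (h : IsModel q b) {m n : ℕ} {x y : M} (hx : x ∈ mDeg q m)
    (hy : y ∈ mDeg q n) (z : M) : h.bracket x (h.bracket y z) = h.bracket (h.bracket x y) z +
      Int.negOnePow (((m : ℤ) - 1) * ((n : ℤ) - 1)) • ∑ r ∈ legs (Rinv k H),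
        h.bracket (hAct k H M r.1 y) (h.bracket (hAct k H M r.2 x) z) := by
  rw [h.bracket_jacobi_of_mem hx hy, Units.smul_def, coe_negOnePow_mul, ksign_comm,
    intCast_natCast_sub_one, intCast_natCast_sub_one]

theorem bracket_mul_negOnePow (h : IsModel q b) {m n : ℕ} {x y : M} (hx : x ∈ mDeg q m)
    (hy : y ∈ mDeg q n) (z : M) : h.bracket x (y * z) = h.bracket x y * z +
      Int.negOnePow (((m : ℤ) - 1) * (n : ℤ)) • ∑ r ∈ legs (Rinv k H),
        hAct k H M r.1 y * h.bracket (hAct k H M r.2 x) z := by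
  rw [h.bracket_mul_of_mem hx hy, Units.smul_def, coe_negOnePow_mul, ksign_comm,
    intCast_natCast_sub_one, Int.cast_natCast]

end IsModel
end Properties

/-! ### The action and the bracket on multivector fields, and their uniqueness. -/

section MV
variable {k H A : Type*} [CommRing k] [Ring H] [HopfAlgebra k H] [Triangular k H] [Ring A]
  [Algebra k A] [Module H A] [IsScalarTower k H A] [ModuleAlgebra k H A]
  [BraidedCommutative k H A]

noncomputable instance : Module (Super H) (MV k H A) := isProj_tM.module

instance : IsScalarTower k (Super H) (MV k H A) := isProj_tM.isScalarTower

section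
variable (k H A)

/-- The brackets of multivector fields with generators. -/
noncomputable def mvBr : MV k H A →ₗ[k] Gen k H A →ₗ[k] MV k H A := isProj_tM.br

/-- The action on multivector fields. -/
noncomputable def mvAct : H →ₐ[k] Module.End k (MV k H A) := hAct k H (MV k H A)

end

theorem isModel_tM : IsModel (M := MV k H A) (tM k H A) (mvBr k H A) := isProj_tM.isModel

section
variable (k H A)

/-- The braided Schouten-Nijenhuis bracket. -/
noncomputable def schouten : MV k H A →ₗ[k] MV k H A →ₗ[k] MV k H A :=
  isModel_tM.bracket

end

theorem isInducedAction_mvAct : IsInducedAction (mvAct k H A) where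
  act_alg ξ a := isModel_tM.hAct_tA ξ a
  act_wedge ξ l := by
    rw [wedge_eq]
    have h : toTensorAlg k H A (diagonal ξ (tensor l)) = tActH k H A ξ (word l) := by
      rw [toTensorAlg_diagonal, toTensorAlg_tensor]
    exact (isModel_tM.hAct_map ξ (word l)).trans (congrArg (tM k H A) h.symm)

theorem mem_degree_one_iff {x : MV k H A} : x ∈ degree k H A 1 ↔ ∃ X, ofDer X = x := by
  have h : ∀ X : Der k H A, ofDer X = tM k H A (tD k H A X) := ofDer_eq k H A
  simp only [h]
  rw [degree_eq]
  have h1 := @mem_mDeg_one_iff k H A _ _ _ _ _ _ _ _ _ _ (MV k H A) _ _ (tM k H A) x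
  exact h1

theorem isEquivariantGradedAlgebra_mvAct : IsEquivariantGradedAlgebra (mvAct k H A) where
  gradedMonoid := by
    have h : degree k H A = mDeg (M := MV k H A) (tM k H A) := funext degree_eq
    rw [h]
    exact gradedMonoid_mDeg
  isInternal := isInternal_degree
  ofAlg_injective := ofAlg_injective
  range_ofAlg := Submodule.ext fun x => by
    rw [degree_eq]
    exact (mem_mDeg_zero_iff (M := MV k H A) (q := tM k H A)).symm
  ofDer_injective := ofDer_injective
  range_ofDer := Submodule.ext fun _ => mem_degree_one_iff.symm
  act_degree ξ n x hx := by
    rw [degree_eq] at hx ⊢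
    exact isModel_tM.hAct_mem hx ξ
  act_one := isModel_tM.hAct_one
  act_mul := isModel_tM.isMulAction_hAct
  act_left ξ a x := by
    refine (isModel_tM.isMulAction_hAct ξ _ x).trans (Finset.sum_congr rfl fun p _ => ?_)
    exact congrArg (· * _) (isModel_tM.hAct_tA _ _)
  act_right ξ a x := by
    refine (isModel_tM.isMulAction_hAct ξ x _).trans (Finset.sum_congr rfl fun p _ => ?_)
    exact congrArg (_ * ·) (isModel_tM.hAct_tA _ _)
  braided_symmetric a x := isModel_tM.mul_tA x a

theorem isSchoutenNijenhuis_schouten : IsSchoutenNijenhuis (mvAct k H A) (schouten k H A) where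
  alg_alg a c := isModel_tM.bracket_tA_tA a c
  mv_alg n _ X a := by
    simp only [before, after, wedge_eq]
    exact isModel_tM.bracket_word_tA n X a
  alg_mv n _ X a := by
    simp only [before, after, wedge_eq]
    exact isModel_tM.bracket_tA_word n X a
  mv_mv n m _ _ X Y := by
    simp only [before, after, wedge_eq, ofDer_eq, mul_assoc]
    refine (isModel_tM.bracket_word_word n m X Y).trans ?_
    simp only [IsModel.term, Finset.sum_mul, mul_assoc]
    rfl

theorem isBraidedGerstenhaberBracket_schouten :
    IsBraidedGerstenhaberBracket (mvAct k H A) (schouten k H A) where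
  degree_zero x hx y hy := by
    rw [degree_eq] at hx hy
    exact isModel_tM.bracket_mem_zero hx hy
  degree_add p q n hn x hx y hy := by
    rw [degree_eq] at hx hy ⊢
    exact isModel_tM.bracket_mem_mDeg hn hx hy
  equivariant := isModel_tM.hAct_bracket
  skew p q x hx y hy := by
    rw [degree_eq] at hx hy
    exact isModel_tM.bracket_skew_negOnePow hx hy
  jacobi p q x hx y hy z := by
    rw [degree_eq] at hx hy
    exact isModel_tM.bracket_jacobi_negOnePow hx hy z
  leibniz p q x hx y hy z := by
    rw [degree_eq] at hx hy
    exact isModel_tM.bracket_mul_negOnePow hx hy z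

theorem mv_linearMap_ext {N : Type*} [AddCommMonoid N] [Module k N] {f g : MV k H A →ₗ[k] N}
    (hA : ∀ a, f (ofAlg k H a) = g (ofAlg k H a))
    (hw : ∀ n, 0 < n → ∀ X : Fin n → Der k H A,
      f (wedge (List.ofFn X)) = g (wedge (List.ofFn X))) : f = g :=
  linearMap_ext (M := MV k H A) tM_surjective hA fun n hn X => by
    have := hw n hn X
    rwa [wedge_eq] at this

theorem IsInducedAction.eq {ρ ρ' : H →ₐ[k] Module.End k (MV k H A)} (h : IsInducedAction ρ)
    (h' : IsInducedAction ρ') : ρ' = ρ :=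
  AlgHom.ext fun ξ => mv_linearMap_ext (f := ρ' ξ) (g := ρ ξ) (fun a => by rw [h.act_alg, h'.act_alg])
    fun n _ X => by rw [h.act_wedge, h'.act_wedge]

/-- The four formulas prescribe the bracket on all pairs from a spanning set; one argument is
extended linearly after the other. -/
theorem IsSchoutenNijenhuis.eq {ρ : H →ₐ[k] Module.End k (MV k H A)}
    {B B' : MV k H A →ₗ[k] MV k H A →ₗ[k] MV k H A} (h : IsSchoutenNijenhuis ρ B)
    (h' : IsSchoutenNijenhuis ρ B') : B' = B := by
  refine LinearMap.ext₂ fun x y => ?_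
  have h1 : ∀ a y, B' (ofAlg k H a) y = B (ofAlg k H a) y := fun a y => LinearMap.congr_fun
    (mv_linearMap_ext (f := B' (ofAlg k H a)) (g := B (ofAlg k H a))
      (fun c => by rw [h.alg_alg, h'.alg_alg])
      fun n hn X => by rw [h.alg_mv n hn, h'.alg_mv n hn]) y
  have h2 : ∀ n, 0 < n → ∀ (X : Fin n → Der k H A) y,
      B' (wedge (List.ofFn X)) y = B (wedge (List.ofFn X)) y := fun n hn X y =>
    LinearMap.congr_fun (mv_linearMap_ext (f := B' (wedge (List.ofFn X)))
      (g := B (wedge (List.ofFn X))) (fun c => by rw [h.mv_alg n hn, h'.mv_alg n hn])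
      fun m hm Y => by rw [h.mv_mv n m hn hm, h'.mv_mv n m hn hm]) y
  exact LinearMap.congr_fun (mv_linearMap_ext (f := B'.flip y) (g := B.flip y)
    (fun a => h1 a y) fun n hn X => h2 n hn X y) x

end MV

end BraidedMV

theorem mainTheorem10 {k H A : Type*} [CommRing k] [Ring H] [HopfAlgebra k H]
    [BraidedMV.Triangular k H] [Ring A] [Algebra k A] [Module H A] [IsScalarTower k H A]
    [BraidedMV.ModuleAlgebra k H A] [BraidedMV.BraidedCommutative k H A] :
    ∃ act : H →ₐ[k] Module.End k (BraidedMV.MV k H A),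
      BraidedMV.IsInducedAction act ∧
      (∀ act' : H →ₐ[k] Module.End k (BraidedMV.MV k H A),
        BraidedMV.IsInducedAction act' → act' = act) ∧
      BraidedMV.IsEquivariantGradedAlgebra act ∧
      ∃ B : BraidedMV.MV k H A →ₗ[k] BraidedMV.MV k H A →ₗ[k] BraidedMV.MV k H A,
        BraidedMV.IsSchoutenNijenhuis act B ∧
        (∀ B' : BraidedMV.MV k H A →ₗ[k] BraidedMV.MV k H A →ₗ[k] BraidedMV.MV k H A,
          BraidedMV.IsSchoutenNijenhuis act B' → B' = B) ∧
        BraidedMV.IsBraidedGerstenhaberBracket act B :=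
  ⟨BraidedMV.mvAct k H A, BraidedMV.isInducedAction_mvAct,
    fun _ h => BraidedMV.isInducedAction_mvAct.eq h,
    BraidedMV.isEquivariantGradedAlgebra_mvAct, BraidedMV.schouten k H A,
    BraidedMV.isSchoutenNijenhuis_schouten,
    fun _ h => BraidedMV.isSchoutenNijenhuis_schouten.eq h,
    BraidedMV.isBraidedGerstenhaberBracket_schouten⟩
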